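/- **Setting.** Let $n,k\ge 1$ with $k\mid n$. The graph $G_{n,k}$ consists of $n/k$ cliques $C_1,\dots,C_{n/k}$ of size $k$, consecutive cliques being joined by a perfect matching (nodes $(i,j)$ with $i\le n/k$, $j\le k$; $(i,j)\sim(i,j')$ for $j\ne j'$, and $(i,j)\sim(i\pm1,j)$). Each node $u$ holds a message $m_u$. In each synchronous round every node sends one message to all its neighbours (no failures). Node $u$ maintains the set $R_u$ of known messages (initially $\{m_u\}$), the set $S_u$ of sent messages (initially $\emptyset$), the number $cnt_{u,v}$ of receptions of $m_v$ (initially $1$ if $v=u$, else $0$), and $B_u=R_u\setminus S_u$. Information spreading is complete when every $R_u$ contains all $n$ messages. **Parameters.** Logarithms are to base $2$. For constants $\alpha,d>0$ and $0<\hat c\le\frac12$ put $\tau=\lceil\alpha\log n\rceil$, $\tau'=\lceil 8d\tau\log^2 n\rceil$, $T=\tau/2$. A message $m_v\in R_u$ is *fresh* for $u$ if $cnt_{u,v}<T$. **Algorithm 2.** All random choices of distinct nodes are independent. The phases are: round 0, in which every $u$ sends $m_u$; one random phase of $\tau$ rounds; then, forever, alternately a ranking phase of $\tau'$ rounds and a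 shuffle phase of $8\tau$ rounds. In round 0 and in the random and ranking phases, a message sent by $u$ is added to $S_u$, and each received message $m_v$ is added to $R_u$ with $cnt_{u,v}$ increased by one per reception. A node whose set $\hat B_u$ (below) is empty sends its own message. - *Random phase.* At the start $\hat B_u:=B_u$; in each round $u$ removes a uniformly random message from $\hat B_u$ and sends it. - *Ranking phase.* At the start $\hat B_u:=B_u$, except that after a shuffle phase the messages of $B_u$ that have $cnt_{u,v}<T$ and were not selected at the end of that shuffle phase are left out. The $b$ messages of $\hat B_u$ are sorted into a list: first those selected at the end of the preceding shuffle phase (if any), in arbitrary order, then the others by increasing $cnt$, ties broken arbitrarily. The message at position $r$ gets probability $\frac1{rH_b}$, $H_b=\sum_{i=1}^b\frac1i$. In each round $u$ draws a message from $\hat B_u$ according to these probabilities, renormalized over the messages still in $\hat B_u$, removes it from $\hat B_u$ and sends it. - *Shuffle phase.* At the start $\hat B_u$ is the set of fresh messages in $B_u$. In each round $u$ removes an arbitrary message from $\hat B_u$ and sends it. The variables $R_u,S_u,cnt$ do not change during the phase; instead $phasecnt_{u,v}$ counts the receptions of $m_v$ in the phase, starting from $1$ if $m_v$ was in $\hat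 B_u$ at the start and from $0$ otherwise. At the end, $R$ is the set of messages with $phasecnt_{u,v}\ge 1$, $phasecnt_{u,v}\ge\hat c\,T$ and $cnt_{u,v}<T$. Then $R$ is added to $R_u$, and $u$ selects $\min(4\tau,|R|)$ messages of $R$ uniformly at random. The arbitrary choices are made by any fixed rule that may depend on the node, the round and the node's local state. **Theorem.** Let $c\ge1$, $\alpha>48c+96$ and $d>c+3$. There is a constant $C=C(c,\alpha,d)>0$ such that for every $\hat c\in(0,\frac12]$ and every $k=k(n)$ with $k=\omega(\log^3 n)$ the following holds for all sufficiently large $n$ with $k\mid n$: for every rule for the arbitrary choices, Algorithm 2, run without failures on $G_{n,k}$, completes information spreading within $C\,\frac{n\log^3 n}{k}$ rounds with probability at least $1-\frac1{n^c}$. -/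

import Mathlib

open Filter
open scoped ENNReal NNReal

noncomputable section

namespace InfoSpreading

/-- The graph `G_{n,k}`: a path of `n / k` cliques `C_1, …, C_{n/k}`, each of size `k`, consecutive
cliques being joined by a perfect matching.  The node `(i, j)` is the node of the `i`-th clique that
lies on the `j`-th layer. -/
def cliquePath (n k : ℕ) : SimpleGraph (Fin (n / k) × Fin k) :=
  SimpleGraph.boxProd (SimpleGraph.pathGraph (n / k)) (⊤ : SimpleGraph (Fin k))

/-! ### Parameters and the schedule of rounds -/

/-- Numerical parameters of the algorithm: the length `tau` of the random phase, the length
`tauRank` of a ranking phase, and the constant `cHat` of the filter of a shuffle phase. -/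
structure Params where
  tau : ℕ
  tauRank : ℕ
  cHat : ℝ

/-- `τ = α log n` and `τ' = 8 d τ log² n`, rounded up; logarithms are to base two. -/
def params (α d cHat : ℝ) (n : ℕ) : Params where
  tau := ⌈α * Real.logb 2 n⌉₊
  tauRank := ⌈8 * d * (⌈α * Real.logb 2 n⌉₊ : ℝ) * Real.logb 2 n ^ 2⌉₊
  cHat := cHat

/-- The freshness threshold `T = τ / 2`. -/
def Params.threshold (p : Params) : ℝ := (p.tau : ℝ) / 2

/-- The part of the algorithm a round belongs to; the number is the index, from `0`, of the round
within its phase. -/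
inductive Stage where
  | initial : Stage
  | random (i : ℕ) : Stage
  | ranking (i : ℕ) : Stage
  | shuffle (i : ℕ) : Stage

/-- Round `0`, then `τ` rounds of the random phase, and then, for ever, `τ'` rounds of a ranking
phase followed by `8 τ` rounds of a shuffle phase. -/
def Params.stage (p : Params) (t : ℕ) : Stage :=
  if t = 0 then .initial
  else if t ≤ p.tau then .random (t - 1)
  else
    let i := (t - 1 - p.tau) % (p.tauRank + 8 * p.tau)
    if i < p.tauRank then .ranking i else .shuffle (i - p.tauRank)

/-! ### The local state of a node

The message `m_v` is identified with the node `v` at which it originates. -/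

/-- The variables held by a node `u`. -/
structure NodeState (V : Type*) where
  /-- `R_u`, the messages known to `u`. -/
  received : Finset V
  /-- `S_u`, the messages already sent by `u`. -/
  sent : Finset V
  /-- `cnt_{u,v}`, the number of receptions of `m_v`. -/
  cnt : V → ℕ
  /-- The set `B̂_u` of the messages that may still be sent in the current phase. -/
  buffer : Finset V
  /-- `Prob`, the probability space computed at the start of a random or ranking phase. -/
  prob : V → ℝ≥0
  /-- `phasecnt_{u,v}`, the counters of the current shuffle phase. -/
  phasecnt : V → ℕ
  /-- The messages selected at the end of the last shuffle phase (none before the first one). -/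
  selected : Finset V
  /-- The messages below the freshness threshold that were not selected at the end of the last
  shuffle phase: the node takes no responsibility for them in the next ranking phase. -/
  deferred : Finset V

section Algorithm

variable {V : Type*} [Fintype V] [DecidableEq V]

/-- The state of node `u` before round `0`. -/
def NodeState.init (u : V) : NodeState V where
  received := {u}
  sent := ∅
  cnt := fun v => if v = u then 1 else 0
  buffer := ∅
  prob := fun _ => 0
  phasecnt := fun _ => 0
  selected := ∅
  deferred := ∅

/-- `B_u = R_u - S_u`. -/
def NodeState.unsent (s : NodeState V) : Finset V := s.received \ s.sent

open Classical in
/-- The known messages `m_v` with `cnt_{u,v} < T`. -/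
def NodeState.fresh (p : Params) (s : NodeState V) : Finset V :=
  s.received.filter fun v => (s.cnt v : ℝ) < p.threshold

/-- The sorting key of the ranking function: the messages selected in the last shuffle phase come
first, the other ones follow by increasing `cnt`; ties are broken by `tie`. -/
def NodeState.sortKey (s : NodeState V) (tie : V ↪ ℕ) (v : V) : ℕ ×ₗ ℕ ×ₗ ℕ :=
  if v ∈ s.selected then toLex (0, toLex (0, tie v)) else toLex (1, toLex (s.cnt v, tie v))

open Classical in
/-- The position, from `1`, of the message `m_v` in the sorted list of the messages of `B`. -/
def NodeState.rank (s : NodeState V) (tie : V ↪ ℕ) (B : Finset V) (v : V) : ℕ :=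
  (B.filter fun w => s.sortKey tie w ≤ s.sortKey tie v).card

/-- The ranking function: a message of rank `r` in a list of `b` messages has
probability `1 / (r H_b)`. -/
def NodeState.rankingFunction (s : NodeState V) (tie : V ↪ ℕ) (B : Finset V) (v : V) : ℝ≥0 :=
  1 / ((s.rank tie B v : ℝ≥0) * ∑ j ∈ Finset.range B.card, 1 / ((j : ℝ≥0) + 1))

/-- What a node does at the start of a round, before sending: it assigns `B̂` and `Prob` at the
start of a random or ranking phase, and `B̂` and `phasecnt` at the start of a shuffle phase. -/
def NodeState.prepare (p : Params) (tie : V ↪ ℕ) (s : NodeState V) : Stage → NodeState V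
  | .random 0 =>
      { s with
        buffer := s.unsent
        prob := fun _ => 1 / (s.unsent.card : ℝ≥0) }
  | .ranking 0 =>
      { s with
        buffer := s.unsent \ s.deferred
        prob := s.rankingFunction tie (s.unsent \ s.deferred) }
  | .shuffle 0 =>
      { s with
        buffer := s.fresh p ∩ s.unsent
        phasecnt := fun v => if v ∈ s.fresh p ∩ s.unsent then 1 else 0 }
  | _ => s

/-- The unnormalized law by which a message is drawn from `B̂`: messages already popped have left
`B̂`, which nullifies their probability. -/
def NodeState.weight (s : NodeState V) (v : V) : ℝ≥0∞ :=
  if v ∈ s.buffer then (s.prob v : ℝ≥0∞) else 0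

theorem NodeState.tsum_weight_ne_top (s : NodeState V) : (∑' v, s.weight v) ≠ ∞ := by
  rw [tsum_fintype]
  refine ENNReal.sum_ne_top.2 fun v _ => ?_
  unfold NodeState.weight
  split_ifs
  · exact ENNReal.coe_ne_top
  · exact ENNReal.zero_ne_top

open Classical in
/-- The law of the message popped from `B̂` according to `Prob`, renormalized over the messages
that remain in `B̂`; a node with nothing left to pop sends its own message. -/
def NodeState.popLaw (u : V) (s : NodeState V) : PMF V :=
  if h : (∑' v, s.weight v) ≠ 0 then PMF.normalize s.weight h s.tsum_weight_ne_top
  else PMF.pure u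

open Classical in
/-- The message sent in a round of a shuffle phase: some message of `B̂` (which one is decided by
`tie`), and the own message when `B̂` is empty. -/
def NodeState.shuffleMessage (u : V) (tie : V ↪ ℕ) (s : NodeState V) : V :=
  if h : s.buffer.Nonempty then (s.buffer.exists_min_image tie h).choose else u

/-- The law of the message that node `u` sends. -/
def NodeState.messageLaw (u : V) (tie : V ↪ ℕ) (s : NodeState V) : Stage → PMF V
  | .initial => PMF.pure u
  | .random _ => s.popLaw u
  | .ranking _ => s.popLaw u
  | .shuffle _ => PMF.pure (s.shuffleMessage u tie)

open Classical in
/-- The number of times node `u` receives `m_v` in a round in which every node `w` sends the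
message `m_{c w}` to all of its neighbours. -/
def receptions (G : SimpleGraph V) (c : V → V) (u v : V) : ℕ :=
  (Finset.univ.filter fun w => G.Adj u w ∧ c w = v).card

/-- The update of the variables of node `u` in a round in which every node `w` sends `m_{c w}`.
In a shuffle phase only `B̂` and `phasecnt` change. -/
def NodeState.deliver (G : SimpleGraph V) (c : V → V) (u : V) (s : NodeState V) :
    Stage → NodeState V
  | .shuffle _ =>
      { s with
        buffer := s.buffer.erase (c u)
        phasecnt := fun v => s.phasecnt v + receptions G c u v }
  | _ =>
      { s with
        buffer := s.buffer.erase (c u)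
        sent := insert (c u) s.sent
        received := s.received ∪ Finset.univ.filter fun v => 0 < receptions G c u v
        cnt := fun v => s.cnt v + receptions G c u v }

open Classical in
/-- The set `R` at the end of a shuffle phase, after filtering: of the messages seen during the
phase, those with `phasecnt ≥ ĉ T` that were not non-fresh when the phase started (the counters
`cnt` do not change during a shuffle phase). -/
def NodeState.candidates (p : Params) (s : NodeState V) : Finset V :=
  Finset.univ.filter fun v =>
    0 < s.phasecnt v ∧ p.cHat * p.threshold ≤ (s.phasecnt v : ℝ) ∧ (s.cnt v : ℝ) < p.threshold

/-- A uniformly random set of `4 τ` messages of `R` (all of `R`, if it has fewer). -/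
def NodeState.selectionLaw (p : Params) (s : NodeState V) : PMF (Finset V) :=
  PMF.uniformOfFinset
    (Finset.powersetCard (min (4 * p.tau) (s.candidates p).card) (s.candidates p))
    (Finset.powersetCard_nonempty.2 (min_le_right _ _))

/-- The end of a shuffle phase: `R` is added to `R_u`, and the set `A` is selected. -/
def NodeState.finishShuffle (p : Params) (s : NodeState V) (A : Finset V) : NodeState V :=
  let s' : NodeState V := { s with received := s.received ∪ s.candidates p }
  { s' with selected := A, deferred := s'.fresh p \ A }

/-! ### The execution -/

/-- Independent choices of all nodes, node `u` choosing by the law `P u`. -/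
def independent {β : Type*} [Fintype β] (P : V → PMF β) : PMF (V → β) :=
  PMF.ofFintype (fun c => ∏ u, P u (c u)) (by
    classical
    rw [← Fintype.prod_sum fun u b => P u b]
    refine Finset.prod_eq_one fun u _ => ?_
    rw [← tsum_fintype (L := .unconditional _)]
    exact (P u).tsum_coe)

/-- A rule for the choices that the algorithm leaves arbitrary (the breaking of ties in the sorted
lists, the order of the selected messages, the order of sending in shuffle phases): for every node,
round and local state, a priority order of the messages. -/
abbrev TieRule (V : Type*) := V → ℕ → NodeState V → (V ↪ ℕ)

/-- Round `t` of the algorithm. -/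
def step (p : Params) (G : SimpleGraph V) (tie : TieRule V) (t : ℕ) (σ : V → NodeState V) :
    PMF (V → NodeState V) :=
  let ready : V → NodeState V := fun u => (σ u).prepare p (tie u t (σ u)) (p.stage t)
  (independent fun u => (ready u).messageLaw u (tie u t (ready u)) (p.stage t)).bind fun c =>
    let next : V → NodeState V := fun u => (ready u).deliver G c u (p.stage t)
    match p.stage t with
    | .shuffle i =>
        if i + 1 = 8 * p.tau then
          (independent fun u => (next u).selectionLaw p).map
            fun A u => (next u).finishShuffle p (A u)
        else PMF.pure next
    | _ => PMF.pure next

/-- The law of the global state after the first `t` rounds (the rounds `0, …, t - 1`). -/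
def execution (p : Params) (G : SimpleGraph V) (tie : TieRule V) : ℕ → PMF (V → NodeState V)
  | 0 => PMF.pure NodeState.init
  | t + 1 => (execution p G tie t).bind (step p G tie t)

/-- Information spreading is complete: every node knows every message. -/
def Complete (σ : V → NodeState V) : Prop := ∀ u v : V, v ∈ (σ u).received

/-- The probability that information spreading is complete after the first `t` rounds. -/
def probComplete (p : Params) (G : SimpleGraph V) (tie : TieRule V) (t : ℕ) : ℝ≥0∞ :=
  (execution p G tie t).toOuterMeasure {σ | Complete σ}

end Algorithm

end InfoSpreading

end

noncomputable section

namespace InfoSpreading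

/-!
Let `cliqueDist` be the distance between the cliques of two nodes. With high probability, when the
ranking phase number `r` starts, every message at clique distance at most `r` is known and no longer
fresh, while more than `T = τ / 2` nodes of each clique hold a given message at distance `r + 1`
among the first `8 τ` entries of their sorted lists. Each of these entries is drawn with probability
at least `1 / (8 τ H_n)` in every round, so the ranking phase sends all of them: the messages at
distance `r + 1` stop being fresh, and the matching carries copies on to distance `r + 2`. In the
shuffle phase the reception counts then single out the messages at distance `r + 2`. There are at
most `2 k` of them for a node, and every node selects `4 τ` at random, so each of them is selected
by more than `T` nodes of the clique, which restores the invariant for `r + 1`. The random phase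
establishes it for `r = 0`, and after `n / k` ranking phases every node knows every message.
-/

/-! ### Expectations and failure probabilities -/

section Probability

variable {β γ ι : Type*}

/-- The expectation of a function with values in `[0, ∞]`. -/
def expect (μ : PMF β) (f : β → ℝ≥0∞) : ℝ≥0∞ := ∑' a, μ a * f a

theorem expect_pure (a : β) (f : β → ℝ≥0∞) : expect (PMF.pure a) f = f a := by
  rw [expect, tsum_eq_single a fun b hb => by rw [PMF.pure_apply_of_ne a b hb, zero_mul],
    PMF.pure_apply_self, one_mul]

theorem expect_bind (μ : PMF β) (κ : β → PMF γ) (f : γ → ℝ≥0∞) :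
    expect (μ.bind κ) f = expect μ fun a => expect (κ a) f := by
  simp_rw [expect, PMF.bind_apply, ← ENNReal.tsum_mul_right, ← ENNReal.tsum_mul_left]
  rw [ENNReal.tsum_comm]
  simp_rw [mul_assoc]

theorem expect_map (μ : PMF β) (g : β → γ) (f : γ → ℝ≥0∞) :
    expect (μ.map g) f = expect μ (f ∘ g) := by
  rw [← PMF.bind_pure_comp, expect_bind]
  simp_rw [Function.comp_apply, expect_pure]
  rfl

theorem expect_mono {μ : PMF β} {f g : β → ℝ≥0∞} (h : ∀ a ∈ μ.support, f a ≤ g a) :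
    expect μ f ≤ expect μ g := by
  refine ENNReal.tsum_le_tsum fun a => ?_
  by_cases ha : a ∈ μ.support
  · gcongr
    exact h a ha
  · rw [(PMF.apply_eq_zero_iff μ a).2 ha, zero_mul, zero_mul]

theorem expect_const (μ : PMF β) (x : ℝ≥0∞) : expect μ (fun _ => x) = x := by
  rw [expect, ENNReal.tsum_mul_right, μ.tsum_coe, one_mul]

theorem expect_add (μ : PMF β) (f g : β → ℝ≥0∞) :
    expect μ (fun a => f a + g a) = expect μ f + expect μ g := by
  simp_rw [expect, mul_add]
  exact ENNReal.tsum_add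

theorem expect_mul_const (μ : PMF β) (f : β → ℝ≥0∞) (x : ℝ≥0∞) :
    expect μ (fun a => f a * x) = expect μ f * x := by
  simp_rw [expect, ← mul_assoc]
  exact ENNReal.tsum_mul_right

theorem expect_const_mul (μ : PMF β) (x : ℝ≥0∞) (f : β → ℝ≥0∞) :
    expect μ (fun a => x * f a) = x * expect μ f := by
  simp_rw [mul_comm x]
  exact expect_mul_const μ f x

/-- The probability that `Q` fails. -/
def failProb (μ : PMF β) (Q : β → Prop) : ℝ≥0∞ := μ.toOuterMeasure {a | ¬ Q a}

theorem failProb_eq_expect (μ : PMF β) (Q : β → Prop) [DecidablePred Q] :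
    failProb μ Q = expect μ fun a => if Q a then 0 else 1 := by
  rw [failProb, PMF.toOuterMeasure_apply]
  refine tsum_congr fun a => ?_
  by_cases hQ : Q a <;> simp [hQ]

theorem failProb_mono {μ : PMF β} {Q R : β → Prop} (h : ∀ a ∈ μ.support, Q a → R a) :
    failProb μ R ≤ failProb μ Q :=
  μ.toOuterMeasure_mono fun a ha hQ => ha.1 (h a ha.2 hQ)

theorem failProb_eq_zero {μ : PMF β} {Q : β → Prop} (h : ∀ a ∈ μ.support, Q a) :
    failProb μ Q = 0 :=
  (PMF.toOuterMeasure_apply_eq_zero_iff μ _).2 (Set.disjoint_left.2 fun a ha => not_not.2 (h a ha))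

theorem failProb_le_one (μ : PMF β) (Q : β → Prop) : failProb μ Q ≤ 1 := by
  classical
  rw [failProb_eq_expect]
  refine (expect_mono fun a _ => ?_).trans (expect_const μ 1).le
  split_ifs
  · exact zero_le_one
  · exact le_rfl

theorem failProb_le_expect {μ : PMF β} {Q : β → Prop} {f : β → ℝ≥0∞}
    (h : ∀ a ∈ μ.support, ¬ Q a → 1 ≤ f a) : failProb μ Q ≤ expect μ f := by
  classical
  rw [failProb_eq_expect]
  refine expect_mono fun a ha => ?_
  split_ifs with hQ
  · exact zero_le
  · exact h a ha hQ

theorem failProb_map (μ : PMF β) (g : β → γ) (Q : γ → Prop) :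
    failProb (μ.map g) Q = failProb μ (Q ∘ g) :=
  PMF.toOuterMeasure_map_apply g μ _

theorem failProb_bind (μ : PMF β) (κ : β → PMF γ) (Q : γ → Prop) :
    failProb (μ.bind κ) Q = expect μ fun a => failProb (κ a) Q := by
  classical
  simp_rw [failProb_eq_expect, expect_bind]

theorem failProb_eq_one_sub_apply (μ : PMF β) (b : β) : failProb μ (· = b) = 1 - μ b := by
  classical
  refine ENNReal.eq_sub_of_add_eq (μ.apply_ne_top b) ?_
  have hb : μ b = expect μ fun a => if a = b then 1 else 0 := by
    simp only [expect, mul_ite, mul_one, mul_zero, tsum_ite_eq]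
  rw [hb, failProb_eq_expect, ← expect_add]
  refine Eq.trans ?_ (expect_const μ 1)
  congr 1
  funext a
  split_ifs <;> simp

theorem failProb_bind_le {μ : PMF β} {κ : β → PMF γ} {Q : β → Prop} {R : γ → Prop} {ε : ℝ≥0∞}
    (h : ∀ a ∈ μ.support, Q a → failProb (κ a) R ≤ ε) :
    failProb (μ.bind κ) R ≤ failProb μ Q + ε := by
  classical
  calc failProb (μ.bind κ) R = expect μ fun a => failProb (κ a) R := failProb_bind μ κ R
    _ ≤ expect μ fun a => (if Q a then 0 else 1) + ε := by
        refine expect_mono fun a ha => ?_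
        split_ifs with hQ
        · rw [zero_add]
          exact h a ha hQ
        · exact (failProb_le_one _ _).trans le_self_add
    _ = failProb μ Q + ε := by rw [expect_add, expect_const, failProb_eq_expect]

theorem failProb_and_le (μ : PMF β) (Q R : β → Prop) :
    failProb μ (fun a => Q a ∧ R a) ≤ failProb μ Q + failProb μ R := by
  simp only [failProb, not_and_or, Set.ofPred_or]
  exact MeasureTheory.measure_union_le _ _

theorem failProb_forall_le [Fintype ι] {μ : PMF β} {Q : ι → β → Prop} {ε : ℝ≥0∞}
    (h : ∀ i, failProb μ (Q i) ≤ ε) :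
    failProb μ (fun a => ∀ i, Q i a) ≤ Fintype.card ι * ε := by
  simp only [failProb, not_forall, Set.ofPred_exists]
  calc μ.toOuterMeasure (⋃ i, {a | ¬ Q i a}) ≤ ∑ i, μ.toOuterMeasure {a | ¬ Q i a} :=
        MeasureTheory.measure_iUnion_fintype_le _ _
    _ ≤ ∑ _i : ι, ε := Finset.sum_le_sum fun i _ => h i
    _ = Fintype.card ι * ε := by rw [Finset.sum_const, nsmul_eq_mul, Finset.card_univ]

theorem failProb_forall₂_le [Fintype ι] {μ : PMF β} {Q : ι → ι → β → Prop} {ε : ℝ≥0∞}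
    (h : ∀ i j, failProb μ (Q i j) ≤ ε) :
    failProb μ (fun a => ∀ i j, Q i j a) ≤ (Fintype.card ι : ℝ≥0∞) ^ 2 * ε := by
  rw [sq, mul_assoc]
  exact failProb_forall_le fun i => failProb_forall_le (h i)

theorem one_sub_failProb_le (μ : PMF β) (Q : β → Prop) :
    1 - failProb μ Q ≤ μ.toOuterMeasure {a | Q a} := by
  rw [tsub_le_iff_right]
  calc (1 : ℝ≥0∞) = μ.toOuterMeasure ({a | Q a} ∪ {a | ¬ Q a}) :=
        ((PMF.toOuterMeasure_apply_eq_one_iff μ _).2 fun a _ => em (Q a)).symm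
    _ ≤ _ := MeasureTheory.measure_union_le _ _

end Probability

section Independent

variable {V β : Type*} [Fintype V] [DecidableEq V] [Fintype β]

theorem expect_independent_prod_univ (P : V → PMF β) (f : V → β → ℝ≥0∞) :
    expect (independent P) (fun c => ∏ u, f u (c u)) = ∏ u, expect (P u) (f u) := by
  classical
  simp_rw [expect, tsum_fintype, Fintype.prod_sum, Finset.prod_mul_distrib]
  rfl

theorem expect_independent_prod (P : V → PMF β) (W : Finset V) (f : V → β → ℝ≥0∞) :
    expect (independent P) (fun c => ∏ u ∈ W, f u (c u)) = ∏ u ∈ W, expect (P u) (f u) := by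
  have h := expect_independent_prod_univ P fun u b => if u ∈ W then f u b else 1
  simp only [Finset.prod_ite_mem, Finset.univ_inter] at h
  rw [h, ← Finset.prod_subset (Finset.subset_univ W) fun u _ hu => by
    simp only [if_neg hu, expect_const]]
  exact Finset.prod_congr rfl fun u hu => by simp only [if_pos hu]

theorem expect_independent_apply (P : V → PMF β) (u : V) (f : β → ℝ≥0∞) :
    expect (independent P) (fun c => f (c u)) = expect (P u) f := by
  simpa only [Finset.prod_singleton] using expect_independent_prod P {u} fun _ => f

theorem failProb_independent_apply (P : V → PMF β) (u : V) (Q : β → Prop) :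
    failProb (independent P) (fun c => Q (c u)) = failProb (P u) Q := by
  classical
  simp_rw [failProb_eq_expect]
  exact expect_independent_apply P u fun b => if Q b then 0 else 1

theorem mem_support_of_independent {P : V → PMF β} {c : V → β}
    (hc : c ∈ (independent P).support) (u : V) : c u ∈ (P u).support := by
  rw [PMF.mem_support_iff] at hc ⊢
  exact fun h0 => hc (Finset.prod_eq_zero (Finset.mem_univ u) h0)

theorem independent_pure (c : V → β) : independent (fun u => PMF.pure (c u)) = PMF.pure c := by
  classical
  ext c'
  change ∏ u, (PMF.pure (c u)) (c' u) = PMF.pure c c'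
  rw [PMF.pure_apply]
  split_ifs with h
  · simp [h]
  · obtain ⟨u, hu⟩ := Function.ne_iff.1 h
    exact Finset.prod_eq_zero (Finset.mem_univ u) (PMF.pure_apply_of_ne _ _ hu)

end Independent

/-! ### Rounds of the random and ranking phases -/

section Rounds

variable {V : Type*} [Fintype V] [DecidableEq V]

/-- The `m` rounds that follow the rounds `0, …, t - 1`, from a given global state. -/
def run (p : Params) (G : SimpleGraph V) (tie : TieRule V) :
    ℕ → ℕ → (V → NodeState V) → PMF (V → NodeState V)
  | _, 0, σ => PMF.pure σ
  | t, m + 1, σ => (step p G tie t σ).bind (run p G tie (t + 1) m)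

/-- A round of a random or ranking phase in which the nodes are already prepared.  The stage
`.initial` stands for any stage in which `deliver` updates all the variables. -/
def popStep (G : SimpleGraph V) (σ : V → NodeState V) : PMF (V → NodeState V) :=
  (independent fun u => (σ u).popLaw u).map fun c u => (σ u).deliver G c u .initial

/-- `L` consecutive rounds of a random or ranking phase in which the nodes are already prepared. -/
def popRun (G : SimpleGraph V) : ℕ → (V → NodeState V) → PMF (V → NodeState V)
  | 0, σ => PMF.pure σ
  | L + 1, σ => (popStep G σ).bind (popRun G L)

variable {p : Params} {G : SimpleGraph V} {tie : TieRule V} {t m i : ℕ} {phase : ℕ → Stage}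

theorem execution_add (p : Params) (G : SimpleGraph V) (tie : TieRule V) (t m : ℕ) :
    execution p G tie (t + m) = (execution p G tie t).bind (run p G tie t m) := by
  induction m generalizing t with
  | zero => simp only [Nat.add_zero, run, PMF.bind_pure]
  | succ m ih => rw [← Nat.succ_add_eq_add_succ, ih, execution, PMF.bind_bind]; rfl

theorem step_eq_popStep (hphase : phase = .random ∨ phase = .ranking)
    (h : p.stage t = phase i) (σ : V → NodeState V) :
    step p G tie t σ = popStep G fun u => (σ u).prepare p (tie u t (σ u)) (phase i) := by
  rcases hphase with rfl | rfl <;>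
  · unfold step popStep
    rw [h, ← PMF.bind_pure_comp]
    rfl

theorem step_eq_popStep_of_pos (hphase : phase = .random ∨ phase = .ranking)
    (h : p.stage t = phase (i + 1)) (σ : V → NodeState V) :
    step p G tie t σ = popStep G σ := by
  rw [step_eq_popStep hphase h]
  rcases hphase with rfl | rfl <;> rfl

theorem run_eq_popRun_of_pos (hphase : phase = .random ∨ phase = .ranking)
    (h : ∀ j < m, p.stage (t + j) = phase (i + 1 + j)) (σ : V → NodeState V) :
    run p G tie t m σ = popRun G m σ := by
  induction m generalizing t i σ with
  | zero => rfl
  | succ m ih =>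
    rw [run, popRun,
      step_eq_popStep_of_pos hphase (show p.stage t = phase (i + 1) from h 0 m.succ_pos)]
    congr 1
    funext σ'
    refine ih (i := i + 1) (fun j hj => ?_) σ'
    rw [add_right_comm t, add_assoc t, h (j + 1) (by lia)]
    congr 1
    ring

theorem run_eq_popRun (hphase : phase = .random ∨ phase = .ranking) (hm : 0 < m)
    (h : ∀ j < m, p.stage (t + j) = phase j) (σ : V → NodeState V) :
    run p G tie t m σ = popRun G m fun u => (σ u).prepare p (tie u t (σ u)) (phase 0) := by
  obtain ⟨m, rfl⟩ := Nat.exists_eq_add_one.2 hm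
  rw [run, popRun, step_eq_popStep hphase (show p.stage t = phase 0 from h 0 hm)]
  congr 1
  funext σ'
  refine run_eq_popRun_of_pos (i := 0) hphase (fun j hj => ?_) σ'
  rw [add_assoc, h (1 + j) (by lia), zero_add]

theorem exists_of_mem_support_popStep {σ σ' : V → NodeState V} (h : σ' ∈ (popStep G σ).support) :
    ∃ c : V → V, (∀ u, c u ∈ ((σ u).popLaw u).support) ∧
      σ' = fun u => (σ u).deliver G c u .initial := by
  rw [popStep, PMF.mem_support_map_iff] at h
  obtain ⟨c, hc, rfl⟩ := h
  exact ⟨c, mem_support_of_independent hc, rfl⟩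

theorem card_sent_le_of_mem_support_popRun {L : ℕ} {σ σ' : V → NodeState V}
    (h : σ' ∈ (popRun G L σ).support) (u : V) : (σ' u).sent.card ≤ (σ u).sent.card + L := by
  induction L generalizing σ with
  | zero => rw [(PMF.mem_support_pure_iff _ _).1 h, Nat.add_zero]
  | succ L ih =>
    obtain ⟨σ₁, h₁, h₂⟩ := (PMF.mem_support_bind_iff _ _ _).1 h
    obtain ⟨c, -, rfl⟩ := exists_of_mem_support_popStep h₁
    calc (σ' u).sent.card ≤ (insert (c u) (σ u).sent).card + L := ih h₂
      _ ≤ (σ u).sent.card + (L + 1) := by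
        have := Finset.card_insert_le (c u) (σ u).sent
        lia

theorem NodeState.mem_buffer_or_eq_of_mem_support_popLaw {u v : V} {s : NodeState V}
    (h : v ∈ (s.popLaw u).support) : v ∈ s.buffer ∨ v = u := by
  unfold NodeState.popLaw at h
  split_ifs at h
  · rw [PMF.mem_support_normalize_iff, NodeState.weight, ne_eq, ite_eq_right_iff,
      Classical.not_imp] at h
    exact .inl h.1
  · exact .inr ((PMF.mem_support_pure_iff _ _).1 h)

end Rounds

section PopRel

variable {V : Type*} [Fintype V]

open Classical in
/-- The neighbours of `u` that sent `m_v` for the first time between the global states `σ`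
and `σ'`. -/
def newSenders (G : SimpleGraph V) (σ σ' : V → NodeState V) (u v : V) : Finset V :=
  Finset.univ.filter fun w => G.Adj u w ∧ v ∈ (σ' w).sent ∧ v ∉ (σ w).sent

variable {G : SimpleGraph V} {σ σ' σ₁ σ₂ σ₃ : V → NodeState V} {c : V → V} {u v w : V}

theorem mem_newSenders :
    w ∈ newSenders G σ σ' u v ↔ G.Adj u w ∧ v ∈ (σ' w).sent ∧ v ∉ (σ w).sent := by
  simp only [newSenders, Finset.mem_filter, Finset.mem_univ, true_and]

theorem newSenders_self : newSenders G σ σ u v = ∅ :=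
  Finset.eq_empty_of_forall_notMem fun _ hw => (mem_newSenders.1 hw).2.2 (mem_newSenders.1 hw).2.1

theorem newSenders_union [DecidableEq V] (h : ∀ u, (σ₁ u).sent ⊆ (σ₂ u).sent)
    (h' : ∀ u, (σ₂ u).sent ⊆ (σ₃ u).sent) :
    newSenders G σ₁ σ₂ u v ∪ newSenders G σ₂ σ₃ u v = newSenders G σ₁ σ₃ u v := by
  ext w
  have := @h w v
  have := @h' w v
  simp only [Finset.mem_union, mem_newSenders]
  tauto

theorem card_newSenders_add (h : ∀ u, (σ₁ u).sent ⊆ (σ₂ u).sent)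
    (h' : ∀ u, (σ₂ u).sent ⊆ (σ₃ u).sent) :
    (newSenders G σ₁ σ₂ u v).card + (newSenders G σ₂ σ₃ u v).card
      = (newSenders G σ₁ σ₃ u v).card := by
  classical
  rw [← newSenders_union h h', Finset.card_union_of_disjoint]
  exact Finset.disjoint_left.2 fun w hw hw' => (mem_newSenders.1 hw').2.2 (mem_newSenders.1 hw).2.1

/-- How the global state `σ'` after some rounds of a random or ranking phase is related to the
global state `σ` before them, whatever the random choices were. -/
structure PopRel (G : SimpleGraph V) (σ σ' : V → NodeState V) : Prop where
  sent_mono : ∀ u, (σ u).sent ⊆ (σ' u).sent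
  sent_of : ∀ u v, v ∈ (σ' u).sent → v ∈ (σ u).sent ∨ v = u ∨ v ∈ (σ u).buffer
  buffer_sub : ∀ u, (σ' u).buffer ⊆ (σ u).buffer
  sent_of_buffer : ∀ u v, v ∈ (σ u).buffer → v ∉ (σ' u).buffer → v ∈ (σ' u).sent
  not_sent : ∀ u v, v ∈ (σ' u).buffer → v ∉ (σ' u).sent
  received_mono : ∀ u, (σ u).received ⊆ (σ' u).received
  received_of : ∀ u v, v ∈ (σ' u).received →
    v ∈ (σ u).received ∨ G.Adj u v ∨ (newSenders G σ σ' u v).Nonempty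
  received_of_newSenders : ∀ u v, (newSenders G σ σ' u v).Nonempty → v ∈ (σ' u).received
  le_cnt : ∀ u v, (σ u).cnt v + (newSenders G σ σ' u v).card ≤ (σ' u).cnt v
  /-- A node with an empty buffer repeats its own message, hence the restriction on `v`. -/
  cnt_eq : ∀ u v, ¬ G.Adj u v → (σ' u).cnt v = (σ u).cnt v + (newSenders G σ σ' u v).card
  deferred_eq : ∀ u, (σ' u).deferred = (σ u).deferred
  selected_eq : ∀ u, (σ' u).selected = (σ u).selected

theorem PopRel.refl (h : ∀ u v, v ∈ (σ u).buffer → v ∉ (σ u).sent) : PopRel G σ σ where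
  sent_mono _ := subset_rfl
  sent_of _ _ hv := .inl hv
  buffer_sub _ := subset_rfl
  sent_of_buffer _ _ h₁ h₂ := absurd h₁ h₂
  not_sent := h
  received_mono _ := subset_rfl
  received_of _ _ hv := .inl hv
  received_of_newSenders _ _ hw := absurd newSenders_self hw.ne_empty
  le_cnt u v := by rw [newSenders_self, Finset.card_empty, Nat.add_zero]
  cnt_eq u v _ := by rw [newSenders_self, Finset.card_empty, Nat.add_zero]
  deferred_eq _ := rfl
  selected_eq _ := rfl

theorem PopRel.trans (h : PopRel G σ₁ σ₂) (h' : PopRel G σ₂ σ₃) : PopRel G σ₁ σ₃ := by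
  classical
  have hunion (u v : V) :
      newSenders G σ₁ σ₂ u v ∪ newSenders G σ₂ σ₃ u v = newSenders G σ₁ σ₃ u v :=
    newSenders_union h.sent_mono h'.sent_mono
  have hcard (u v : V) :=
    card_newSenders_add (G := G) (u := u) (v := v) h.sent_mono h'.sent_mono
  refine ⟨fun u => (h.sent_mono u).trans (h'.sent_mono u), ?_,
    fun u => (h'.buffer_sub u).trans (h.buffer_sub u), ?_, h'.not_sent,
    fun u => (h.received_mono u).trans (h'.received_mono u), ?_, ?_, ?_, ?_,
    fun u => (h'.deferred_eq u).trans (h.deferred_eq u),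
    fun u => (h'.selected_eq u).trans (h.selected_eq u)⟩
  · intro u v hv
    rcases h'.sent_of u v hv with h₁ | h₁ | h₁
    · exact h.sent_of u v h₁
    · exact .inr (.inl h₁)
    · exact .inr (.inr (h.buffer_sub u h₁))
  · intro u v h₁ h₂
    by_cases h₃ : v ∈ (σ₂ u).buffer
    · exact h'.sent_of_buffer u v h₃ h₂
    · exact h'.sent_mono u (h.sent_of_buffer u v h₁ h₃)
  · intro u v hv
    rw [← hunion, Finset.union_nonempty]
    have := h.received_of u v
    have := h'.received_of u v hv
    tauto
  · intro u v hv
    rw [← hunion, Finset.union_nonempty] at hv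
    exact hv.elim (fun h₁ => h'.received_mono u (h.received_of_newSenders u v h₁))
      (h'.received_of_newSenders u v)
  · intro u v
    rw [← hcard, ← Nat.add_assoc]
    exact (Nat.add_le_add_right (h.le_cnt u v) _).trans (h'.le_cnt u v)
  · intro u v huv
    rw [← hcard, ← Nat.add_assoc, ← h.cnt_eq u v huv, ← h'.cnt_eq u v huv]

end PopRel

section PopRun

variable {V : Type*} {G : SimpleGraph V} {σ σ' : V → NodeState V} {c : V → V} {u v w : V}

theorem notMem_sent_of_not_adj (hσ : ∀ u v, v ∈ (σ u).buffer → v ∉ (σ u).sent)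
    (hc : ∀ u, c u ∈ (σ u).buffer ∨ c u = u) (huv : ¬ G.Adj u v) (hw : G.Adj u w) (hcw : c w = v) :
    v ∉ (σ w).sent := by
  rw [← hcw] at huv ⊢
  exact hσ w _ ((hc w).resolve_right fun h => huv (h.symm ▸ hw))

variable [Fintype V] [DecidableEq V]

theorem mem_sent_deliver : v ∈ ((σ u).deliver G c u .initial).sent ↔ v = c u ∨ v ∈ (σ u).sent :=
  Finset.mem_insert

theorem mem_received_deliver : v ∈ ((σ u).deliver G c u .initial).received ↔
    v ∈ (σ u).received ∨ ∃ w, G.Adj u w ∧ c w = v := by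
  change v ∈ _ ∪ Finset.univ.filter _ ↔ _
  rw [Finset.mem_union, Finset.mem_filter_univ, receptions, Finset.card_pos]
  simp only [Finset.Nonempty, Finset.mem_filter_univ]

theorem mem_newSenders_deliver :
    w ∈ newSenders G σ (fun u => (σ u).deliver G c u .initial) u v ↔
      (G.Adj u w ∧ c w = v) ∧ v ∉ (σ w).sent := by
  rw [mem_newSenders, mem_sent_deliver]
  tauto

theorem card_newSenders_deliver_le :
    (newSenders G σ (fun u => (σ u).deliver G c u .initial) u v).card ≤ receptions G c u v := by
  classical
  exact Finset.card_le_card fun _ hw =>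
    Finset.mem_filter.2 ⟨Finset.mem_univ _, (mem_newSenders_deliver.1 hw).1⟩

theorem card_newSenders_deliver (hσ : ∀ u v, v ∈ (σ u).buffer → v ∉ (σ u).sent)
    (hc : ∀ u, c u ∈ (σ u).buffer ∨ c u = u) (huv : ¬ G.Adj u v) :
    (newSenders G σ (fun u => (σ u).deliver G c u .initial) u v).card = receptions G c u v := by
  classical
  refine congrArg Finset.card (Finset.ext fun w => ?_)
  rw [mem_newSenders_deliver, Finset.mem_filter_univ]
  exact ⟨And.left, fun h => ⟨h, notMem_sent_of_not_adj hσ hc huv h.1 h.2⟩⟩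

theorem popRel_deliver (hσ : ∀ u v, v ∈ (σ u).buffer → v ∉ (σ u).sent)
    (hc : ∀ u, c u ∈ (σ u).buffer ∨ c u = u) :
    PopRel G σ fun u => (σ u).deliver G c u .initial where
  sent_mono _ := Finset.subset_insert _ _
  sent_of u v hv := by
    rcases mem_sent_deliver.1 hv with rfl | hv
    · exact .inr (hc u).symm
    · exact .inl hv
  buffer_sub _ := Finset.erase_subset _ _
  sent_of_buffer u v h₁ h₂ := mem_sent_deliver.2 <| .inl <|
    by_contra fun h₃ => h₂ (Finset.mem_erase.2 ⟨h₃, h₁⟩)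
  not_sent u v hv := by
    rw [mem_sent_deliver, not_or]
    exact ⟨(Finset.mem_erase.1 hv).1, hσ u v (Finset.mem_erase.1 hv).2⟩
  received_mono _ := Finset.subset_union_left
  received_of u v hv := by
    by_cases huv : G.Adj u v
    · exact .inr (.inl huv)
    · rcases mem_received_deliver.1 hv with hv | ⟨w, hw, hcw⟩
      · exact .inl hv
      · exact .inr <| .inr ⟨w, mem_newSenders_deliver.2
          ⟨⟨hw, hcw⟩, notMem_sent_of_not_adj hσ hc huv hw hcw⟩⟩
  received_of_newSenders u v := fun ⟨w, hw⟩ =>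
    mem_received_deliver.2 (.inr ⟨w, (mem_newSenders_deliver.1 hw).1⟩)
  le_cnt _ _ := Nat.add_le_add_left card_newSenders_deliver_le _
  cnt_eq _ _ huv := by rw [card_newSenders_deliver hσ hc huv]; rfl
  deferred_eq _ := rfl
  selected_eq _ := rfl

theorem popRel_of_popStep (hσ : ∀ u v, v ∈ (σ u).buffer → v ∉ (σ u).sent)
    (h : σ' ∈ (popStep G σ).support) : PopRel G σ σ' := by
  obtain ⟨c, hc, rfl⟩ := exists_of_mem_support_popStep h
  exact popRel_deliver hσ fun u => NodeState.mem_buffer_or_eq_of_mem_support_popLaw (hc u)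

theorem popRel_of_popRun {L : ℕ} (hσ : ∀ u v, v ∈ (σ u).buffer → v ∉ (σ u).sent)
    (h : σ' ∈ (popRun G L σ).support) : PopRel G σ σ' := by
  induction L generalizing σ with
  | zero =>
    rw [(PMF.mem_support_pure_iff _ _).1 h]
    exact PopRel.refl hσ
  | succ L ih =>
    obtain ⟨σ₁, h₁, h₂⟩ := (PMF.mem_support_bind_iff _ _ _).1 h
    have hrel := popRel_of_popStep hσ h₁
    exact hrel.trans (ih hrel.not_sent h₂)

end PopRun

section PopProbability

theorem NodeState.tsum_weight {V : Type*} [DecidableEq V] (s : NodeState V) :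
    ∑' v, s.weight v = ((∑ v ∈ s.buffer, s.prob v : ℝ≥0) : ℝ≥0∞) := by
  rw [tsum_eq_sum (s := s.buffer) fun v hv => show s.weight v = 0 from if_neg hv,
    ENNReal.ofNNReal_finsetSum]
  exact Finset.sum_congr rfl fun v hv => if_pos hv

variable {V : Type*} [Fintype V] [DecidableEq V] {G : SimpleGraph V}

theorem NodeState.le_popLaw_apply {u v : V} {s : NodeState V} (hv : v ∈ s.buffer)
    (hsum : ∑ x ∈ s.buffer, s.prob x ≤ 1) : (s.prob v : ℝ≥0∞) ≤ s.popLaw u v := by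
  unfold NodeState.popLaw
  split_ifs with h0
  · rw [PMF.normalize_apply, NodeState.weight, if_pos hv, NodeState.tsum_weight]
    exact le_mul_of_one_le_right' (ENNReal.one_le_inv.2 (by exact_mod_cast hsum))
  · rw [not_not, NodeState.tsum_weight, ENNReal.coe_eq_zero, Finset.sum_eq_zero_iff] at h0
    rw [h0 v hv, ENNReal.coe_zero]
    exact zero_le

theorem NodeState.expect_popLaw_of_uniform {u : V} {s : NodeState V} {a : ℝ≥0} (ha : a ≠ 0)
    (hprob : ∀ v, s.prob v = a) (hb : s.buffer.Nonempty) (f : V → ℝ≥0∞) :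
    expect (s.popLaw u) f = (∑ v ∈ s.buffer, f v) / s.buffer.card := by
  have hb' : (s.buffer.card : ℝ≥0∞) ≠ 0 := by exact_mod_cast hb.card_ne_zero
  have ha' : (a : ℝ≥0∞) ≠ 0 := ENNReal.coe_ne_zero.2 ha
  have hsum : ∑' v, s.weight v = s.buffer.card * (a : ℝ≥0∞) := by
    simp only [NodeState.tsum_weight, hprob, Finset.sum_const, nsmul_eq_mul, ENNReal.coe_mul,
      ENNReal.coe_natCast]
  have hterm (v : V) : s.weight v * (s.buffer.card * a : ℝ≥0∞)⁻¹ * f v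
      = if v ∈ s.buffer then (s.buffer.card : ℝ≥0∞)⁻¹ * f v else 0 := by
    rw [NodeState.weight, hprob]
    split_ifs
    · rw [ENNReal.mul_inv (.inl hb') (.inl (ENNReal.natCast_ne_top _)), mul_left_comm,
        ENNReal.mul_inv_cancel ha' ENNReal.coe_ne_top, mul_one]
    · rw [zero_mul, zero_mul]
  rw [NodeState.popLaw, dif_pos (by rw [hsum]; exact mul_ne_zero hb' ha'), expect, tsum_fintype]
  simp_rw [PMF.normalize_apply, hsum, hterm, Finset.sum_ite_mem, Finset.univ_inter,
    ENNReal.div_eq_inv_mul, Finset.mul_sum]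

theorem buffer_subset_of_mem_support_popRun {L : ℕ} {σ σ' : V → NodeState V}
    (h : σ' ∈ (popRun G L σ).support) (u : V) : (σ' u).buffer ⊆ (σ u).buffer := by
  induction L generalizing σ with
  | zero => rw [(PMF.mem_support_pure_iff _ _).1 h]
  | succ L ih =>
    obtain ⟨σ₁, h₁, h₂⟩ := (PMF.mem_support_bind_iff _ _ _).1 h
    obtain ⟨c, -, rfl⟩ := exists_of_mem_support_popStep h₁
    exact (ih h₂).trans (Finset.erase_subset _ _)

theorem failProb_notMem_buffer_popStep_le (σ : V → NodeState V) (u v : V)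
    (hsum : ∑ x ∈ (σ u).buffer, (σ u).prob x ≤ 1) :
    failProb (popStep G σ) (fun σ' => v ∉ (σ' u).buffer) ≤ 1 - (σ u).prob v := by
  by_cases hv : v ∈ (σ u).buffer
  · calc failProb (popStep G σ) (fun σ' => v ∉ (σ' u).buffer)
        = failProb ((σ u).popLaw u) (fun x => v ∉ (σ u).buffer.erase x) := by
          rw [popStep, failProb_map, ← failProb_independent_apply (fun u => (σ u).popLaw u)]
          rfl
      _ ≤ failProb ((σ u).popLaw u) (· = v) :=
          failProb_mono fun x _ hx => hx ▸ Finset.notMem_erase _ _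
      _ ≤ 1 - (σ u).prob v := by
          rw [failProb_eq_one_sub_apply]
          exact tsub_le_tsub_left (NodeState.le_popLaw_apply hv hsum) 1
  · refine (failProb_eq_zero fun σ' h => mt (fun hv' => ?_) hv).trans_le zero_le
    obtain ⟨c, -, rfl⟩ := exists_of_mem_support_popStep h
    exact Finset.mem_of_mem_erase hv'

theorem failProb_notMem_buffer_popRun_le (L : ℕ) (σ : V → NodeState V) (u v : V)
    (hsum : ∑ x ∈ (σ u).buffer, (σ u).prob x ≤ 1) :
    failProb (popRun G L σ) (fun σ' => v ∉ (σ' u).buffer) ≤ (1 - (σ u).prob v) ^ L := by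
  induction L generalizing σ with
  | zero => exact (failProb_le_one _ _).trans_eq (pow_zero _).symm
  | succ L ih =>
    rw [popRun, failProb_bind, pow_succ']
    calc expect (popStep G σ) (fun σ₁ => failProb (popRun G L σ₁) fun σ' => v ∉ (σ' u).buffer)
        ≤ expect (popStep G σ) (fun σ₁ =>
            (if v ∈ (σ₁ u).buffer then 1 else 0) * (1 - ((σ u).prob v : ℝ≥0∞)) ^ L) := by
          refine expect_mono fun σ₁ h => ?_
          split_ifs with hv
          · obtain ⟨c, -, rfl⟩ := exists_of_mem_support_popStep h
            rw [one_mul]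
            exact ih _ ((Finset.sum_le_sum_of_subset (Finset.erase_subset _ _)).trans hsum)
          · exact (failProb_eq_zero fun σ' h' hv' =>
              hv (buffer_subset_of_mem_support_popRun h' u hv')).trans_le zero_le
      _ = failProb (popStep G σ) (fun σ₁ => v ∉ (σ₁ u).buffer)
            * (1 - ((σ u).prob v : ℝ≥0∞)) ^ L := by
          simp_rw [expect_mul_const, failProb_eq_expect, ite_not]
      _ ≤ _ := by
          gcongr
          exact failProb_notMem_buffer_popStep_le σ u v hsum

end PopProbability

section SentProduct

/-- The expectation of `z ^ [x ∈ A]` for a uniformly random `m`-element subset `A` of a set of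
`b` elements that contains `x`. -/
def hitFactor (z : ℝ≥0∞) (b m : ℕ) : ℝ≥0∞ := (((b - m : ℕ) : ℝ≥0∞) + z * m) / b

theorem hitFactor_zero {b : ℕ} (hb : b ≠ 0) (z : ℝ≥0∞) : hitFactor z b 0 = 1 := by
  rw [hitFactor, Nat.cast_zero, mul_zero, add_zero, Nat.sub_zero,
    ENNReal.div_self (Nat.cast_ne_zero.2 hb) (ENNReal.natCast_ne_top b)]

variable {V : Type*} [DecidableEq V]

theorem sum_hitFactor {B : Finset V} {v : V} (hv : v ∈ B) {L : ℕ} (hL : L + 1 ≤ B.card)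
    (z : ℝ≥0∞) :
    (∑ x ∈ B, if x = v then z else hitFactor z (B.card - 1) L) / B.card
      = hitFactor z B.card (L + 1) := by
  rw [Finset.sum_ite, Finset.filter_eq' B v, if_pos hv, Finset.sum_singleton, Finset.sum_const,
    Finset.filter_ne' B v, Finset.card_erase_of_mem hv, nsmul_eq_mul, hitFactor, hitFactor]
  congr 1
  by_cases hb : B.card = 1
  · simp [hb, show L = 0 by lia]
  · have hb' : B.card - 1 ≠ 0 := by lia
    rw [ENNReal.mul_div_cancel (Nat.cast_ne_zero.2 hb') (ENNReal.natCast_ne_top _),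
      show B.card - (L + 1) = B.card - 1 - L by lia]
    push_cast
    ring

/-- The conditional expectation of `z ^ [m_v is sent]`, given the state `s` of a node that is going
to pop `L` further messages uniformly from its buffer. -/
def NodeState.sentFactor (z : ℝ≥0∞) (L : ℕ) (s : NodeState V) (v : V) : ℝ≥0∞ :=
  if v ∈ s.sent then z else hitFactor z s.buffer.card L

variable [Fintype V] {G : SimpleGraph V}

theorem NodeState.expect_sentFactor_deliver_le {u v : V} {s : NodeState V} {a : ℝ≥0} {L : ℕ}
    (z : ℝ≥0∞) (ha : a ≠ 0) (hprob : ∀ v, s.prob v = a) (hL : L + 1 ≤ s.buffer.card)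
    (hv : v ∈ s.sent ∨ v ∈ s.buffer) :
    expect (s.popLaw u) (fun x =>
        if v ∈ insert x s.sent then z else hitFactor z (s.buffer.erase x).card L)
      ≤ s.sentFactor z (L + 1) v := by
  rw [NodeState.sentFactor]
  split_ifs with hsent
  · simp only [Finset.mem_insert_of_mem hsent, if_true, expect_const, le_refl]
  · have hbuffer := hv.resolve_left hsent
    rw [NodeState.expect_popLaw_of_uniform ha hprob ⟨v, hbuffer⟩, ← sum_hitFactor hbuffer hL]
    gcongr with x hx
    simp only [Finset.mem_insert, hsent, or_false, Finset.card_erase_of_mem hx, eq_comm (a := v),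
      le_refl]

theorem expect_prod_sentFactor_popStep_le (W : Finset V) (f : V → V) (z : ℝ≥0∞) {L : ℕ}
    {σ : V → NodeState V} (hprob : ∀ x ∈ W, ∃ a : ℝ≥0, a ≠ 0 ∧ ∀ v, (σ x).prob v = a)
    (hcard : ∀ x ∈ W, L + 1 ≤ (σ x).buffer.card)
    (htarget : ∀ x ∈ W, f x ∈ (σ x).sent ∨ f x ∈ (σ x).buffer) :
    expect (popStep G σ) (fun σ' => ∏ x ∈ W, (σ' x).sentFactor z L (f x))
      ≤ ∏ x ∈ W, (σ x).sentFactor z (L + 1) (f x) := by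
  rw [popStep, expect_map]
  refine (expect_independent_prod (fun u => (σ u).popLaw u) W fun x y =>
    if f x ∈ insert y (σ x).sent then z else hitFactor z ((σ x).buffer.erase y).card L).trans_le ?_
  refine Finset.prod_le_prod' fun x hx => ?_
  obtain ⟨a, ha, hp⟩ := hprob x hx
  exact NodeState.expect_sentFactor_deliver_le z ha hp (hcard x hx) (htarget x hx)

/-- Choices of different nodes are independent, even though a single node draws without
replacement; hence the product. -/
theorem expect_prod_sent_popRun_le (W : Finset V) (f : V → V) (z : ℝ≥0∞) {L : ℕ}
    {σ : V → NodeState V} (hprob : ∀ x ∈ W, ∃ a : ℝ≥0, a ≠ 0 ∧ ∀ v, (σ x).prob v = a)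
    (hcard : ∀ x ∈ W, L ≤ (σ x).buffer.card)
    (htarget : ∀ x ∈ W, f x ∈ (σ x).sent ∨ f x ∈ (σ x).buffer) :
    expect (popRun G L σ) (fun σ' => ∏ x ∈ W, if f x ∈ (σ' x).sent then z else 1)
      ≤ ∏ x ∈ W, (σ x).sentFactor z L (f x) := by
  induction L generalizing σ with
  | zero =>
    rw [popRun, expect_pure]
    refine Finset.prod_le_prod' fun x hx => ?_
    rw [NodeState.sentFactor]
    split_ifs with h
    · exact le_rfl
    · exact (hitFactor_zero (Finset.card_ne_zero_of_mem ((htarget x hx).resolve_left h)) z).ge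
  | succ L ih =>
    rw [popRun, expect_bind]
    refine (expect_mono fun σ₁ h => ?_).trans
      (expect_prod_sentFactor_popStep_le W f z hprob hcard htarget)
    obtain ⟨c, -, rfl⟩ := exists_of_mem_support_popStep h
    refine ih hprob (fun x hx => ?_) fun x hx => ?_
    · exact (Nat.le_sub_one_of_lt (hcard x hx)).trans Finset.pred_card_le_card_erase
    · have := htarget x hx
      simp only [NodeState.deliver, Finset.mem_insert, Finset.mem_erase]
      tauto

end SentProduct

section RandomSubset

variable {β : Type*}

theorem expect_uniformOfFinset (S : Finset β) (hS : S.Nonempty) (f : β → ℝ≥0∞) :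
    expect (PMF.uniformOfFinset S hS) f = (∑ a ∈ S, f a) / S.card := by
  rw [ENNReal.div_eq_inv_mul, Finset.mul_sum, expect, tsum_eq_sum (s := S) fun a ha => by
    rw [PMF.uniformOfFinset_apply_of_notMem hS ha, zero_mul]]
  exact Finset.sum_congr rfl fun a ha => by rw [PMF.uniformOfFinset_apply_of_mem hS ha]

variable {R : Finset β} {a : β} {m : ℕ}

theorem two_pow_mul_descFactorial_le {a b : ℕ} (h : 2 * a ≤ b) (m : ℕ) :
    2 ^ m * a.descFactorial m ≤ b.descFactorial m := by
  induction m with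
  | zero => rfl
  | succ m ih =>
    rw [Nat.descFactorial_succ, Nat.descFactorial_succ]
    calc 2 ^ (m + 1) * ((a - m) * a.descFactorial m)
        = (2 * (a - m)) * (2 ^ m * a.descFactorial m) := by ring
      _ ≤ (b - m) * b.descFactorial m := Nat.mul_le_mul (by lia) ih

theorem two_pow_mul_choose_le {a b : ℕ} (h : 2 * a ≤ b) (m : ℕ) :
    2 ^ m * a.choose m ≤ b.choose m := by
  have hdesc := two_pow_mul_descFactorial_le h m
  rw [Nat.descFactorial_eq_factorial_mul_choose, Nat.descFactorial_eq_factorial_mul_choose,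
    mul_left_comm] at hdesc
  exact Nat.le_of_mul_le_mul_left hdesc m.factorial_pos

theorem failProb_not_subset_uniform_powersetCard_le {D : Finset β} (hD : 2 * D.card ≤ R.card)
    (hm : m ≤ R.card) (h : (R.powersetCard m).Nonempty) :
    failProb (PMF.uniformOfFinset (R.powersetCard m) h) (fun A => ¬ A ⊆ D) ≤ (1 / 2) ^ m := by
  classical
  have hchoose : (R.card.choose m : ℝ≥0∞) ≠ 0 := Nat.cast_ne_zero.2 (Nat.choose_pos hm).ne'
  simp_rw [failProb_eq_expect, ite_not, expect_uniformOfFinset, Finset.sum_boole,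
    Finset.card_powersetCard]
  rw [ENNReal.div_le_iff hchoose (ENNReal.natCast_ne_top _)]
  have hcard : ((R.powersetCard m).filter (· ⊆ D)).card ≤ D.card.choose m := by
    rw [← Finset.card_powersetCard]
    refine Finset.card_le_card fun A hA => ?_
    rw [Finset.mem_filter, Finset.mem_powersetCard] at hA
    exact Finset.mem_powersetCard.2 ⟨hA.2, hA.1.2⟩
  calc (((R.powersetCard m).filter (· ⊆ D)).card : ℝ≥0∞) ≤ D.card.choose m := mod_cast hcard
    _ = (1 / 2) ^ m * (2 ^ m * D.card.choose m) := by
      rw [← mul_assoc, ← mul_pow, ENNReal.div_mul_cancel two_ne_zero ENNReal.ofNat_ne_top, one_pow,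
        one_mul]
    _ ≤ (1 / 2) ^ m * R.card.choose m := by
      gcongr
      exact_mod_cast two_pow_mul_choose_le hD m

variable [DecidableEq β]

theorem card_filter_notMem_powersetCard_mul (ha : a ∈ R) :
    ((R.powersetCard m).filter fun A => a ∉ A).card * R.card
      = (R.card - m) * R.card.choose m := by
  have herase : (R.powersetCard m).filter (fun A => a ∉ A) = (R.erase a).powersetCard m := by
    ext A
    simp only [Finset.mem_filter, Finset.mem_powersetCard, Finset.subset_erase]
    tauto
  have hpascal := Nat.choose_mul_succ_eq (R.card - 1) m
  rw [Nat.sub_add_cancel (Finset.card_pos.2 ⟨a, ha⟩)] at hpascal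
  rw [herase, Finset.card_powersetCard, Finset.card_erase_of_mem ha, hpascal, mul_comm]

theorem card_filter_mem_powersetCard_mul (ha : a ∈ R) (hm : m ≤ R.card) :
    ((R.powersetCard m).filter fun A => a ∈ A).card * R.card = m * R.card.choose m := by
  have htotal : ((R.powersetCard m).filter fun A => a ∈ A).card * R.card
      + ((R.powersetCard m).filter fun A => a ∉ A).card * R.card
      = R.card.choose m * R.card := by
    rw [← add_mul, Finset.card_filter_add_card_filter_not, Finset.card_powersetCard]
  rw [card_filter_notMem_powersetCard_mul ha, Nat.sub_mul, mul_comm (R.card.choose m)] at htotal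
  have := Nat.mul_le_mul_right (R.card.choose m) hm
  lia

theorem expect_mem_uniform_powersetCard (ha : a ∈ R) (hm : m ≤ R.card)
    (h : (R.powersetCard m).Nonempty) (z : ℝ≥0∞) :
    expect (PMF.uniformOfFinset (R.powersetCard m) h) (fun A => if a ∈ A then z else 1)
      = hitFactor z R.card m := by
  have hR : (R.card : ℝ≥0∞) ≠ 0 := Nat.cast_ne_zero.2 (Finset.card_ne_zero_of_mem ha)
  have hchoose : (R.card.choose m : ℝ≥0∞) ≠ 0 := Nat.cast_ne_zero.2 (Nat.choose_pos hm).ne'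
  have hmem := congrArg (Nat.cast (R := ℝ≥0∞)) (card_filter_mem_powersetCard_mul ha hm)
  have hnotMem := congrArg (Nat.cast (R := ℝ≥0∞)) (card_filter_notMem_powersetCard_mul (m := m) ha)
  rw [Nat.cast_mul, Nat.cast_mul] at hmem hnotMem
  rw [expect_uniformOfFinset, Finset.sum_ite, Finset.sum_const, Finset.sum_const, nsmul_eq_mul,
    nsmul_eq_mul, mul_one, Finset.card_powersetCard, hitFactor, ENNReal.div_eq_div_iff hR
    (ENNReal.natCast_ne_top _) hchoose (ENNReal.natCast_ne_top _), mul_comm, add_mul,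
    mul_right_comm, hmem, hnotMem]
  ring

end RandomSubset

section Selection

variable {V : Type*} [Fintype V] {p : Params} {s : NodeState V}

theorem NodeState.mem_support_selectionLaw {A : Finset V}
    (h : A ∈ (s.selectionLaw p).support) :
    A ⊆ s.candidates p ∧ A.card = min (4 * p.tau) (s.candidates p).card :=
  Finset.mem_powersetCard.1 ((PMF.mem_support_uniformOfFinset_iff _ _).1 h)

theorem NodeState.selectionLaw_eq_uniform (h : 4 * p.tau ≤ (s.candidates p).card) :
    s.selectionLaw p = PMF.uniformOfFinset ((s.candidates p).powersetCard (4 * p.tau))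
      (Finset.powersetCard_nonempty.2 h) := by
  simp only [NodeState.selectionLaw, min_eq_left h]

end Selection

/-! ### Rounds of the shuffle phases -/

section ShuffleRel

variable {V : Type*} [Fintype V]

open Classical in
/-- The neighbours of `u` that sent `m_v` from their buffers between the global states `σ` and `σ'`
of a shuffle phase. -/
def shuffleSenders (G : SimpleGraph V) (σ σ' : V → NodeState V) (u v : V) : Finset V :=
  Finset.univ.filter fun w => G.Adj u w ∧ v ∈ (σ w).buffer ∧ v ∉ (σ' w).buffer

variable {G : SimpleGraph V} {σ σ' σ₁ σ₂ σ₃ : V → NodeState V} {c : V → V} {u v w : V} {m m' : ℕ}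

theorem mem_shuffleSenders :
    w ∈ shuffleSenders G σ σ' u v ↔ G.Adj u w ∧ v ∈ (σ w).buffer ∧ v ∉ (σ' w).buffer := by
  simp only [shuffleSenders, Finset.mem_filter, Finset.mem_univ, true_and]

theorem shuffleSenders_self : shuffleSenders G σ σ u v = ∅ :=
  Finset.eq_empty_of_forall_notMem fun _ hw =>
    (mem_shuffleSenders.1 hw).2.2 (mem_shuffleSenders.1 hw).2.1

theorem card_shuffleSenders_add (h : ∀ u, (σ₂ u).buffer ⊆ (σ₁ u).buffer)
    (h' : ∀ u, (σ₃ u).buffer ⊆ (σ₂ u).buffer) :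
    (shuffleSenders G σ₁ σ₂ u v).card + (shuffleSenders G σ₂ σ₃ u v).card
      = (shuffleSenders G σ₁ σ₃ u v).card := by
  classical
  rw [← Finset.card_union_of_disjoint]
  · congr 1
    ext w
    have := @h w v
    have := @h' w v
    simp only [Finset.mem_union, mem_shuffleSenders]
    tauto
  · exact Finset.disjoint_left.2 fun w hw hw' =>
      (mem_shuffleSenders.1 hw).2.2 (mem_shuffleSenders.1 hw').2.1

/-- How the global state `σ'` after `m` rounds of a shuffle phase is related to the global state `σ`
before them. -/
structure ShuffleRel (G : SimpleGraph V) (m : ℕ) (σ σ' : V → NodeState V) : Prop where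
  received_eq : ∀ u, (σ' u).received = (σ u).received
  sent_eq : ∀ u, (σ' u).sent = (σ u).sent
  cnt_eq : ∀ u, (σ' u).cnt = (σ u).cnt
  buffer_sub : ∀ u, (σ' u).buffer ⊆ (σ u).buffer
  buffer_card : ∀ u, (σ' u).buffer.card ≤ (σ u).buffer.card - m
  le_phasecnt : ∀ u v,
    (σ u).phasecnt v + (shuffleSenders G σ σ' u v).card ≤ (σ' u).phasecnt v
  /-- A node with an empty buffer repeats its own message, hence the restriction on `v`. -/
  phasecnt_eq : ∀ u v, ¬ G.Adj u v →
    (σ' u).phasecnt v = (σ u).phasecnt v + (shuffleSenders G σ σ' u v).card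

theorem ShuffleRel.refl (G : SimpleGraph V) (σ : V → NodeState V) : ShuffleRel G 0 σ σ where
  received_eq _ := rfl
  sent_eq _ := rfl
  cnt_eq _ := rfl
  buffer_sub _ := subset_rfl
  buffer_card _ := le_rfl
  le_phasecnt _ _ := by rw [shuffleSenders_self, Finset.card_empty, Nat.add_zero]
  phasecnt_eq _ _ _ := by rw [shuffleSenders_self, Finset.card_empty, Nat.add_zero]

theorem ShuffleRel.trans (h : ShuffleRel G m σ₁ σ₂) (h' : ShuffleRel G m' σ₂ σ₃) :
    ShuffleRel G (m + m') σ₁ σ₃ where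
  received_eq u := (h'.received_eq u).trans (h.received_eq u)
  sent_eq u := (h'.sent_eq u).trans (h.sent_eq u)
  cnt_eq u := (h'.cnt_eq u).trans (h.cnt_eq u)
  buffer_sub u := (h'.buffer_sub u).trans (h.buffer_sub u)
  buffer_card u := by
    have := h.buffer_card u
    have := h'.buffer_card u
    lia
  le_phasecnt u v := by
    rw [← card_shuffleSenders_add h.buffer_sub h'.buffer_sub, ← Nat.add_assoc]
    exact (Nat.add_le_add_right (h.le_phasecnt u v) _).trans (h'.le_phasecnt u v)
  phasecnt_eq u v huv := by
    rw [← card_shuffleSenders_add h.buffer_sub h'.buffer_sub, ← Nat.add_assoc,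
      ← h.phasecnt_eq u v huv, ← h'.phasecnt_eq u v huv]

variable [DecidableEq V]

theorem mem_shuffleSenders_deliver {i : ℕ} :
    w ∈ shuffleSenders G σ (fun u => (σ u).deliver G c u (.shuffle i)) u v ↔
      (G.Adj u w ∧ c w = v) ∧ v ∈ (σ w).buffer := by
  rw [mem_shuffleSenders, and_assoc, and_congr_right_iff]
  change _ → (_ ∧ v ∉ (σ w).buffer.erase (c w) ↔ _)
  rw [Finset.mem_erase]
  tauto

theorem shuffleRel_deliver (i : ℕ) (hc : ∀ u, (σ u).buffer.Nonempty → c u ∈ (σ u).buffer)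
    (hc' : ∀ u, ¬ (σ u).buffer.Nonempty → c u = u) :
    ShuffleRel G 1 σ fun u => (σ u).deliver G c u (.shuffle i) where
  received_eq _ := rfl
  sent_eq _ := rfl
  cnt_eq _ := rfl
  buffer_sub _ := Finset.erase_subset _ _
  buffer_card u := by
    change ((σ u).buffer.erase (c u)).card ≤ _
    by_cases hu : (σ u).buffer.Nonempty
    · exact (Finset.card_erase_of_mem (hc u hu)).le
    · rw [Finset.not_nonempty_iff_eq_empty.1 hu]
      exact Nat.zero_le _
  le_phasecnt u v := by
    classical
    exact Nat.add_le_add_left (Finset.card_le_card fun w hw =>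
      (Finset.mem_filter_univ w).2 (mem_shuffleSenders_deliver.1 hw).1) _
  phasecnt_eq u v huv := by
    classical
    refine congrArg (fun S => (σ u).phasecnt v + Finset.card S) (Finset.ext fun w => ?_)
    rw [Finset.mem_filter_univ, mem_shuffleSenders_deliver, iff_self_and]
    rintro ⟨hw, rfl⟩
    exact hc w <| by_contra fun hempty => huv ((hc' w hempty).symm ▸ hw)

end ShuffleRel

section ShuffleRun

variable {V : Type*}

section ShuffleMessage

variable {u : V} {rule : V ↪ ℕ} {s : NodeState V}

theorem NodeState.shuffleMessage_mem (h : s.buffer.Nonempty) :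
    s.shuffleMessage u rule ∈ s.buffer := by
  rw [NodeState.shuffleMessage, dif_pos h]
  exact (s.buffer.exists_min_image rule h).choose_spec.1

theorem NodeState.shuffleMessage_of_not_nonempty (h : ¬ s.buffer.Nonempty) :
    s.shuffleMessage u rule = u := dif_neg h

end ShuffleMessage

variable [Fintype V] [DecidableEq V]

/-- The global state after the preparations for round `t`, the round `i` of a shuffle phase. -/
def shuffleReady (p : Params) (tie : TieRule V) (t i : ℕ) (σ : V → NodeState V) :
    V → NodeState V :=
  fun u => (σ u).prepare p (tie u t (σ u)) (.shuffle i)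

/-- The global state at the end of round `t`, the round `i` of a shuffle phase, before a selection
is made. -/
def shuffleNext (p : Params) (G : SimpleGraph V) (tie : TieRule V) (t i : ℕ)
    (σ : V → NodeState V) : V → NodeState V :=
  let ready := shuffleReady p tie t i σ
  fun u => (ready u).deliver G (fun w => (ready w).shuffleMessage w (tie w t (ready w))) u
    (.shuffle i)

variable {p : Params} {G : SimpleGraph V} {tie : TieRule V} {t m i : ℕ}

theorem shuffleRel_shuffleNext (σ : V → NodeState V) :
    ShuffleRel G 1 (shuffleReady p tie t i σ) (shuffleNext p G tie t i σ) :=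
  shuffleRel_deliver i (fun _ => NodeState.shuffleMessage_mem)
    fun _ => NodeState.shuffleMessage_of_not_nonempty

theorem step_eq_of_shuffle (h : p.stage t = .shuffle i) (σ : V → NodeState V) :
    step p G tie t σ = if i + 1 = 8 * p.tau then
        (independent fun u => (shuffleNext p G tie t i σ u).selectionLaw p).map
          fun A u => (shuffleNext p G tie t i σ u).finishShuffle p (A u)
      else PMF.pure (shuffleNext p G tie t i σ) := by
  unfold step
  rw [h]
  simp only [NodeState.messageLaw]
  rw [independent_pure, PMF.pure_bind]
  rfl

theorem run_succ (p : Params) (G : SimpleGraph V) (tie : TieRule V) (t m : ℕ)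
    (σ : V → NodeState V) :
    run p G tie t (m + 1) σ = (run p G tie t m σ).bind (step p G tie (t + m)) := by
  induction m generalizing t σ with
  | zero =>
    rw [run, run, PMF.pure_bind]
    exact PMF.bind_pure _
  | succ m ih =>
    calc run p G tie t (m + 1 + 1) σ
        = (step p G tie t σ).bind fun σ₁ =>
            (run p G tie (t + 1) m σ₁).bind (step p G tie (t + 1 + m)) :=
          congrArg _ (funext fun σ₁ => ih (t + 1) σ₁)
      _ = ((step p G tie t σ).bind (run p G tie (t + 1) m)).bind (step p G tie (t + (m + 1))) := by
        rw [PMF.bind_bind, Nat.succ_add_eq_add_succ]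

theorem exists_run_eq_pure_of_shuffle (h : ∀ j < 8 * p.tau, p.stage (t + j) = .shuffle j)
    (hm : m < 8 * p.tau) (σ : V → NodeState V) :
    ∃ σ', run p G tie t m σ = PMF.pure σ' ∧
      ShuffleRel G m (shuffleReady p tie t 0 σ) (shuffleReady p tie (t + m) m σ') := by
  induction m with
  | zero => exact ⟨σ, rfl, ShuffleRel.refl _ _⟩
  | succ m ih =>
    obtain ⟨σ', hrun, hrel⟩ := ih (by lia)
    refine ⟨shuffleNext p G tie (t + m) m σ', ?_, hrel.trans (shuffleRel_shuffleNext σ')⟩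
    rw [run_succ, hrun, PMF.pure_bind, step_eq_of_shuffle (h m (by lia)), if_neg (by lia)]

theorem exists_run_eq_map_of_shuffle (hτ : 0 < p.tau)
    (h : ∀ j < 8 * p.tau, p.stage (t + j) = .shuffle j) (σ : V → NodeState V) :
    ∃ σ', ShuffleRel G (8 * p.tau) (shuffleReady p tie t 0 σ) σ' ∧
      run p G tie t (8 * p.tau) σ = (independent fun u => (σ' u).selectionLaw p).map
        fun A u => (σ' u).finishShuffle p (A u) := by
  obtain ⟨m, hm⟩ : ∃ m, 8 * p.tau = m + 1 := Nat.exists_eq_add_one.2 (by lia)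
  obtain ⟨σ₁, hrun, hrel⟩ := exists_run_eq_pure_of_shuffle (G := G) (tie := tie) h
    (show m < 8 * p.tau by lia) σ
  refine ⟨_, hm ▸ hrel.trans (shuffleRel_shuffleNext σ₁), ?_⟩
  rw [hm, run_succ, hrun, PMF.pure_bind, step_eq_of_shuffle (h m (by lia)), if_pos hm.symm]

end ShuffleRun

section Schedule

/-- The round with which the ranking phase number `r` starts, counted from `0`. -/
def Params.rankingStart (p : Params) (r : ℕ) : ℕ := 1 + p.tau + r * (p.tauRank + 8 * p.tau)

variable (p : Params) (r : ℕ) {j : ℕ}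

theorem Params.stage_random (hj : j < p.tau) : p.stage (1 + j) = .random j := by
  rw [Params.stage, if_neg (by lia), if_pos (by lia), Nat.add_sub_cancel_left]

theorem Params.stage_rankingStart_add (hj : j < p.tauRank + 8 * p.tau) :
    p.stage (p.rankingStart r + j)
      = if j < p.tauRank then .ranking j else .shuffle (j - p.tauRank) := by
  have hround : p.rankingStart r + j - 1 - p.tau = j + r * (p.tauRank + 8 * p.tau) := by
    unfold Params.rankingStart
    lia
  unfold Params.stage
  rw [if_neg (by unfold Params.rankingStart; lia), if_neg (by unfold Params.rankingStart; lia)]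
  simp only [hround, Nat.add_mul_mod_self_right, Nat.mod_eq_of_lt hj]

theorem Params.stage_ranking (hj : j < p.tauRank) :
    p.stage (p.rankingStart r + j) = .ranking j := by
  rw [Params.stage_rankingStart_add p r (by lia), if_pos hj]

theorem Params.stage_shuffle (hj : j < 8 * p.tau) :
    p.stage (p.rankingStart r + p.tauRank + j) = .shuffle j := by
  rw [add_assoc, Params.stage_rankingStart_add p r (by lia), if_neg (by lia),
    Nat.add_sub_cancel_left]

theorem Params.rankingStart_succ :
    p.rankingStart (r + 1) = p.rankingStart r + p.tauRank + 8 * p.tau := by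
  unfold Params.rankingStart
  ring

end Schedule

section Monotone

variable {V : Type*} [DecidableEq V]

theorem NodeState.received_prepare (p : Params) (rule : V ↪ ℕ) (s : NodeState V) (st : Stage) :
    (s.prepare p rule st).received = s.received := by
  unfold NodeState.prepare
  split <;> rfl

variable [Fintype V]

theorem NodeState.received_subset_deliver (G : SimpleGraph V) (c : V → V) (u : V)
    (s : NodeState V) (st : Stage) : s.received ⊆ (s.deliver G c u st).received := by
  unfold NodeState.deliver
  split
  · exact subset_rfl
  · exact Finset.subset_union_left

variable {p : Params} {G : SimpleGraph V} {tie : TieRule V} {t : ℕ} {σ σ' : V → NodeState V}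

theorem received_subset_of_mem_support_step (h : σ' ∈ (step p G tie t σ).support) (u : V) :
    (σ u).received ⊆ (σ' u).received := by
  have hnext (c : V → V) (st : Stage) : (σ u).received ⊆
      (((σ u).prepare p (tie u t (σ u)) st).deliver G c u st).received :=
    (NodeState.received_prepare p _ (σ u) st).symm.subset.trans
      (NodeState.received_subset_deliver G c u _ st)
  obtain ⟨c, -, h⟩ := (PMF.mem_support_bind_iff _ _ _).1 h
  split at h
  · split_ifs at h
    · obtain ⟨A, -, rfl⟩ := (PMF.mem_support_map_iff _ _ _).1 h
      exact (hnext c _).trans Finset.subset_union_left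
    · rw [(PMF.mem_support_pure_iff _ _).1 h]
      exact hnext c _
  · rw [(PMF.mem_support_pure_iff _ _).1 h]
    exact hnext c _

theorem failProb_complete_antitone (p : Params) (G : SimpleGraph V) (tie : TieRule V) :
    Antitone fun t => failProb (execution p G tie t) Complete := by
  refine antitone_nat_of_succ_le fun t => ?_
  change failProb ((execution p G tie t).bind _) Complete ≤ _
  refine (failProb_bind_le (Q := Complete) (ε := 0) fun σ _ hσ => ?_).trans (add_zero _).le
  exact (failProb_eq_zero fun σ' h u v => received_subset_of_mem_support_step h u (hσ u v)).le

end Monotone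

/-! ### The path of cliques -/

section Geometry

variable {N k : ℕ} {u u' v w : Fin N × Fin k}

/-- The distance of the cliques of two nodes on the path of cliques; one of the two truncated
differences is zero. -/
def cliqueDist (u v : Fin N × Fin k) : ℕ := (u.1.val - v.1.val) + (v.1.val - u.1.val)

theorem cliqueDist_comm (u v : Fin N × Fin k) : cliqueDist u v = cliqueDist v u :=
  Nat.add_comm _ _

theorem cliqueDist_triangle (u v w : Fin N × Fin k) :
    cliqueDist u w ≤ cliqueDist u v + cliqueDist v w := by
  unfold cliqueDist
  lia

theorem cliqueDist_eq_zero : cliqueDist u v = 0 ↔ v.1 = u.1 := by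
  rw [cliqueDist, Fin.ext_iff]
  lia

theorem cliqueDist_congr (h : cliqueDist u w = 0) : cliqueDist w v = cliqueDist u v := by
  rw [cliqueDist, cliqueDist, cliqueDist_eq_zero.1 h]

theorem eq_of_cliqueDist_eq_zero (h : cliqueDist u v = 0) (h' : v.2 = u.2) : v = u :=
  Prod.ext (cliqueDist_eq_zero.1 h) h'

theorem mk_eq_of_cliqueDist_eq_zero (h : cliqueDist u w = 0) : (u.1, w.2) = w :=
  Prod.ext (cliqueDist_eq_zero.1 h).symm rfl

theorem exists_next_clique {r : ℕ} (h : cliqueDist u v = r + 1) :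
    ∃ u' : Fin N × Fin k, cliqueDist u u' = 1 ∧ u'.2 = u.2 ∧ cliqueDist u' v = r := by
  unfold cliqueDist at *
  by_cases hlt : u.1.val < v.1.val
  · exact ⟨(⟨u.1.val + 1, by lia⟩, u.2), by simp only; lia, rfl, by simp only; lia⟩
  · exact ⟨(⟨u.1.val - 1, by lia⟩, u.2), by simp only; lia, rfl, by simp only; lia⟩

theorem card_le_three {S : Finset (Fin N × Fin k)} (j : Fin k)
    (hS : ∀ w ∈ S, cliqueDist u w = 0 ∧ w.2 = j ∨ cliqueDist u w = 1 ∧ w.2 = u.2) :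
    S.card ≤ 3 := by
  refine (Finset.card_le_card_of_injOn (fun w => w.1.val)
    (t := {u.1.val, u.1.val + 1, u.1.val - 1}) (fun w hw => ?_) fun w hw w' hw' h => ?_).trans
    Finset.card_le_three
  · have := hS w hw
    unfold cliqueDist at this
    simp only [Finset.coe_insert, Finset.coe_singleton, Set.mem_insert_iff, Set.mem_singleton_iff]
    lia
  · have hdist : cliqueDist u w = cliqueDist u w' := by
      rw [cliqueDist, cliqueDist, show w.1.val = w'.1.val from h]
    refine Prod.ext (Fin.ext h) ?_
    rcases hS w hw with ⟨h₁, e₁⟩ | ⟨h₁, e₁⟩ <;> rcases hS w' hw' with ⟨h₂, e₂⟩ | ⟨h₂, e₂⟩ <;>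
      first | exact e₁.trans e₂.symm | lia

theorem card_le_two_mul {α : Type*} {S : Finset α} {M : ℕ} (P : α → Prop) [DecidablePred P]
    (h : ∀ a₀ ∈ S, (S.filter fun a => P a ↔ P a₀).card ≤ M) : S.card ≤ 2 * M := by
  have hside (Q : α → Prop) [DecidablePred Q] (hQ : ∀ a a₀, Q a → Q a₀ → (P a ↔ P a₀)) :
      (S.filter Q).card ≤ M := by
    rcases (S.filter Q).eq_empty_or_nonempty with hempty | ⟨a₀, ha₀⟩
    · rw [hempty]
      exact Nat.zero_le M
    · refine (Finset.card_le_card fun a ha => ?_).trans (h a₀ (Finset.mem_filter.1 ha₀).1)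
      rw [Finset.mem_filter] at *
      exact ⟨ha.1, hQ a a₀ ha.2 ha₀.2⟩
  rw [← Finset.card_filter_add_card_filter_not P, two_mul]
  exact Nat.add_le_add (hside P fun _ _ => iff_of_true) (hside (¬ P ·) fun _ _ => iff_of_false)

/-- The nodes of the clique of `u` whose set `S w` contains the message `m_v`. -/
def cliqueHolders (S : Fin N × Fin k → Finset (Fin N × Fin k)) (u v : Fin N × Fin k) :
    Finset (Fin N × Fin k) :=
  Finset.univ.filter fun w => cliqueDist u w = 0 ∧ v ∈ S w

variable {S : Fin N × Fin k → Finset (Fin N × Fin k)}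

theorem mem_cliqueHolders : w ∈ cliqueHolders S u v ↔ cliqueDist u w = 0 ∧ v ∈ S w :=
  Finset.mem_filter_univ _

theorem card_cliqueHolders_le {T : Finset (Fin N × Fin k)} (j : Fin k)
    (h : ∀ w, cliqueDist u w = 0 → v ∈ S w → w.2 ≠ j → (u'.1, w.2) ∈ T) :
    (cliqueHolders S u v).card ≤ T.card + 1 := by
  have hle : ((cliqueHolders S u v).erase (u.1, j)).card ≤ T.card := by
    refine Finset.card_le_card_of_injOn (fun w => (u'.1, w.2)) (fun w hw => ?_)
      fun w hw w' hw' hww => ?_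
    all_goals
      rw [Finset.mem_coe, Finset.mem_erase, mem_cliqueHolders] at hw
    · exact h w hw.2.1 hw.2.2 fun hj => hw.1 (hj ▸ (mk_eq_of_cliqueDist_eq_zero hw.2.1).symm)
    · rw [Finset.mem_coe, Finset.mem_erase, mem_cliqueHolders] at hw'
      rw [← mk_eq_of_cliqueDist_eq_zero hw.2.1, ← mk_eq_of_cliqueDist_eq_zero hw'.2.1,
        (Prod.mk.inj hww).2]
  have := Finset.pred_card_le_card_erase (s := cliqueHolders S u v) (a := (u.1, j))
  lia

end Geometry

section CliquePath

variable {n k : ℕ} {u v w : Fin (n / k) × Fin k}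

theorem cliquePath_adj : (cliquePath n k).Adj u w ↔
    cliqueDist u w = 1 ∧ w.2 = u.2 ∨ cliqueDist u w = 0 ∧ w.2 ≠ u.2 := by
  rw [cliquePath, SimpleGraph.boxProd_adj, SimpleGraph.pathGraph_adj, SimpleGraph.top_adj,
    Fin.ext_iff (a := u.1), eq_comm (a := w.2), ne_comm (a := w.2), cliqueDist]
  lia

theorem cliqueDist_le_one_of_adj (h : (cliquePath n k).Adj u w) : cliqueDist u w ≤ 1 := by
  rcases cliquePath_adj.1 h with h | h <;> lia

theorem not_adj_of_two_le (h : 2 ≤ cliqueDist u w) : ¬ (cliquePath n k).Adj u w := fun hadj => by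
  have := cliqueDist_le_one_of_adj hadj
  lia

theorem adj_of_cliqueDist_eq_zero (h : cliqueDist u w = 0) (hne : w.2 ≠ u.2) :
    (cliquePath n k).Adj u w := cliquePath_adj.2 (.inr ⟨h, hne⟩)

theorem card_le_three_of_adj {S : Finset (Fin (n / k) × Fin k)} (j : Fin k)
    (hadj : ∀ w ∈ S, (cliquePath n k).Adj u w) (hS : ∀ w ∈ S, cliqueDist u w = 0 → w.2 = j) :
    S.card ≤ 3 :=
  card_le_three j fun w hw => (cliquePath_adj.1 (hadj w hw)).symm.imp_left
    fun h => ⟨h.1, hS w hw h.1⟩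

end CliquePath

section PhaseStarts

section NodeState

variable {V : Type*} {p : Params} {s : NodeState V} {v : V}

theorem NodeState.mem_fresh : v ∈ s.fresh p ↔ v ∈ s.received ∧ 2 * s.cnt v < p.tau := by
  rw [NodeState.fresh, Params.threshold, Finset.mem_filter, lt_div_iff₀ two_pos, mul_comm]
  norm_cast

variable [DecidableEq V]

/-- The messages from which a node draws in a ranking phase. -/
def NodeState.offered (s : NodeState V) : Finset V := s.unsent \ s.deferred

theorem NodeState.mem_offered :
    v ∈ s.offered ↔ (v ∈ s.received ∧ v ∉ s.sent) ∧ v ∉ s.deferred := by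
  rw [NodeState.offered, Finset.mem_sdiff, NodeState.unsent, Finset.mem_sdiff]

/-- The messages from which a node draws in a shuffle phase. -/
def NodeState.freshUnsent (p : Params) (s : NodeState V) : Finset V := s.fresh p ∩ s.unsent

theorem NodeState.mem_freshUnsent :
    v ∈ s.freshUnsent p ↔ v ∈ s.fresh p ∧ v ∉ s.sent := by
  rw [NodeState.freshUnsent, Finset.mem_inter, NodeState.unsent, Finset.mem_sdiff,
    and_congr_right_iff]
  exact fun h => and_iff_right (NodeState.mem_fresh.1 h).1

open Classical in
/-- The offered messages that are certain to be sent in a ranking phase if all goes well: those of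
rank at most `8 τ`, no matter how ties are broken. -/
def NodeState.leading (p : Params) (s : NodeState V) : Finset V :=
  s.offered.filter fun v => ∀ tie, s.rank tie s.offered v ≤ 8 * p.tau

theorem NodeState.mem_leading :
    v ∈ s.leading p ↔ v ∈ s.offered ∧ ∀ tie, s.rank tie s.offered v ≤ 8 * p.tau := by
  classical
  exact Finset.mem_filter

end NodeState

section Senders

variable {V : Type*} [Fintype V] {G : SimpleGraph V} {σ σ' : V → NodeState V} {u v w : V}

open Classical in
/-- The neighbours of `u` that have sent `m_v`. -/
def senders (G : SimpleGraph V) (σ : V → NodeState V) (u v : V) : Finset V :=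
  Finset.univ.filter fun w => G.Adj u w ∧ v ∈ (σ w).sent

theorem mem_senders : w ∈ senders G σ u v ↔ G.Adj u w ∧ v ∈ (σ w).sent := by
  classical
  exact Finset.mem_filter_univ w

theorem card_senders_add_card_newSenders (h : ∀ u, (σ u).sent ⊆ (σ' u).sent) :
    (senders G σ u v).card + (newSenders G σ σ' u v).card = (senders G σ' u v).card := by
  classical
  rw [← Finset.card_union_of_disjoint]
  · congr 1
    ext w
    have := @h w v
    rw [Finset.mem_union, mem_senders, mem_senders, mem_newSenders]
    tauto
  · exact Finset.disjoint_left.2 fun w hw hw' =>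
      (mem_newSenders.1 hw').2.2 (mem_senders.1 hw).2

theorem PopRel.cnt_le_card_senders (h : PopRel G σ σ') (huv : ¬ G.Adj u v)
    (hcnt : (σ u).cnt v ≤ (senders G σ u v).card) : (σ' u).cnt v ≤ (senders G σ' u v).card := by
  rw [h.cnt_eq u v huv, ← card_senders_add_card_newSenders h.sent_mono]
  exact Nat.add_le_add_right hcnt _

theorem PopRel.received_of_not_adj (h : PopRel G σ σ') (huv : ¬ G.Adj u v)
    (hv : v ∈ (σ' u).received) : v ∈ (σ u).received ∨ ∃ w, G.Adj u w ∧ v ∈ (σ w).buffer := by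
  rcases h.received_of u v hv with hv | hv | ⟨w, hw⟩
  · exact .inl hv
  · exact absurd hv huv
  · obtain ⟨hadj, hsent, hnot⟩ := mem_newSenders.1 hw
    refine .inr ⟨w, hadj, (((h.sent_of w v hsent).resolve_left hnot).resolve_left ?_)⟩
    rintro rfl
    exact huv hadj

variable [DecidableEq V]

open Classical in
/-- The messages that `u` knows or may receive from its neighbours in a ranking phase. -/
def incoming (G : SimpleGraph V) (σ : V → NodeState V) (u : V) : Finset V :=
  Finset.univ.filter fun v => v ∈ (σ u).received ∨ ∃ w, G.Adj u w ∧ v ∈ (σ w).offered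

theorem mem_incoming :
    v ∈ incoming G σ u ↔ v ∈ (σ u).received ∨ ∃ w, G.Adj u w ∧ v ∈ (σ w).offered := by
  classical
  exact Finset.mem_filter_univ v

end Senders

variable {n k : ℕ}

/-- The global states with which ranking phase number `r` (from `0`) starts, if all goes well. -/
structure RankingStart (p : Params) (r : ℕ) (σ : Fin (n / k) × Fin k → NodeState _) : Prop where
  known : ∀ u v, cliqueDist u v ≤ r → v ∈ (σ u).received ∧ p.tau ≤ 2 * (σ u).cnt v
  sent_layer : ∀ u v, r + 1 ≤ cliqueDist u v → v ∈ (σ u).sent → v.2 = u.2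
  cnt_le : ∀ u v, r + 2 ≤ cliqueDist u v → (σ u).cnt v ≤ (senders (cliquePath n k) σ u v).card
  offered_near : ∀ u v, v ∈ (σ u).offered →
    cliqueDist u v ≤ r + 1 ∨ r = 0 ∧ cliqueDist u v = 2 ∧ v.2 = u.2
  received_far : ∀ u v, v ∈ (σ u).received → r + 2 ≤ cliqueDist u v →
    r ≤ 1 ∧ cliqueDist u v = r + 2 ∧ v.2 = u.2
  buffer_bound : ∀ u, ((incoming (cliquePath n k) σ u).filter
    fun v => r + 2 ≤ cliqueDist u v).card ≤ 8 * p.tau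
  holders : ∀ u v, cliqueDist u v = r + 1 →
    p.tau + 4 ≤ 2 * (cliqueHolders (fun w => (σ w).leading p) u v).card

/-- The global states with which shuffle phase number `r` (from `0`) starts, if all goes well. -/
structure ShuffleStart (p : Params) (r : ℕ) (σ : Fin (n / k) × Fin k → NodeState _) : Prop where
  known : ∀ u v, cliqueDist u v ≤ r + 1 → v ∈ (σ u).received ∧ p.tau ≤ 2 * (σ u).cnt v
  sent_layer : ∀ u v, r + 2 ≤ cliqueDist u v → v ∈ (σ u).sent → v.2 = u.2
  cnt_le : ∀ u v, r + 2 ≤ cliqueDist u v → (σ u).cnt v ≤ (senders (cliquePath n k) σ u v).card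
  received_far : ∀ u v, v ∈ (σ u).received → r + 3 ≤ cliqueDist u v →
    r = 0 ∧ cliqueDist u v = 3 ∧ v.2 = u.2
  buffer_bound : ∀ u, ((σ u).freshUnsent p).card ≤ 8 * p.tau
  holders : ∀ u v, cliqueDist u v = r + 2 →
    p.tau + 2 ≤ 2 * (cliqueHolders (fun w => (σ w).freshUnsent p) u v).card

theorem card_senders_le_three {σ : Fin (n / k) × Fin k → NodeState _} {u v : Fin (n / k) × Fin k}
    (h : ∀ w, cliqueDist u w = 0 → v ∈ (σ w).sent → v.2 = w.2) :
    (senders (cliquePath n k) σ u v).card ≤ 3 :=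
  card_le_three_of_adj v.2 (fun _ hw => (mem_senders.1 hw).1)
    fun w hw hd => (h w hd (mem_senders.1 hw).2).symm

theorem ShuffleStart.cnt_le_three {p : Params} {r : ℕ} {σ : Fin (n / k) × Fin k → NodeState _}
    (h : ShuffleStart p r σ) {u v : Fin (n / k) × Fin k} (huv : r + 2 ≤ cliqueDist u v) :
    (σ u).cnt v ≤ 3 :=
  (h.cnt_le u v huv).trans <| card_senders_le_three fun w hw =>
    h.sent_layer w v (huv.trans (cliqueDist_congr hw).ge)

end PhaseStarts

/-! ### Ranking phases -/

section RankingPhase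

variable {n k r : ℕ} {p : Params} {σ σ' : Fin (n / k) × Fin k → NodeState _}
  {u v w : Fin (n / k) × Fin k}

theorem RankingStart.prepare (h : RankingStart p r σ) (tie : Fin (n / k) × Fin k → (_ ↪ ℕ)) :
    RankingStart p r fun u => (σ u).prepare p (tie u) (.ranking 0) :=
  ⟨h.known, h.sent_layer, h.cnt_le, h.offered_near, h.received_far, h.buffer_bound, h.holders⟩

theorem RankingStart.layer_eq_of_sent (h : RankingStart p r σ)
    (hbuf : ∀ u, (σ u).buffer = (σ u).offered) (hrel : PopRel (cliquePath n k) σ σ')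
    (huv : r + 2 ≤ cliqueDist u v) (hv : v ∈ (σ' u).sent) : v.2 = u.2 := by
  rcases hrel.sent_of u v hv with hv | rfl | hv
  · exact h.sent_layer u v (by lia) hv
  · rfl
  · rw [hbuf] at hv
    rcases h.offered_near u v hv with hnear | hfar
    · lia
    · exact hfar.2.2

theorem RankingStart.cnt_le_card_senders (h : RankingStart p r σ)
    (hrel : PopRel (cliquePath n k) σ σ') (huv : r + 2 ≤ cliqueDist u v) :
    (σ' u).cnt v ≤ (senders (cliquePath n k) σ' u v).card :=
  hrel.cnt_le_card_senders (not_adj_of_two_le (by lia)) (h.cnt_le u v huv)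

/-- All nodes of the clique of `u` that are certain to send `m_v` are neighbours of `u`, except
possibly `u` itself. -/
theorem RankingStart.le_card_newSenders (h : RankingStart p r σ)
    (hsend : ∀ u, (σ u).leading p ⊆ (σ' u).sent) (huv : cliqueDist u v = r + 1) :
    p.tau + 2 ≤ 2 * (newSenders (cliquePath n k) σ σ' u v).card := by
  have := h.holders u v huv
  have : (cliqueHolders (fun w => (σ w).leading p) u v).card
      ≤ (newSenders (cliquePath n k) σ σ' u v).card + 1 :=
    card_cliqueHolders_le (u' := u) u.2 fun w hw hv hne => by
      rw [mk_eq_of_cliqueDist_eq_zero hw, mem_newSenders]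
      exact ⟨adj_of_cliqueDist_eq_zero hw hne, hsend w hv,
        (NodeState.mem_offered.1 (NodeState.mem_leading.1 hv).1).1.2⟩
  lia

theorem RankingStart.known_succ (h : RankingStart p r σ) (hrel : PopRel (cliquePath n k) σ σ')
    (hsend : ∀ u, (σ u).leading p ⊆ (σ' u).sent) (huv : cliqueDist u v ≤ r + 1) :
    v ∈ (σ' u).received ∧ p.tau ≤ 2 * (σ' u).cnt v := by
  have hcnt := hrel.le_cnt u v
  rcases Nat.le_or_eq_of_le_succ huv with huv | huv
  · obtain ⟨hmem, hle⟩ := h.known u v huv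
    exact ⟨hrel.received_mono u hmem, by lia⟩
  · have hle := h.le_card_newSenders hsend huv
    exact ⟨hrel.received_of_newSenders u v (Finset.card_pos.1 (by lia)), by lia⟩

theorem RankingStart.received_far_succ (h : RankingStart p r σ)
    (hbuf : ∀ u, (σ u).buffer = (σ u).offered) (hrel : PopRel (cliquePath n k) σ σ')
    (hv : v ∈ (σ' u).received) (huv : r + 3 ≤ cliqueDist u v) :
    r = 0 ∧ cliqueDist u v = 3 ∧ v.2 = u.2 := by
  rcases hrel.received_of_not_adj (not_adj_of_two_le (by lia)) hv with hv | ⟨w, hw, hv⟩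
  · have := h.received_far u v hv (by lia)
    lia
  · rw [hbuf] at hv
    have hnear := h.offered_near w v hv
    have := cliqueDist_triangle u w v
    rcases cliquePath_adj.1 hw with ⟨hd, hlayer⟩ | ⟨hd, -⟩
    · rw [← hlayer]
      lia
    · lia

theorem RankingStart.card_freshUnsent_le (h : RankingStart p r σ)
    (hbuf : ∀ u, (σ u).buffer = (σ u).offered) (hrel : PopRel (cliquePath n k) σ σ')
    (hsend : ∀ u, (σ u).leading p ⊆ (σ' u).sent) (u : Fin (n / k) × Fin k) :
    ((σ' u).freshUnsent p).card ≤ 8 * p.tau := by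
  refine (Finset.card_le_card fun v hv => ?_).trans (h.buffer_bound u)
  obtain ⟨hmem, hcnt⟩ := NodeState.mem_fresh.1 (NodeState.mem_freshUnsent.1 hv).1
  have hfar : r + 2 ≤ cliqueDist u v := by
    by_contra hlt
    have := (h.known_succ hrel hsend (u := u) (v := v) (by lia)).2
    lia
  simp only [Finset.mem_filter, mem_incoming, ← hbuf]
  exact ⟨hrel.received_of_not_adj (not_adj_of_two_le (by lia)) hmem, hfar⟩

/-- The matching edges carry the copies of `m_v` in the adjacent clique to the clique of `u`. -/
theorem RankingStart.le_card_cliqueHolders_freshUnsent (h : RankingStart p r σ)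
    (hτ : 6 < p.tau) (hbuf : ∀ u, (σ u).buffer = (σ u).offered)
    (hrel : PopRel (cliquePath n k) σ σ') (hsend : ∀ u, (σ u).leading p ⊆ (σ' u).sent)
    (huv : cliqueDist u v = r + 2) :
    p.tau + 2 ≤ 2 * (cliqueHolders (fun w => (σ' w).freshUnsent p) u v).card := by
  obtain ⟨u', huu', -, hu'v⟩ := exists_next_clique huv
  have := h.holders u' v hu'v
  have : (cliqueHolders (fun w => (σ w).leading p) u' v).card
      ≤ (cliqueHolders (fun w => (σ' w).freshUnsent p) u v).card + 1 := by
    refine card_cliqueHolders_le (u' := u) v.2 fun w hw hv hne => ?_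
    have hdist {x : Fin (n / k) × Fin k} (hx : cliqueDist u x = 0) : r + 2 ≤ cliqueDist x v :=
      (cliqueDist_congr hx ▸ huv).ge
    have hd : cliqueDist u (u.1, w.2) = 0 := cliqueDist_eq_zero.2 rfl
    have hcnt : (σ' (u.1, w.2)).cnt v ≤ 3 :=
      (h.cnt_le_card_senders hrel (hdist hd)).trans <| card_senders_le_three fun x hx hv =>
        h.layer_eq_of_sent hbuf hrel (hdist ((cliqueDist_congr hd).symm.trans hx)) hv
    have hadj : (cliquePath n k).Adj (u.1, w.2) w := by
      refine cliquePath_adj.2 (.inl ⟨?_, rfl⟩)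
      rw [cliqueDist_congr hd, cliqueDist_comm, cliqueDist_congr hw, cliqueDist_comm, huu']
    have hmem : v ∈ (σ' (u.1, w.2)).received :=
      hrel.received_of_newSenders _ _ ⟨w, mem_newSenders.2
        ⟨hadj, hsend w hv, (NodeState.mem_offered.1 (NodeState.mem_leading.1 hv).1).1.2⟩⟩
    refine mem_cliqueHolders.2 ⟨hd, NodeState.mem_freshUnsent.2
      ⟨NodeState.mem_fresh.2 ⟨hmem, by lia⟩, fun hsent => hne ?_⟩⟩
    exact (h.layer_eq_of_sent hbuf hrel (hdist hd) hsent).symm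
  lia

theorem RankingStart.shuffleStart (h : RankingStart p r σ) (hτ : 6 < p.tau)
    (hbuf : ∀ u, (σ u).buffer = (σ u).offered) (hrel : PopRel (cliquePath n k) σ σ')
    (hsend : ∀ u, (σ u).leading p ⊆ (σ' u).sent) : ShuffleStart p r σ' where
  known _ _ := h.known_succ hrel hsend
  sent_layer _ _ := h.layer_eq_of_sent hbuf hrel
  cnt_le _ _ := h.cnt_le_card_senders hrel
  received_far _ _ := h.received_far_succ hbuf hrel
  buffer_bound := h.card_freshUnsent_le hbuf hrel hsend
  holders _ _ := h.le_card_cliqueHolders_freshUnsent hτ hbuf hrel hsend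

end RankingPhase

/-! ### Shuffle phases -/

section Candidates

theorem NodeState.mem_candidates {V : Type*} [Fintype V] {p : Params} {s : NodeState V} {v : V} :
    v ∈ s.candidates p ↔ 0 < s.phasecnt v ∧ p.cHat * p.threshold ≤ s.phasecnt v ∧
      2 * s.cnt v < p.tau := by
  rw [NodeState.candidates, Finset.mem_filter_univ, Params.threshold,
    lt_div_iff₀ two_pos, mul_comm (s.cnt v : ℝ)]
  norm_cast

variable {n k r : ℕ} {p : Params} {tie : TieRule (Fin (n / k) × Fin k)} {t : ℕ}
  {σ σ' : Fin (n / k) × Fin k → NodeState _} {u v w : Fin (n / k) × Fin k}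

theorem ShuffleStart.prepare (h : ShuffleStart p r σ) :
    ShuffleStart p r (shuffleReady p tie t 0 σ) :=
  ⟨h.known, h.sent_layer, h.cnt_le, h.received_far, h.buffer_bound, h.holders⟩

theorem ShuffleStart.le_cliqueDist_of_two_mul_cnt_lt (h : ShuffleStart p r σ)
    (hcnt : 2 * (σ u).cnt v < p.tau) : r + 2 ≤ cliqueDist u v := by
  by_contra hlt
  have := (h.known u v (by lia)).2
  lia

theorem ShuffleStart.card_shuffleSenders_le_three (h : ShuffleStart p r σ)
    (hbuf : ∀ u, (σ u).buffer = (σ u).freshUnsent p) (huv : r + 3 ≤ cliqueDist u v) :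
    (shuffleSenders (cliquePath n k) σ σ' u v).card ≤ 3 := by
  refine card_le_three_of_adj v.2 (fun w hw => (mem_shuffleSenders.1 hw).1) fun w hw hd => ?_
  have hmem := (mem_shuffleSenders.1 hw).2.1
  rw [hbuf, NodeState.mem_freshUnsent, NodeState.mem_fresh] at hmem
  exact (h.received_far w v hmem.1.1 (huv.trans (cliqueDist_congr hd).ge)).2.2.symm

theorem ShuffleStart.buffer_eq_empty (h : ShuffleStart p r σ)
    (hbuf : ∀ u, (σ u).buffer = (σ u).freshUnsent p)
    (hrel : ShuffleRel (cliquePath n k) (8 * p.tau) σ σ') (u : Fin (n / k) × Fin k) :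
    (σ' u).buffer = ∅ := by
  rw [← Finset.card_eq_zero, ← Nat.le_zero]
  exact (hrel.buffer_card u).trans (Nat.sub_eq_zero_of_le (hbuf u ▸ h.buffer_bound u)).le

theorem ShuffleStart.le_two_mul_phasecnt (h : ShuffleStart p r σ)
    (hbuf : ∀ u, (σ u).buffer = (σ u).freshUnsent p)
    (hrel : ShuffleRel (cliquePath n k) (8 * p.tau) σ σ') (huv : cliqueDist u v = r + 2) :
    p.tau ≤ 2 * (σ' u).phasecnt v := by
  have := h.holders u v huv
  have := hrel.le_phasecnt u v
  have : (cliqueHolders (fun w => (σ w).freshUnsent p) u v).card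
      ≤ (shuffleSenders (cliquePath n k) σ σ' u v).card + 1 :=
    card_cliqueHolders_le (u' := u) u.2 fun w hw hv hne => by
      rw [mk_eq_of_cliqueDist_eq_zero hw, mem_shuffleSenders, hbuf,
        h.buffer_eq_empty hbuf hrel w]
      exact ⟨adj_of_cliqueDist_eq_zero hw hne, hv, Finset.notMem_empty v⟩
  lia

/-- Closer messages are no longer fresh, and farther ones are counted at most four times. -/
theorem ShuffleStart.mem_candidates (h : ShuffleStart p r σ) (hτ : 6 < p.tau)
    (hc : p.cHat ≤ 1 / 2) (hc' : 4 < p.cHat * p.threshold)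
    (hbuf : ∀ u, (σ u).buffer = (σ u).freshUnsent p) (hphase : ∀ u v, (σ u).phasecnt v ≤ 1)
    (hrel : ShuffleRel (cliquePath n k) (8 * p.tau) σ σ') :
    v ∈ (σ' u).candidates p ↔ cliqueDist u v = r + 2 := by
  rw [NodeState.mem_candidates, hrel.cnt_eq u]
  constructor
  · rintro ⟨-, hcount, hcnt⟩
    refine le_antisymm (by_contra fun hlt => ?_) (h.le_cliqueDist_of_two_mul_cnt_lt hcnt)
    have hfew : (σ' u).phasecnt v ≤ 4 := by
      rw [hrel.phasecnt_eq u v (not_adj_of_two_le (by lia))]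
      have := h.card_shuffleSenders_le_three (σ' := σ') hbuf (u := u) (v := v) (by lia)
      have := hphase u v
      lia
    have : ((σ' u).phasecnt v : ℝ) ≤ 4 := by exact_mod_cast hfew
    linarith
  · intro hd
    have hmany := h.le_two_mul_phasecnt hbuf hrel hd
    have hcnt := h.cnt_le_three hd.ge
    refine ⟨by lia, ?_, by lia⟩
    calc p.cHat * p.threshold ≤ 1 * p.threshold := by
          unfold Params.threshold
          gcongr
          linarith
      _ ≤ (σ' u).phasecnt v := by
        rw [Params.threshold, one_mul, div_le_iff₀ two_pos, mul_comm]
        exact_mod_cast hmany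

end Candidates

section BalancedSelection

/-- A selection `A` of at most `4 τ` messages at clique distance `s` by every node that leaves no
message at this distance aside: every clique holds more than `τ / 2` copies of it, and a node that
has two cliques at distance `s` selects messages of both. -/
structure BalancedSelection {N k : ℕ} (p : Params) (s : ℕ)
    (A : Fin N × Fin k → Finset (Fin N × Fin k)) : Prop where
  cliqueDist_eq : ∀ u v, v ∈ A u → cliqueDist u v = s
  card_le : ∀ u, (A u).card ≤ 4 * p.tau
  many : ∀ u v, cliqueDist u v = s → p.tau + 6 ≤ 2 * (cliqueHolders A u v).card
  both : ∀ u v v', cliqueDist u v = s → cliqueDist u v' = s → v.1 ≠ v'.1 → ∃ x ∈ A u, x.1 ≠ v.1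

section Relay

variable {N k s : ℕ} {p : Params} {u v v₀ v₁ w : Fin N × Fin k} {S : Finset (Fin N × Fin k)}
  {A : Fin N × Fin k → Finset (Fin N × Fin k)}

theorem exists_cliqueDist_eq_of_two_sides (hs : 0 < s) (h₀ : cliqueDist u v₀ = s + 1)
    (h₁ : cliqueDist u v₁ = s + 1) (hne : v₁.1 ≠ v₀.1) (hw : cliqueDist u w = 1)
    (hwv : cliqueDist w v₀ = s) : ∃ v', cliqueDist w v' = s ∧ v₀.1 ≠ v'.1 := by
  have hwv₁ : cliqueDist v₁ w = s + 2 ∧ 3 ≤ cliqueDist v₁ v₀ := by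
    rw [Ne, Fin.ext_iff] at hne
    unfold cliqueDist at *
    lia
  obtain ⟨x, hx, -, hxw⟩ := exists_next_clique hwv₁.1
  obtain ⟨v', hv', -, hvw⟩ := exists_next_clique hxw
  refine ⟨v', (cliqueDist_comm _ _).trans hvw, fun he => ?_⟩
  have := cliqueDist_triangle v₁ x v₀
  rw [cliqueDist_comm x v₀, cliqueDist_congr (cliqueDist_eq_zero.2 he),
    cliqueDist_comm v' x] at this
  lia

theorem card_filter_clique_le (hA : ∀ u v, v ∈ A u → cliqueDist u v = s)
    (hS : ∀ v ∈ S, cliqueDist u v = s + 1 ∧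
      (v.2 = u.2 ∨ ∃ w, cliqueDist u w = 1 ∧ w.2 = u.2 ∧ v ∈ A w))
    (hw : cliqueDist u w = 1) (hwu : w.2 = u.2) (hwv : cliqueDist w v₀ = s) :
    (S.filter fun v => v.1 = v₀.1).card ≤ ((A w).filter fun v => v.1 = v₀.1).card + 1 := by
  refine (Finset.card_le_card fun v hv => ?_).trans (Finset.card_insert_le (v₀.1, u.2) _)
  obtain ⟨hvS, hv⟩ := Finset.mem_filter.1 hv
  obtain ⟨hd, hlayer | ⟨w', hw', hwu', hvw'⟩⟩ := hS v hvS
  · exact Finset.mem_insert.2 (.inl (Prod.ext hv hlayer))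
  · have hww : w = w' := by
      refine eq_of_cliqueDist_eq_zero ?_ (hwu.trans hwu'.symm)
      have := hA w' v hvw'
      rw [Fin.ext_iff] at hv
      unfold cliqueDist at *
      lia
    exact Finset.mem_insert_of_mem (Finset.mem_filter.2 ⟨hww ▸ hvw', hv⟩)

theorem BalancedSelection.card_filter_clique_le_of_two_sides (hA : BalancedSelection p s A)
    (hs : 0 < s)
    (hS : ∀ v ∈ S, cliqueDist u v = s + 1 ∧
      (v.2 = u.2 ∨ ∃ w, cliqueDist u w = 1 ∧ w.2 = u.2 ∧ v ∈ A w))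
    (h₀ : v₀ ∈ S) (h₁ : v₁ ∈ S) (hne : v₁.1 ≠ v₀.1) :
    (S.filter fun v => v.1 = v₀.1).card ≤ 4 * p.tau := by
  obtain ⟨w, hw, hwu, hwv⟩ := exists_next_clique (hS v₀ h₀).1
  obtain ⟨v', hv', hne'⟩ :=
    exists_cliqueDist_eq_of_two_sides hs (hS v₀ h₀).1 (hS v₁ h₁).1 hne hw hwv
  have hlt : ((A w).filter fun v => v.1 = v₀.1).card < (A w).card :=
    Finset.card_lt_card (Finset.filter_ssubset.2 (hA.both w v₀ v' hwv hv' hne'))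
  have := card_filter_clique_le hA.cliqueDist_eq hS hw hwu hwv
  have := hA.card_le w
  lia

theorem BalancedSelection.card_le_of_relay (hA : BalancedSelection p s A) (hτ : 0 < p.tau)
    (hs : 0 < s)
    (hS : ∀ v ∈ S, cliqueDist u v = s + 1 ∧
      (v.2 = u.2 ∨ ∃ w, cliqueDist u w = 1 ∧ w.2 = u.2 ∧ v ∈ A w)) :
    S.card ≤ 8 * p.tau := by
  by_cases hex : ∀ v₀ ∈ S, ∃ v₁ ∈ S, v₁.1 ≠ v₀.1
  · refine (card_le_two_mul (u.1 < ·.1) (M := 4 * p.tau) fun v₀ h₀ => ?_).trans (by lia)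
    obtain ⟨v₁, h₁, hne⟩ := hex v₀ h₀
    refine (Finset.card_le_card fun v hv => ?_).trans
      (hA.card_filter_clique_le_of_two_sides hs hS h₀ h₁ hne)
    obtain ⟨hvS, hside⟩ := Finset.mem_filter.1 hv
    refine Finset.mem_filter.2 ⟨hvS, Fin.ext ?_⟩
    have hd := (hS v hvS).1
    have hd₀ := (hS v₀ h₀).1
    rw [Fin.lt_def, Fin.lt_def] at hside
    unfold cliqueDist at hd hd₀
    lia
  · push Not at hex
    obtain ⟨v₀, h₀, hall⟩ := hex
    obtain ⟨w, hw, hwu, hwv⟩ := exists_next_clique (hS v₀ h₀).1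
    have hle := card_filter_clique_le hA.cliqueDist_eq hS hw hwu hwv
    rw [Finset.filter_true_of_mem hall] at hle
    have := (Finset.card_filter_le (A w) fun v => v.1 = v₀.1).trans (hA.card_le w)
    lia

end Relay

theorem NodeState.rank_le_card_selected {V : Type*} [DecidableEq V]
    {s : NodeState V} {tie : V ↪ ℕ} {B : Finset V} {v : V} (hv : v ∈ s.selected) :
    s.rank tie B v ≤ s.selected.card := by
  classical
  refine Finset.card_le_card fun w hw => by_contra fun hws => ?_
  have hle := (Finset.mem_filter.1 hw).2
  rw [NodeState.sortKey, NodeState.sortKey, if_neg hws, if_pos hv, Prod.Lex.toLex_le_toLex] at hle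
  simp at hle

variable {n k r : ℕ} {p : Params} {σ σ' : Fin (n / k) × Fin k → NodeState _}
  {u v w : Fin (n / k) × Fin k} {A : Fin (n / k) × Fin k → Finset (Fin (n / k) × Fin k)}

theorem ShuffleRel.mem_received_finishShuffle (hrel : ShuffleRel (cliquePath n k) (8 * p.tau) σ σ')
    (hcand : ∀ u v, v ∈ (σ' u).candidates p ↔ cliqueDist u v = r + 2) :
    v ∈ ((σ' u).finishShuffle p (A u)).received ↔ v ∈ (σ u).received ∨ cliqueDist u v = r + 2 := by
  rw [← hcand, ← hrel.received_eq]
  exact Finset.mem_union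

theorem NodeState.mem_deferred_finishShuffle {V : Type*} [Fintype V] [DecidableEq V]
    {s : NodeState V} {B : Finset V} {v : V} : v ∈ (s.finishShuffle p B).deferred ↔
      v ∈ (s.finishShuffle p B).fresh p ∧ v ∉ B := Finset.mem_sdiff

theorem ShuffleStart.mem_of_mem_offered (h : ShuffleStart p r σ) (hτ : 6 < p.tau)
    (hrel : ShuffleRel (cliquePath n k) (8 * p.tau) σ σ')
    (hv : v ∈ ((σ' u).finishShuffle p (A u)).offered) (huv : r + 2 ≤ cliqueDist u v) :
    v ∈ A u := by
  obtain ⟨⟨hmem, -⟩, hdeferred⟩ := NodeState.mem_offered.1 hv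
  rw [NodeState.mem_deferred_finishShuffle, NodeState.mem_fresh, not_and_not_right] at hdeferred
  refine hdeferred ⟨hmem, ?_⟩
  change 2 * (σ' u).cnt v < _
  rw [hrel.cnt_eq]
  have := h.cnt_le_three huv
  lia

theorem ShuffleStart.cliqueDist_le_of_mem_offered (h : ShuffleStart p r σ) (hτ : 6 < p.tau)
    (hrel : ShuffleRel (cliquePath n k) (8 * p.tau) σ σ') (hA : BalancedSelection p (r + 2) A)
    (hv : v ∈ ((σ' u).finishShuffle p (A u)).offered) : cliqueDist u v ≤ r + 2 := by
  by_contra hlt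
  exact hlt (hA.cliqueDist_eq u v (h.mem_of_mem_offered hτ hrel hv (by lia))).le

theorem ShuffleStart.of_mem_incoming (h : ShuffleStart p r σ) (hτ : 6 < p.tau)
    (hrel : ShuffleRel (cliquePath n k) (8 * p.tau) σ σ')
    (hcand : ∀ u v, v ∈ (σ' u).candidates p ↔ cliqueDist u v = r + 2)
    (hA : BalancedSelection p (r + 2) A)
    (hv : v ∈ incoming (cliquePath n k) (fun u => (σ' u).finishShuffle p (A u)) u)
    (huv : r + 3 ≤ cliqueDist u v) :
    cliqueDist u v = r + 2 + 1 ∧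
      (v.2 = u.2 ∨ ∃ w, cliqueDist u w = 1 ∧ w.2 = u.2 ∧ v ∈ A w) := by
  rcases mem_incoming.1 hv with hv | ⟨w, hadj, hv⟩
  · rcases (hrel.mem_received_finishShuffle hcand).1 hv with hv | hv
    · have := h.received_far u v hv huv
      exact ⟨by lia, .inl this.2.2⟩
    · lia
  · have hd := h.cliqueDist_le_of_mem_offered hτ hrel hA hv
    have := cliqueDist_triangle u w v
    rcases cliquePath_adj.1 hadj with ⟨huw, hlayer⟩ | ⟨huw, -⟩
    · exact ⟨by lia, .inr ⟨w, huw, hlayer, h.mem_of_mem_offered hτ hrel hv (by lia)⟩⟩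
    · lia

theorem ShuffleStart.mem_leading (h : ShuffleStart p r σ)
    (hrel : ShuffleRel (cliquePath n k) (8 * p.tau) σ σ')
    (hcand : ∀ u v, v ∈ (σ' u).candidates p ↔ cliqueDist u v = r + 2)
    (hA : BalancedSelection p (r + 2) A) (hv : v ∈ A w) (hne : w.2 ≠ v.2) :
    v ∈ ((σ' w).finishShuffle p (A w)).leading p := by
  have hd := hA.cliqueDist_eq w v hv
  refine NodeState.mem_leading.2 ⟨NodeState.mem_offered.2 ⟨⟨?_, fun hsent => hne ?_⟩, ?_⟩,
    fun tie => ?_⟩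
  · exact (hrel.mem_received_finishShuffle hcand).2 (.inr hd)
  · exact (h.sent_layer w v hd.ge (hrel.sent_eq w ▸ hsent)).symm
  · exact fun hdeferred => (NodeState.mem_deferred_finishShuffle.1 hdeferred).2 hv
  · have := (NodeState.rank_le_card_selected (s := (σ' w).finishShuffle p (A w)) (tie := tie)
      (B := ((σ' w).finishShuffle p (A w)).offered) hv).trans (hA.card_le w)
    lia

theorem ShuffleStart.rankingStart (h : ShuffleStart p r σ) (hτ : 6 < p.tau)
    (hrel : ShuffleRel (cliquePath n k) (8 * p.tau) σ σ')
    (hcand : ∀ u v, v ∈ (σ' u).candidates p ↔ cliqueDist u v = r + 2)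
    (hA : BalancedSelection p (r + 2) A) :
    RankingStart p (r + 1) fun u => (σ' u).finishShuffle p (A u) where
  known u v huv := by
    obtain ⟨hmem, hcnt⟩ := h.known u v huv
    exact ⟨(hrel.mem_received_finishShuffle hcand).2 (.inl hmem), hcnt.trans_eq
      (congrArg (fun c : _ → ℕ => 2 * c v) (hrel.cnt_eq u).symm)⟩
  sent_layer u v huv hsent := h.sent_layer u v huv (hrel.sent_eq u ▸ hsent)
  cnt_le u v huv := by
    have hsenders : senders (cliquePath n k) (fun u => (σ' u).finishShuffle p (A u)) u v
        = senders (cliquePath n k) σ u v :=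
      Finset.ext fun w => by
        rw [mem_senders, mem_senders, ← hrel.sent_eq]
        rfl
    rw [hsenders]
    exact (congrFun (hrel.cnt_eq u) v).trans_le (h.cnt_le u v (by lia))
  offered_near u v hv := .inl (h.cliqueDist_le_of_mem_offered hτ hrel hA hv)
  received_far u v hv huv := by
    rcases (hrel.mem_received_finishShuffle hcand).1 hv with hv | hv
    · have := h.received_far u v hv huv
      exact ⟨by lia, by lia, this.2.2⟩
    · lia
  buffer_bound u := by
    refine hA.card_le_of_relay (u := u) (by lia) (by lia) fun v hv => ?_
    obtain ⟨hv, huv⟩ := Finset.mem_filter.1 hv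
    exact h.of_mem_incoming hτ hrel hcand hA hv huv
  holders u v huv := by
    have := hA.many u v huv
    have : (cliqueHolders A u v).card ≤ (cliqueHolders
        (fun w => ((σ' w).finishShuffle p (A w)).leading p) u v).card + 1 :=
      card_cliqueHolders_le (u' := u) v.2 fun w hw hv hne => by
        rw [mk_eq_of_cliqueDist_eq_zero hw]
        exact mem_cliqueHolders.2 ⟨hw, h.mem_leading hrel hcand hA hv hne⟩
    lia

end BalancedSelection

/-! ### The random phase -/

section Initial

variable {V : Type*} [Fintype V] [DecidableEq V] {p : Params} {G : SimpleGraph V}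
  {tie : TieRule V} {σ : V → NodeState V} {u v : V}

/-- The global state after round `0`. -/
def afterInitial (G : SimpleGraph V) : V → NodeState V :=
  fun u => (NodeState.init u).deliver G id u .initial

/-- The global state with which the random phase starts, after the buffers have been assigned. -/
def randomReady (p : Params) (G : SimpleGraph V) (tie : TieRule V) : V → NodeState V :=
  fun u => (afterInitial G u).prepare p (tie u 1 (afterInitial G u)) (.random 0)

theorem execution_one (p : Params) (G : SimpleGraph V) (tie : TieRule V) :
    execution p G tie 1 = PMF.pure (afterInitial G) := by
  have hstage : p.stage 0 = .initial := if_pos rfl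
  change (PMF.pure NodeState.init).bind (step p G tie 0) = _
  unfold step
  simp only [hstage, NodeState.messageLaw, PMF.pure_bind]
  rw [independent_pure, PMF.pure_bind]
  rfl

theorem mem_received_randomReady : v ∈ (randomReady p G tie u).received ↔ v = u ∨ G.Adj u v := by
  refine mem_received_deliver.trans (or_congr Finset.mem_singleton ?_)
  exact ⟨fun ⟨_, hw, hwv⟩ => hwv ▸ hw, fun h => ⟨v, h, rfl⟩⟩

theorem mem_sent_randomReady : v ∈ (randomReady p G tie u).sent ↔ v = u := Finset.mem_singleton

theorem mem_buffer_randomReady : v ∈ (randomReady p G tie u).buffer ↔ G.Adj u v := by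
  change v ∈ (randomReady p G tie u).received \ (randomReady p G tie u).sent ↔ _
  rw [Finset.mem_sdiff, mem_received_randomReady, mem_sent_randomReady, or_and_right,
    and_not_self_iff, false_or, and_iff_left_iff_imp]
  exact fun h => h.ne'

theorem notMem_sent_of_mem_buffer_randomReady (u v : V)
    (hv : v ∈ (randomReady p G tie u).buffer) : v ∉ (randomReady p G tie u).sent :=
  fun h => (mem_buffer_randomReady.1 hv).ne (mem_sent_randomReady.1 h).symm

theorem cnt_randomReady : (randomReady p G tie u).cnt v
    = (if v = u then 1 else 0) + (senders G (randomReady p G tie) u v).card := by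
  classical
  refine congrArg (fun S => (if v = u then 1 else 0) + Finset.card S) (Finset.ext fun w => ?_)
  rw [mem_senders, mem_sent_randomReady, Finset.mem_filter_univ, eq_comm (a := v), id]

variable (hrel : PopRel G (randomReady p G tie) σ)
include hrel

theorem mem_sent_self : u ∈ (σ u).sent := hrel.sent_mono u (mem_sent_randomReady.2 rfl)

theorem eq_or_adj_of_mem_sent (hv : v ∈ (σ u).sent) : v = u ∨ G.Adj u v := by
  rcases hrel.sent_of u v hv with hv | hv | hv
  · exact .inl (mem_sent_randomReady.1 hv)
  · exact .inl hv
  · exact .inr (mem_buffer_randomReady.1 hv)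

theorem mem_received_iff_of_popRel_randomReady : v ∈ (σ u).received ↔
    v = u ∨ G.Adj u v ∨ ∃ w, G.Adj u w ∧ G.Adj w v ∧ v ∈ (σ w).sent := by
  constructor
  · intro hv
    rcases hrel.received_of u v hv with hv | hv | ⟨w, hw⟩
    · exact or_assoc.1 (.inl (mem_received_randomReady.1 hv))
    · exact .inr (.inl hv)
    · obtain ⟨hadj, hsent, hnot⟩ := mem_newSenders.1 hw
      exact .inr (.inr ⟨w, hadj, (eq_or_adj_of_mem_sent hrel hsent).resolve_left
        fun h => hnot (mem_sent_randomReady.2 h), hsent⟩)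
  · rw [← or_assoc]
    rintro (hv | ⟨w, hadj, hwv, hsent⟩)
    · exact hrel.received_mono u (mem_received_randomReady.2 hv)
    · exact hrel.received_of_newSenders u v ⟨w, mem_newSenders.2
        ⟨hadj, hsent, fun h => hwv.ne (mem_sent_randomReady.1 h).symm⟩⟩

theorem card_senders_le_cnt : (senders G σ u v).card ≤ (σ u).cnt v := by
  have := hrel.le_cnt u v
  rw [← card_senders_add_card_newSenders hrel.sent_mono]
  rw [cnt_randomReady] at this
  lia

theorem cnt_le_card_senders (hne : v ≠ u) (huv : ¬ G.Adj u v) :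
    (σ u).cnt v ≤ (senders G σ u v).card :=
  hrel.cnt_le_card_senders huv (by rw [cnt_randomReady, if_neg hne, zero_add])

end Initial

section EvenlySent

theorem NodeState.cnt_le_of_sortKey_le {V : Type*} [DecidableEq V]
    {s : NodeState V} {tie : V ↪ ℕ} {v w : V} (hs : s.selected = ∅)
    (h : s.sortKey tie w ≤ s.sortKey tie v) : s.cnt w ≤ s.cnt v := by
  rw [NodeState.sortKey, NodeState.sortKey, hs, if_neg (Finset.notMem_empty _),
    if_neg (Finset.notMem_empty _), Prod.Lex.toLex_le_toLex] at h
  have h' := (h.resolve_left (lt_irrefl _)).2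
  rw [Prod.Lex.toLex_le_toLex] at h'
  exact h'.elim le_of_lt fun h => h.1.le

variable {n k : ℕ}

/-- The global states in which the messages have been sent evenly: every node has sent few of them,
each message has been sent by more than `τ / 2` nodes of its own clique, and in every clique not
much more than the expected `2 τ` nodes have sent the message of their neighbour in a given adjacent
clique. -/
structure EvenlySent (p : Params) (σ : Fin (n / k) × Fin k → NodeState _) : Prop where
  card_sent_le : ∀ u, (σ u).sent.card ≤ p.tau + 1
  many : ∀ v, p.tau + 8 ≤ 2 * (cliqueHolders (fun w => (σ w).sent) v v).card
  few : ∀ u y, cliqueDist u y = 1 → 2 * (Finset.univ.filter fun x =>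
    cliqueDist u x = 0 ∧ (y.1, x.2) ∈ (σ x).sent).card ≤ 5 * p.tau

variable {p : Params} {tie : TieRule (Fin (n / k) × Fin k)}
  {σ : Fin (n / k) × Fin k → NodeState _} {u v w y : Fin (n / k) × Fin k}
  (hrel : PopRel (cliquePath n k) (randomReady p (cliquePath n k) tie) σ)
include hrel

theorem layer_eq_of_mem_sent (huv : 1 ≤ cliqueDist u v) (hv : v ∈ (σ u).sent) : v.2 = u.2 := by
  rcases eq_or_adj_of_mem_sent hrel hv with rfl | hadj
  · rfl
  · rcases cliquePath_adj.1 hadj with h | h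
    · exact h.2
    · lia

theorem cnt_le_three_of_layer_ne (huv : 1 ≤ cliqueDist u v) (hne : v.2 ≠ u.2) :
    (σ u).cnt v ≤ 3 := by
  refine (cnt_le_card_senders hrel (fun h => hne (congrArg _ h)) fun h => ?_).trans ?_
  · rcases cliquePath_adj.1 h with h | h
    · exact hne h.2
    · lia
  · exact card_senders_le_three fun w hw =>
      layer_eq_of_mem_sent hrel (huv.trans (cliqueDist_congr hw).ge)

theorem mem_received_of_cliqueDist_eq_zero (huv : cliqueDist u v = 0) : v ∈ (σ u).received := by
  rw [mem_received_iff_of_popRel_randomReady hrel]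
  by_cases he : v.2 = u.2
  · exact .inl (eq_of_cliqueDist_eq_zero huv he)
  · exact .inr (.inl (adj_of_cliqueDist_eq_zero huv he))

theorem exists_of_mem_received_of_two_le (hv : v ∈ (σ u).received) (huv : 2 ≤ cliqueDist u v) :
    cliqueDist u v = 2 ∧ v.2 = u.2 ∧
      ∃ y, cliqueDist u y = 1 ∧ y.2 = u.2 ∧ cliqueDist y v = 1 ∧ v ∈ (σ y).sent := by
  rcases (mem_received_iff_of_popRel_randomReady hrel).1 hv with rfl | hadj | ⟨y, huy, hyv, hsent⟩
  · rw [cliqueDist_eq_zero.2 rfl] at huv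
    lia
  · exact absurd hadj (not_adj_of_two_le huv)
  · have := cliqueDist_triangle u y v
    rcases cliquePath_adj.1 huy with ⟨h₁, h₂⟩ | ⟨h₁, -⟩ <;>
      rcases cliquePath_adj.1 hyv with ⟨h₃, h₄⟩ | ⟨h₃, -⟩
    · exact ⟨by lia, h₄.trans h₂, y, h₁, h₂, h₃, hsent⟩
    all_goals lia

theorem mem_sent_of_mem_received_of_beyond (hv : v ∈ (σ w).received) (hwy : cliqueDist w y = 1)
    (hlayer : y.2 = w.2) (hd : cliqueDist w v = cliqueDist y v + 1) :
    v ∈ (σ y).sent ∨ ∃ x, (cliqueDist w x = 0 ∧ (y.1, x.2) ∈ (σ x).sent) ∧ v = (y.1, x.2) := by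
  rcases (mem_received_iff_of_popRel_randomReady hrel).1 hv with rfl | hadj | ⟨x, hwx, hxv, hsent⟩
  · rw [cliqueDist_eq_zero.2 rfl] at hd
    lia
  · have := cliqueDist_le_one_of_adj hadj
    have hvy : v = y := eq_of_cliqueDist_eq_zero (by lia) <| by
      rcases cliquePath_adj.1 hadj with h | h
      · exact h.2.trans hlayer.symm
      · lia
    exact .inl (hvy ▸ mem_sent_self hrel)
  · have := cliqueDist_le_one_of_adj hxv
    rcases cliquePath_adj.1 hwx with ⟨h₁, h₂⟩ | ⟨h₁, -⟩
    · have hxy : x = y := eq_of_cliqueDist_eq_zero (by unfold cliqueDist at *; lia)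
        (h₂.trans hlayer.symm)
      exact .inl (hxy ▸ hsent)
    · have hdist := cliqueDist_congr (v := v) h₁
      have hvx : v = (y.1, x.2) := by
        rcases cliquePath_adj.1 hxv with h | h
        · exact Prod.ext (cliqueDist_eq_zero.1 (by lia : cliqueDist y v = 0)) h.2
        · lia
      exact .inr ⟨x, ⟨h₁, hvx ▸ hsent⟩, hvx⟩

theorem EvenlySent.card_le_of_beyond (h : EvenlySent p σ) (hτ : 6 < p.tau)
    (hwy : cliqueDist w y = 1) (hlayer : y.2 = w.2) {S : Finset (Fin (n / k) × Fin k)}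
    (hS : ∀ v ∈ S, v ∈ (σ w).received ∧ cliqueDist w v = cliqueDist y v + 1) :
    S.card ≤ 4 * p.tau := by
  classical
  set E := Finset.univ.filter fun x => cliqueDist w x = 0 ∧ (y.1, x.2) ∈ (σ x).sent
  have hsub : S ⊆ (σ y).sent ∪ E.image fun x => (y.1, x.2) := fun v hv => by
    refine Finset.mem_union.2 ((mem_sent_of_mem_received_of_beyond hrel (hS v hv).1 hwy hlayer
      (hS v hv).2).imp_right ?_)
    rintro ⟨x, hx, hvx⟩
    exact Finset.mem_image.2 ⟨x, (Finset.mem_filter_univ x).2 hx, hvx.symm⟩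
  have := (Finset.card_le_card hsub).trans (Finset.card_union_le _ _)
  have := h.card_sent_le y
  have : (E.image fun x => (y.1, x.2)).card ≤ E.card := Finset.card_image_le
  have : 2 * E.card ≤ 5 * p.tau := h.few w y hwy
  lia

theorem EvenlySent.card_le_of_received_at (h : EvenlySent p σ) (hτ : 6 < p.tau) (δ : ℕ)
    {S : Finset (Fin (n / k) × Fin k)} (hS : ∀ v ∈ S, 1 + δ ≤ cliqueDist u v ∧
      ∃ w, (cliqueDist u w = δ ∧ w.2 = u.2) ∧ v ∈ (σ w).received ∧
        cliqueDist u v = δ + cliqueDist w v) : S.card ≤ 8 * p.tau := by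
  refine (card_le_two_mul (u.1 < ·.1) (M := 4 * p.tau) fun v₀ hv₀ => ?_).trans (by lia)
  obtain ⟨hd₀, w, ⟨hw, hwu⟩, -, hwv₀⟩ := hS v₀ hv₀
  obtain ⟨y, hy, hyw, hyv₀⟩ := exists_next_clique (r := cliqueDist w v₀ - 1) (u := w) (v := v₀)
    (by lia)
  refine h.card_le_of_beyond hrel hτ hy hyw fun v hv => ?_
  obtain ⟨hvS, hside⟩ := Finset.mem_filter.1 hv
  obtain ⟨hd, w', ⟨hw', hwu'⟩, hmem, hwv⟩ := hS v hvS
  rw [Fin.lt_def, Fin.lt_def] at hside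
  have hww : w' = w := by
    refine eq_of_cliqueDist_eq_zero ?_ (hwu'.trans hwu.symm)
    unfold cliqueDist at *
    omega
  subst hww
  refine ⟨hmem, ?_⟩
  unfold cliqueDist at *
  omega

theorem EvenlySent.known (h : EvenlySent p σ) (huv : cliqueDist u v = 0) :
    v ∈ (σ u).received ∧ p.tau ≤ 2 * (σ u).cnt v := by
  refine ⟨mem_received_of_cliqueDist_eq_zero hrel huv, ?_⟩
  have := h.many v
  have := card_senders_le_cnt hrel (u := u) (v := v)
  have : (cliqueHolders (fun w => (σ w).sent) v v).card
      ≤ (senders (cliquePath n k) σ u v).card + 1 :=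
    card_cliqueHolders_le (u' := u) u.2 fun w hw hv hne => by
      have huw : cliqueDist u w = 0 := (cliqueDist_congr huv).symm.trans hw
      rw [mk_eq_of_cliqueDist_eq_zero huw]
      exact mem_senders.2 ⟨adj_of_cliqueDist_eq_zero huw hne, hv⟩
  lia

theorem exists_of_mem_incoming (hv : v ∈ incoming (cliquePath n k) σ u)
    (huv : 2 ≤ cliqueDist u v) : ∃ w, (cliqueDist u w = 1 ∧ w.2 = u.2) ∧ v ∈ (σ w).received ∧
      cliqueDist u v = 1 + cliqueDist w v := by
  have hclose {u' : Fin (n / k) × Fin k} (huu' : cliqueDist u u' = 0)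
      (hv : v ∈ (σ u').received) : ∃ w, (cliqueDist u w = 1 ∧ w.2 = u.2) ∧ v ∈ (σ w).received ∧
        cliqueDist u v = 1 + cliqueDist w v := by
    have hdist := cliqueDist_congr (v := v) huu'
    obtain ⟨hd, -, y, hy, -, hyv, hsent⟩ :=
      exists_of_mem_received_of_two_le hrel hv (hdist ▸ huv)
    have hy' : cliqueDist (y.1, u.2) y = 0 := cliqueDist_eq_zero.2 rfl
    have hyv' : cliqueDist (y.1, u.2) v = 1 := (cliqueDist_congr hy').symm.trans hyv
    refine ⟨(y.1, u.2), ⟨(cliqueDist_congr huu').symm.trans hy, rfl⟩, ?_, by lia⟩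
    rw [mem_received_iff_of_popRel_randomReady hrel]
    have hvy := layer_eq_of_mem_sent hrel hyv.ge hsent
    by_cases he : y.2 = u.2
    · exact .inr (.inl (cliquePath_adj.2 (.inl ⟨hyv', hvy.trans he⟩)))
    · exact .inr (.inr ⟨y, adj_of_cliqueDist_eq_zero hy' he,
        cliquePath_adj.2 (.inl ⟨hyv, hvy⟩), hsent⟩)
  rcases mem_incoming.1 hv with hv | ⟨w, hadj, hv⟩
  · exact hclose (cliqueDist_eq_zero.2 rfl) hv
  · have hv := (NodeState.mem_offered.1 hv).1.1
    rcases cliquePath_adj.1 hadj with ⟨hd, hlayer⟩ | ⟨hd, -⟩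
    · refine ⟨w, ⟨hd, hlayer⟩, hv, ?_⟩
      have hle : cliqueDist w v ≤ 2 := by_contra fun hlt =>
        hlt (exists_of_mem_received_of_two_le hrel hv (by lia)).1.le
      unfold cliqueDist at hd huv hle ⊢
      lia
    · exact hclose hd hv

theorem EvenlySent.rank_le (h : EvenlySent p σ) (hτ : 6 < p.tau) (huv : 1 ≤ cliqueDist u v)
    (hne : v.2 ≠ u.2) (rule : _ ↪ ℕ) : (σ u).rank rule (σ u).offered v ≤ 8 * p.tau := by
  refine h.card_le_of_received_at hrel hτ (u := u) 0 fun w hw => ?_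
  obtain ⟨hw, hle⟩ := Finset.mem_filter.1 hw
  have hcnt := (NodeState.cnt_le_of_sortKey_le (hrel.selected_eq u) hle).trans
    (cnt_le_three_of_layer_ne hrel huv hne)
  refine ⟨by_contra fun hlt => ?_, u, ⟨cliqueDist_eq_zero.2 rfl, rfl⟩,
    (NodeState.mem_offered.1 hw).1.1, (Nat.zero_add _).symm⟩
  have := (h.known hrel (u := u) (v := w) (by lia)).2
  lia

theorem EvenlySent.mem_leading (h : EvenlySent p σ) (hτ : 6 < p.tau) (huv : cliqueDist u v = 1)
    (hw : cliqueDist v w = 0) (hsent : v ∈ (σ w).sent) (hne : w.2 ≠ v.2) :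
    v ∈ (σ (u.1, w.2)).leading p := by
  have hd : cliqueDist (u.1, w.2) v = 1 := huv
  have hdist : cliqueDist (u.1, w.2) w = 1 :=
    (cliqueDist_comm _ _).trans ((cliqueDist_congr hw).trans ((cliqueDist_comm _ _).trans huv))
  refine NodeState.mem_leading.2 ⟨NodeState.mem_offered.2 ⟨⟨?_, fun hv => ?_⟩, ?_⟩, fun rule => ?_⟩
  · refine (mem_received_iff_of_popRel_randomReady hrel).2 (.inr (.inr ⟨w, ?_, ?_, hsent⟩))
    · exact cliquePath_adj.2 (.inl ⟨hdist, rfl⟩)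
    · exact adj_of_cliqueDist_eq_zero ((cliqueDist_comm _ _).trans hw) hne.symm
  · exact hne (layer_eq_of_mem_sent hrel hd.ge hv).symm
  · exact (congrArg (v ∉ ·) (hrel.deferred_eq (u.1, w.2))).mpr (Finset.notMem_empty v)
  · exact h.rank_le hrel hτ hd.ge hne.symm rule

theorem EvenlySent.rankingStart (h : EvenlySent p σ) (hτ : 6 < p.tau) : RankingStart p 0 σ where
  known u v huv := h.known hrel (by lia)
  sent_layer u v huv := layer_eq_of_mem_sent hrel (by lia)
  cnt_le u v huv := cnt_le_card_senders hrel
    (fun he => by rw [he, cliqueDist_eq_zero.2 rfl] at huv; lia) (not_adj_of_two_le (by lia))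
  offered_near u v hv := by
    refine or_iff_not_imp_left.2 fun hfar => ⟨rfl, ?_⟩
    have := exists_of_mem_received_of_two_le hrel (NodeState.mem_offered.1 hv).1.1 (by lia)
    exact ⟨this.1, this.2.1⟩
  received_far u v hv huv := by
    have := exists_of_mem_received_of_two_le hrel hv (by lia)
    exact ⟨Nat.zero_le 1, this.1, this.2.1⟩
  buffer_bound u := by
    refine h.card_le_of_received_at hrel hτ (u := u) 1 fun v hv => ?_
    obtain ⟨hv, huv⟩ := Finset.mem_filter.1 hv
    exact ⟨by lia, exists_of_mem_incoming hrel hv (by lia)⟩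
  holders u v huv := by
    have := h.many v
    have : (cliqueHolders (fun w => (σ w).sent) v v).card
        ≤ (cliqueHolders (fun w => (σ w).leading p) u v).card + 1 :=
      card_cliqueHolders_le (u' := u) v.2 fun w hw hsent hne => mem_cliqueHolders.2
        ⟨cliqueDist_eq_zero.2 rfl, h.mem_leading hrel hτ (by lia) hw hsent hne⟩
    lia

end EvenlySent

/-! ### Exponential estimates -/

section RankingFunction

variable {V : Type*} [DecidableEq V] {s : NodeState V} {tie : V ↪ ℕ} {B : Finset V} {v w : V}

theorem NodeState.sortKey_injective (s : NodeState V) (tie : V ↪ ℕ) :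
    Function.Injective (s.sortKey tie) := by
  intro v w h
  have htie := congrArg (fun x => (ofLex (ofLex x).2).2) h
  rw [NodeState.sortKey, NodeState.sortKey] at htie
  split_ifs at htie <;> exact tie.injective htie

theorem NodeState.rank_lt_rank (hw : w ∈ B) (h : s.sortKey tie v < s.sortKey tie w) :
    s.rank tie B v < s.rank tie B w := by
  classical
  refine Finset.card_lt_card ((Finset.ssubset_iff_of_subset ?_).2 ⟨w, ?_, ?_⟩)
  · exact Finset.monotone_filter_right B fun x _ hx => hx.trans h.le
  · exact Finset.mem_filter.2 ⟨hw, le_rfl⟩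
  · exact fun hmem => (Finset.mem_filter.1 hmem).2.not_gt h

theorem NodeState.rank_injOn (s : NodeState V) (tie : V ↪ ℕ) (B : Finset V) :
    Set.InjOn (s.rank tie B) B := by
  intro v hv w hw h
  rcases lt_trichotomy (s.sortKey tie v) (s.sortKey tie w) with hlt | heq | hgt
  · exact absurd h (NodeState.rank_lt_rank hw hlt).ne
  · exact s.sortKey_injective tie heq
  · exact absurd h (NodeState.rank_lt_rank hv hgt).ne'

theorem NodeState.rank_mem_Icc (hv : v ∈ B) : s.rank tie B v ∈ Finset.Icc 1 B.card := by
  classical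
  exact Finset.mem_Icc.2 ⟨Finset.card_pos.2 ⟨v, Finset.mem_filter.2 ⟨hv, le_rfl⟩⟩,
    Finset.card_filter_le _ _⟩

theorem NodeState.sum_one_div_rank_le (s : NodeState V) (tie : V ↪ ℕ) (B : Finset V) :
    ∑ v ∈ B, 1 / (s.rank tie B v : ℝ≥0) ≤ ∑ j ∈ Finset.range B.card, 1 / ((j : ℝ≥0) + 1) := by
  calc ∑ v ∈ B, 1 / (s.rank tie B v : ℝ≥0)
      = ∑ i ∈ B.image (s.rank tie B), 1 / (i : ℝ≥0) :=
        (Finset.sum_image (f := fun i : ℕ => 1 / (i : ℝ≥0)) (s.rank_injOn tie B)).symm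
    _ ≤ ∑ i ∈ Finset.Icc 1 B.card, 1 / (i : ℝ≥0) :=
        Finset.sum_le_sum_of_subset (Finset.image_subset_iff.2 fun _ => NodeState.rank_mem_Icc)
    _ = ∑ j ∈ Finset.range B.card, 1 / ((j : ℝ≥0) + 1) := by
        simp only [← Nat.cast_add_one]
        rw [Finset.range_eq_Ico, Finset.sum_Ico_add' fun i : ℕ => 1 / (i : ℝ≥0), zero_add,
          Finset.Ico_add_one_right_eq_Icc]

theorem NodeState.sum_rankingFunction_le (s : NodeState V) (tie : V ↪ ℕ) (B : Finset V) :
    ∑ v ∈ B, s.rankingFunction tie B v ≤ 1 := by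
  simp only [NodeState.rankingFunction, ← div_div]
  rw [← Finset.sum_div]
  exact div_le_one_of_le₀ (s.sum_one_div_rank_le tie B) zero_le

theorem NodeState.le_rankingFunction [Fintype V] (hv : v ∈ B) {m : ℕ} (hr : s.rank tie B v ≤ m)
    {q : ℝ≥0} (hq : q * (m * ∑ j ∈ Finset.range (Fintype.card V), 1 / ((j : ℝ≥0) + 1)) ≤ 1) :
    q ≤ s.rankingFunction tie B v := by
  have hrank : 0 < s.rank tie B v := (Finset.mem_Icc.1 (NodeState.rank_mem_Icc hv)).1
  have hsum : 0 < ∑ j ∈ Finset.range B.card, 1 / ((j : ℝ≥0) + 1) :=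
    Finset.sum_pos (fun j _ => by positivity)
      (Finset.nonempty_range_iff.2 (Finset.card_ne_zero_of_mem hv))
  rw [NodeState.rankingFunction, le_div_iff₀ (mul_pos (Nat.cast_pos.2 hrank) hsum)]
  refine le_trans ?_ hq
  gcongr
  exact Finset.card_le_univ B

end RankingFunction

section HitFactor

variable {b m : ℕ}

theorem hitFactor_eq_ofReal {z : ℝ} (hz : 0 ≤ z) (hb : 0 < b) (hm : m ≤ b) :
    hitFactor (ENNReal.ofReal z) b m = ENNReal.ofReal (1 + (z - 1) * m / b) := by
  have hb' : (0 : ℝ) < b := Nat.cast_pos.2 hb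
  have h : 1 + (z - 1) * m / b = ((b - m : ℕ) + z * m) / b := by
    rw [Nat.cast_sub hm]
    field_simp
    ring
  rw [h, ENNReal.ofReal_div_of_pos hb', ENNReal.ofReal_add (by positivity) (by positivity),
    ENNReal.ofReal_mul hz, ENNReal.ofReal_natCast, ENNReal.ofReal_natCast, ENNReal.ofReal_natCast,
    hitFactor]

theorem hitFactor_le_ofReal_exp {z x : ℝ} (hz : 0 ≤ z) (hb : 0 < b) (hm : m ≤ b)
    (hx : (z - 1) * m ≤ x * b) :
    hitFactor (ENNReal.ofReal z) b m ≤ ENNReal.ofReal (Real.exp x) := by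
  rw [hitFactor_eq_ofReal hz hb hm]
  refine ENNReal.ofReal_le_ofReal (le_trans ?_ (Real.add_one_le_exp x))
  rw [add_comm]
  gcongr
  exact (div_le_iff₀ (Nat.cast_pos.2 hb)).2 hx

theorem hitFactor_half_le_ofReal_exp {x : ℝ} (hb : 0 < b) (hm : m ≤ b) (hx : -(m / 2) ≤ x * b) :
    hitFactor (1 / 2) b m ≤ ENNReal.ofReal (Real.exp x) := by
  have h := hitFactor_le_ofReal_exp (z := 1 / 2) (x := x) (by norm_num) hb hm (by linarith)
  rwa [ENNReal.ofReal_div_of_pos two_pos, ENNReal.ofReal_one, ENNReal.ofReal_ofNat] at h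

theorem hitFactor_two_le_ofReal_exp {x : ℝ} (hb : 0 < b) (hm : m ≤ b) (hx : m ≤ x * b) :
    hitFactor 2 b m ≤ ENNReal.ofReal (Real.exp x) := by
  have h := hitFactor_le_ofReal_exp (z := 2) (x := x) zero_le_two hb hm (by linarith)
  rwa [ENNReal.ofReal_ofNat] at h

end HitFactor

section Chernoff

variable {β ι : Type*}

theorem two_pow_eq_ofReal_exp (m : ℕ) :
    (2 : ℝ≥0∞) ^ m = ENNReal.ofReal (Real.exp (m * Real.log 2)) := by
  rw [Real.exp_nat_mul, Real.exp_log two_pos, ENNReal.ofReal_pow zero_le_two,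
    ENNReal.ofReal_ofNat]

theorem half_pow_eq_ofReal_exp (m : ℕ) :
    (1 / 2 : ℝ≥0∞) ^ m = ENNReal.ofReal (Real.exp (-(m * Real.log 2))) := by
  rw [Real.exp_neg, ENNReal.ofReal_inv_of_pos (Real.exp_pos _), ← two_pow_eq_ofReal_exp, one_div,
    ENNReal.inv_pow]

theorem prod_le_ofReal_exp (W : Finset ι) (f : ι → ℝ≥0∞) (x : ℝ)
    (h : ∀ i ∈ W, f i ≤ ENNReal.ofReal (Real.exp x)) :
    ∏ i ∈ W, f i ≤ ENNReal.ofReal (Real.exp (W.card * x)) := by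
  refine (Finset.prod_le_prod' h).trans ?_
  rw [Finset.prod_const, ← ENNReal.ofReal_pow (Real.exp_pos x).le, ← Real.exp_nat_mul]

theorem one_le_two_pow_mul_half_pow {a b : ℕ} (h : b ≤ a) : (1 : ℝ≥0∞) ≤ 2 ^ a * (1 / 2) ^ b := by
  calc (1 : ℝ≥0∞) = 2 ^ b * (1 / 2) ^ b := by
        rw [← mul_pow, one_div, ENNReal.mul_inv_cancel two_ne_zero ENNReal.ofNat_ne_top, one_pow]
    _ ≤ 2 ^ a * (1 / 2) ^ b := by
        gcongr
        exact one_le_two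

variable {μ : PMF β} {W : Finset ι} {P : ι → β → Prop} [∀ i a, Decidable (P i a)] {x : ℝ}

theorem failProb_lt_card_filter_le (m : ℕ)
    (h : expect μ (fun a => ∏ i ∈ W, if P i a then 1 / 2 else 1) ≤ ENNReal.ofReal (Real.exp x)) :
    failProb μ (fun a => m < (W.filter (P · a)).card)
      ≤ ENNReal.ofReal (Real.exp (m * Real.log 2 + x)) := by
  calc failProb μ (fun a => m < (W.filter (P · a)).card)
      ≤ expect μ fun a => 2 ^ m * ∏ i ∈ W, if P i a then 1 / 2 else 1 := by
        refine failProb_le_expect fun a _ hbad => ?_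
        rw [Finset.prod_ite, Finset.prod_const, Finset.prod_const_one, mul_one]
        exact one_le_two_pow_mul_half_pow (not_lt.1 hbad)
    _ ≤ 2 ^ m * ENNReal.ofReal (Real.exp x) := by
        rw [expect_const_mul]
        gcongr
    _ = ENNReal.ofReal (Real.exp (m * Real.log 2 + x)) := by
        rw [two_pow_eq_ofReal_exp, ← ENNReal.ofReal_mul (Real.exp_pos _).le, ← Real.exp_add]

theorem failProb_card_filter_lt_le (m : ℕ)
    (h : expect μ (fun a => ∏ i ∈ W, if P i a then 2 else 1) ≤ ENNReal.ofReal (Real.exp x)) :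
    failProb μ (fun a => (W.filter (P · a)).card < m)
      ≤ ENNReal.ofReal (Real.exp (x - m * Real.log 2)) := by
  calc failProb μ (fun a => (W.filter (P · a)).card < m)
      ≤ expect μ fun a => (∏ i ∈ W, if P i a then 2 else 1) * (1 / 2) ^ m := by
        refine failProb_le_expect fun a _ hbad => ?_
        rw [Finset.prod_ite, Finset.prod_const, Finset.prod_const_one, mul_one]
        exact one_le_two_pow_mul_half_pow (not_lt.1 hbad)
    _ ≤ ENNReal.ofReal (Real.exp x) * (1 / 2) ^ m := by
        rw [expect_mul_const]
        gcongr
    _ = ENNReal.ofReal (Real.exp (x - m * Real.log 2)) := by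
        rw [half_pow_eq_ofReal_exp, ← ENNReal.ofReal_mul (Real.exp_pos _).le, ← Real.exp_add,
          sub_eq_add_neg]

end Chernoff

section CliqueCard

variable {N k s : ℕ} {u v v' : Fin N × Fin k}

theorem card_filter_fst_eq (a : Fin N) :
    (Finset.univ.filter fun v : Fin N × Fin k => v.1 = a).card = k := by
  have h : (Finset.univ.filter fun v : Fin N × Fin k => v.1 = a) = {a} ×ˢ Finset.univ := by
    ext v
    simp only [Finset.mem_filter_univ, Finset.mem_product, Finset.mem_singleton, Finset.mem_univ,
      and_true]
  rw [h, Finset.card_product, Finset.card_singleton, Finset.card_fin, one_mul]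

theorem card_filter_cliqueDist_eq_zero (u : Fin N × Fin k) :
    (Finset.univ.filter fun v => cliqueDist u v = 0).card = k := by
  simp_rw [cliqueDist_eq_zero]
  exact card_filter_fst_eq u.1

theorem card_filter_cliqueDist_le (u : Fin N × Fin k) (s : ℕ) :
    (Finset.univ.filter fun v => cliqueDist u v = s).card ≤ 2 * k := by
  refine card_le_two_mul (fun v => v.1 < u.1) fun v₀ hv₀ =>
    (Finset.card_le_card fun v hv => ?_).trans (card_filter_fst_eq v₀.1).le
  simp only [Finset.mem_filter, Fin.lt_def] at hv₀ hv
  unfold cliqueDist at *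
  rw [Finset.mem_filter_univ, Fin.ext_iff]
  lia

theorem le_card_filter_cliqueDist (h : cliqueDist u v = s) :
    k ≤ (Finset.univ.filter fun v => cliqueDist u v = s).card := by
  refine (card_filter_fst_eq (k := k) v.1).ge.trans (Finset.card_le_card fun w hw => ?_)
  rw [Finset.mem_filter_univ] at hw ⊢
  rw [← h, cliqueDist, cliqueDist, hw]

theorem two_mul_le_card_filter_cliqueDist (h : cliqueDist u v = s) (h' : cliqueDist u v' = s)
    (hne : v.1 ≠ v'.1) : 2 * k ≤ (Finset.univ.filter fun v => cliqueDist u v = s).card := by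
  calc 2 * k = (Finset.univ.filter fun w : Fin N × Fin k => w.1 = v.1).card
        + (Finset.univ.filter fun w : Fin N × Fin k => w.1 = v'.1).card := by
        rw [card_filter_fst_eq, card_filter_fst_eq, two_mul]
    _ = (Finset.univ.filter fun w : Fin N × Fin k => w.1 = v.1 ∨ w.1 = v'.1).card := by
        rw [Finset.filter_or, Finset.card_union_of_disjoint]
        exact Finset.disjoint_filter.2 fun w _ hw hw' => hne (hw.symm.trans hw')
    _ ≤ (Finset.univ.filter fun v => cliqueDist u v = s).card := by
        refine Finset.card_le_card (Finset.monotone_filter_right _ fun w _ hw => ?_)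
        rcases hw with hw | hw
        · rw [← h, cliqueDist, cliqueDist, hw]
        · rw [← h', cliqueDist, cliqueDist, hw]

theorem cliqueHolders_eq_filter (S : Fin N × Fin k → Finset (Fin N × Fin k)) :
    cliqueHolders S u v = (Finset.univ.filter fun w => cliqueDist u w = 0).filter (v ∈ S ·) :=
  (Finset.filter_filter _ _ _).symm

end CliqueCard

/-! ### Failure probabilities -/

section RankingFailure

variable {n k r : ℕ} {p : Params} {σ : Fin (n / k) × Fin k → NodeState _}

theorem RankingStart.failProb_shuffleStart_le (h : RankingStart p r σ)
    (tie : TieRule (Fin (n / k) × Fin k)) (hτ : 6 < p.tau) (hτ' : 0 < p.tauRank) {q : ℝ≥0}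
    (hq : q * ((8 * p.tau : ℕ) * ∑ j ∈ Finset.range (Fintype.card (Fin (n / k) × Fin k)),
      1 / ((j : ℝ≥0) + 1)) ≤ 1) :
    failProb (run p (cliquePath n k) tie (p.rankingStart r) p.tauRank σ) (ShuffleStart p r)
      ≤ (Fintype.card (Fin (n / k) × Fin k) : ℝ≥0∞) ^ 2 * (1 - (q : ℝ≥0∞)) ^ p.tauRank := by
  rw [run_eq_popRun (phase := .ranking) (.inr rfl) hτ' fun j hj => p.stage_ranking r hj]
  set σ₀ : Fin (n / k) × Fin k → NodeState _ :=
    fun u => (σ u).prepare p (tie u (p.rankingStart r) (σ u)) (.ranking 0)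
  have hrel {σ'} (hσ' : σ' ∈ (popRun (cliquePath n k) p.tauRank σ₀).support) :
      PopRel (cliquePath n k) σ₀ σ' :=
    popRel_of_popRun (fun u v hv => (NodeState.mem_offered (s := σ u).1 hv).1.2) hσ'
  refine (failProb_mono (Q := fun σ' => ∀ u v, v ∈ (σ₀ u).leading p → v ∈ (σ' u).sent)
    fun σ' hσ' hsend => (h.prepare _).shuffleStart hτ (fun _ => rfl) (hrel hσ') hsend).trans
    (failProb_forall₂_le fun u v => ?_)
  by_cases hv : v ∈ (σ₀ u).leading p
  · obtain ⟨hoffered, hrank⟩ := NodeState.mem_leading.1 hv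
    have hprob : q ≤ (σ₀ u).prob v := NodeState.le_rankingFunction hoffered (hrank _) hq
    calc failProb (popRun (cliquePath n k) p.tauRank σ₀)
          (fun σ' => v ∈ (σ₀ u).leading p → v ∈ (σ' u).sent)
        ≤ failProb (popRun (cliquePath n k) p.tauRank σ₀) (fun σ' => v ∉ (σ' u).buffer) :=
          failProb_mono fun σ' hσ' hpopped _ => (hrel hσ').sent_of_buffer u v hoffered hpopped
      _ ≤ (1 - ((σ₀ u).prob v : ℝ≥0∞)) ^ p.tauRank :=
          failProb_notMem_buffer_popRun_le _ _ u v (by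
            exact_mod_cast (σ u).sum_rankingFunction_le _ _)
      _ ≤ (1 - (q : ℝ≥0∞)) ^ p.tauRank := by gcongr
  · exact (failProb_eq_zero fun _ _ hv' => absurd hv' hv).trans_le zero_le

end RankingFailure

section ShuffleFailure

variable {N k s : ℕ} {p : Params} {σ : Fin N × Fin k → NodeState (Fin N × Fin k)}
  {u v v' : Fin N × Fin k}

theorem failProb_cliqueHolders_selection_le
    (hcand : ∀ u v, v ∈ (σ u).candidates p ↔ cliqueDist u v = s) (hk : 4 * p.tau ≤ k)
    (huv : cliqueDist u v = s) :
    failProb (independent fun u => (σ u).selectionLaw p)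
        (fun A => p.tau + 6 ≤ 2 * (cliqueHolders A u v).card)
      ≤ ENNReal.ofReal (Real.exp (2 - p.tau / 10)) := by
  have hcard (w : Fin N × Fin k) :
      (σ w).candidates p = Finset.univ.filter fun v => cliqueDist w v = s :=
    Finset.ext fun x => by rw [hcand, Finset.mem_filter_univ]
  have hkpos : (0 : ℝ) < k := Nat.cast_pos.2 v.2.pos
  have hexp : expect (independent fun u => (σ u).selectionLaw p) (fun A =>
      ∏ w ∈ Finset.univ.filter (fun w => cliqueDist u w = 0), if v ∈ A w then 1 / 2 else 1)
      ≤ ENNReal.ofReal (Real.exp (-p.tau)) := by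
    rw [expect_independent_prod _ _ fun _ (A : Finset (Fin N × Fin k)) =>
      if v ∈ A then (1 / 2 : ℝ≥0∞) else 1]
    refine (prod_le_ofReal_exp _ _ (-(p.tau / k)) fun w hw => ?_).trans_eq ?_
    · have hwv : cliqueDist w v = s :=
        (cliqueDist_congr ((Finset.mem_filter_univ w).1 hw)).trans huv
      have hlow : k ≤ ((σ w).candidates p).card := hcard w ▸ le_card_filter_cliqueDist hwv
      have hup : (((σ w).candidates p).card : ℝ) ≤ 2 * k := by
        exact_mod_cast hcard w ▸ card_filter_cliqueDist_le w s
      rw [NodeState.selectionLaw_eq_uniform (by lia),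
        expect_mem_uniform_powersetCard ((hcand w v).2 hwv) (by lia)]
      refine hitFactor_half_le_ofReal_exp (v.2.pos.trans_le hlow) (by lia) ?_
      have hratio : p.tau / k * (((σ w).candidates p).card : ℝ) ≤ 2 * p.tau := by
        rw [div_mul_eq_mul_div, div_le_iff₀ hkpos]
        nlinarith [p.tau.cast_nonneg (α := ℝ)]
      push_cast
      linarith
    · rw [card_filter_cliqueDist_eq_zero, mul_neg, mul_div_cancel₀ _ hkpos.ne']
  refine (failProb_mono fun A _ hA => ?_).trans
    ((failProb_lt_card_filter_le ((p.tau + 5) / 2) hexp).trans ?_)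
  · rw [← cliqueHolders_eq_filter] at hA
    lia
  · refine ENNReal.ofReal_le_ofReal (Real.exp_le_exp.2 ?_)
    have hhalf : (((p.tau + 5) / 2 : ℕ) : ℝ) ≤ (p.tau + 5) / 2 := by
      exact_mod_cast Nat.cast_div_le (α := ℝ) (m := p.tau + 5) (n := 2)
    nlinarith [Real.log_two_gt_d9, Real.log_two_lt_d9]

theorem failProb_both_cliques_selection_le
    (hcand : ∀ u v, v ∈ (σ u).candidates p ↔ cliqueDist u v = s) (hk : 4 * p.tau ≤ k)
    (huv : cliqueDist u v = s) (huv' : cliqueDist u v' = s) (hne : v.1 ≠ v'.1) :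
    failProb (independent fun u => (σ u).selectionLaw p) (fun A => ∃ x ∈ A u, x.1 ≠ v.1)
      ≤ ENNReal.ofReal (Real.exp (2 - p.tau / 10)) := by
  have hcard : 2 * k ≤ ((σ u).candidates p).card :=
    (two_mul_le_card_filter_cliqueDist huv huv' hne).trans_eq (congrArg Finset.card
      (Finset.ext fun v => (Finset.mem_filter_univ v).trans (hcand u v).symm))
  have hclique := card_filter_fst_eq (k := k) v.1
  rw [failProb_independent_apply (fun u => (σ u).selectionLaw p) u fun A => ∃ x ∈ A, x.1 ≠ v.1,
    NodeState.selectionLaw_eq_uniform (by lia)]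
  refine (failProb_mono fun A _ hA => ?_).trans ((failProb_not_subset_uniform_powersetCard_le
    (D := Finset.univ.filter fun w => w.1 = v.1) (by lia) (by lia) _).trans ?_)
  · obtain ⟨x, hx, hxD⟩ := Finset.not_subset.1 hA
    exact ⟨x, hx, fun he => hxD ((Finset.mem_filter_univ x).2 he)⟩
  · rw [half_pow_eq_ofReal_exp]
    refine ENNReal.ofReal_le_ofReal (Real.exp_le_exp.2 ?_)
    push_cast
    nlinarith [Real.log_two_gt_d9]

theorem failProb_balancedSelection_le
    (hcand : ∀ u v, v ∈ (σ u).candidates p ↔ cliqueDist u v = s) (hk : 4 * p.tau ≤ k) :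
    failProb (independent fun u => (σ u).selectionLaw p) (BalancedSelection p s)
      ≤ 2 * (Fintype.card (Fin N × Fin k) : ℝ≥0∞) ^ 2
        * ENNReal.ofReal (Real.exp (2 - p.tau / 10)) := by
  rw [mul_assoc, two_mul]
  refine (failProb_mono fun A hA hgood => ?_).trans ((failProb_and_le _
    (fun A => ∀ u v, cliqueDist u v = s → p.tau + 6 ≤ 2 * (cliqueHolders A u v).card)
    fun A => ∀ u v, (∃ v', cliqueDist u v = s ∧ cliqueDist u v' = s ∧ v.1 ≠ v'.1) →
      ∃ x ∈ A u, x.1 ≠ v.1).trans (add_le_add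
        (failProb_forall₂_le fun u v => ?_) (failProb_forall₂_le fun u v => ?_)))
  · have hsel (u) := NodeState.mem_support_selectionLaw (mem_support_of_independent hA u)
    exact ⟨fun u v hv => (hcand u v).1 ((hsel u).1 hv),
      fun u => (hsel u).2.trans_le (min_le_left _ _), hgood.1,
      fun u v v' hv hv' hne => hgood.2 u v ⟨v', hv, hv', hne⟩⟩
  · by_cases huv : cliqueDist u v = s
    · exact (failProb_mono fun _ _ h _ => h).trans
        (failProb_cliqueHolders_selection_le hcand hk huv)
    · exact (failProb_eq_zero fun _ _ huv' => absurd huv' huv).trans_le zero_le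
  · by_cases huv : ∃ v', cliqueDist u v = s ∧ cliqueDist u v' = s ∧ v.1 ≠ v'.1
    · obtain ⟨v', hv, hv', hne⟩ := huv
      exact (failProb_mono fun _ _ h _ => h).trans
        (failProb_both_cliques_selection_le hcand hk hv hv' hne)
    · exact (failProb_eq_zero fun _ _ huv' => absurd huv' huv).trans_le zero_le

end ShuffleFailure

theorem ShuffleStart.failProb_rankingStart_le {n k r : ℕ} {p : Params}
    {σ : Fin (n / k) × Fin k → NodeState _} (h : ShuffleStart p r σ)
    (tie : TieRule (Fin (n / k) × Fin k)) (hτ : 6 < p.tau) (hc : p.cHat ≤ 1 / 2)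
    (hc' : 4 < p.cHat * p.threshold) (hk : 4 * p.tau ≤ k) :
    failProb (run p (cliquePath n k) tie (p.rankingStart r + p.tauRank) (8 * p.tau) σ)
        (RankingStart p (r + 1))
      ≤ 2 * (Fintype.card (Fin (n / k) × Fin k) : ℝ≥0∞) ^ 2
        * ENNReal.ofReal (Real.exp (2 - p.tau / 10)) := by
  obtain ⟨σ', hrel, hrun⟩ := exists_run_eq_map_of_shuffle (G := cliquePath n k) (tie := tie)
    (p := p) (by lia) (fun j hj => p.stage_shuffle r hj) σ
  have hcand (u v) : v ∈ (σ' u).candidates p ↔ cliqueDist u v = r + 2 :=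
    h.prepare.mem_candidates hτ hc hc' (fun _ => rfl) (fun u v => by
      change (if _ then 1 else 0) ≤ 1
      split_ifs <;> lia) hrel
  rw [hrun, failProb_map]
  exact (failProb_mono fun A _ hA => h.prepare.rankingStart hτ hrel hcand hA).trans
    (failProb_balancedSelection_le hcand hk)

section RandomFailure

variable {n k : ℕ} {p : Params} {tie : TieRule (Fin (n / k) × Fin k)}

theorem le_card_buffer_randomReady (u : Fin (n / k) × Fin k) :
    k ≤ (randomReady p (cliquePath n k) tie u).buffer.card + 1 := by
  classical
  refine (card_filter_cliqueDist_eq_zero u).symm.trans_le ((Finset.card_le_card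
    (t := insert u (randomReady p (cliquePath n k) tie u).buffer) fun v hv => ?_).trans
      (Finset.card_insert_le _ _))
  have huv := (Finset.mem_filter_univ v).1 hv
  rw [Finset.mem_insert, mem_buffer_randomReady]
  by_cases he : v.2 = u.2
  · exact .inl (eq_of_cliqueDist_eq_zero huv he)
  · exact .inr (adj_of_cliqueDist_eq_zero huv he)

theorem card_buffer_randomReady_le (u : Fin (n / k) × Fin k) :
    (randomReady p (cliquePath n k) tie u).buffer.card ≤ k + 3 := by
  classical
  have hsub : (randomReady p (cliquePath n k) tie u).buffer ⊆
      Finset.univ.filter (cliqueDist u · = 0) ∪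
        Finset.univ.filter fun v => cliqueDist u v = 1 ∧ v.2 = u.2 := fun v hv => by
    rw [Finset.mem_union, Finset.mem_filter_univ, Finset.mem_filter_univ]
    exact (cliquePath_adj.1 (mem_buffer_randomReady.1 hv)).symm.imp_left And.left
  refine (Finset.card_le_card hsub).trans ((Finset.card_union_le _ _).trans ?_)
  rw [card_filter_cliqueDist_eq_zero]
  exact Nat.add_le_add_left
    (card_le_three (u := u) u.2 fun w hw => .inr ((Finset.mem_filter_univ w).1 hw)) _

theorem exists_prob_randomReady (hk : 1 < k) (u : Fin (n / k) × Fin k) :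
    ∃ a : ℝ≥0, a ≠ 0 ∧ ∀ v, (randomReady p (cliquePath n k) tie u).prob v = a := by
  refine ⟨1 / ((randomReady p (cliquePath n k) tie u).buffer.card : ℝ≥0), ?_, fun v => rfl⟩
  have := le_card_buffer_randomReady (p := p) (tie := tie) u
  exact one_div_ne_zero (Nat.cast_ne_zero.2 (by lia))

theorem expect_prod_sent_random_le (hk : p.tau < k) (hk' : 1 < k)
    (W : Finset (Fin (n / k) × Fin k)) (f : Fin (n / k) × Fin k → Fin (n / k) × Fin k) (z : ℝ≥0∞)
    (hf : ∀ x ∈ W, f x = x ∨ (cliquePath n k).Adj x (f x)) :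
    expect (popRun (cliquePath n k) p.tau (randomReady p (cliquePath n k) tie))
        (fun σ => ∏ x ∈ W, if f x ∈ (σ x).sent then z else 1)
      ≤ ∏ x ∈ W, (randomReady p (cliquePath n k) tie x).sentFactor z p.tau (f x) :=
  expect_prod_sent_popRun_le W f z (fun x _ => exists_prob_randomReady hk' x)
    (fun x _ => by have := le_card_buffer_randomReady (p := p) (tie := tie) x; lia)
    fun x hx => (hf x hx).imp mem_sent_randomReady.2 mem_buffer_randomReady.2

theorem sentFactor_half_randomReady_le (hτ : 20 ≤ p.tau) (hk : 4 * p.tau ≤ k)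
    (x v : Fin (n / k) × Fin k) :
    (randomReady p (cliquePath n k) tie x).sentFactor (1 / 2) p.tau v
      ≤ ENNReal.ofReal (Real.exp (-(p.tau / (2 * (k + 3))))) := by
  have hk' : (4 * p.tau : ℝ) ≤ k := by exact_mod_cast hk
  have hτ' : (20 : ℝ) ≤ p.tau := by exact_mod_cast hτ
  unfold NodeState.sentFactor
  split_ifs
  · have hone : (1 / 2 : ℝ≥0∞) = hitFactor (1 / 2) 1 1 := by simp [hitFactor]
    rw [hone]
    refine hitFactor_half_le_ofReal_exp one_pos le_rfl ?_
    rw [Nat.cast_one, mul_one, neg_le_neg_iff, div_le_div_iff₀ (by positivity) two_pos]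
    linarith
  · have hlow := le_card_buffer_randomReady (p := p) (tie := tie) x
    have hup : ((randomReady p (cliquePath n k) tie x).buffer.card : ℝ) ≤ k + 3 := by
      exact_mod_cast card_buffer_randomReady_le (p := p) (tie := tie) x
    refine hitFactor_half_le_ofReal_exp (by lia) (by lia) ?_
    rw [neg_mul, neg_le_neg_iff, div_mul_eq_mul_div, div_le_div_iff₀ (by positivity) two_pos]
    nlinarith

theorem sentFactor_two_randomReady_le (hτ : 20 ≤ p.tau) (hk : 4 * p.tau ≤ k)
    {x v : Fin (n / k) × Fin k} (hadj : (cliquePath n k).Adj x v) :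
    (randomReady p (cliquePath n k) tie x).sentFactor 2 p.tau v
      ≤ ENNReal.ofReal (Real.exp (p.tau / (k - 1))) := by
  have hk' : (4 * p.tau : ℝ) ≤ k := by exact_mod_cast hk
  have hτ' : (20 : ℝ) ≤ p.tau := by exact_mod_cast hτ
  have hlow := le_card_buffer_randomReady (p := p) (tie := tie) x
  have hlow' : (k : ℝ) ≤ (randomReady p (cliquePath n k) tie x).buffer.card + 1 := by
    exact_mod_cast hlow
  rw [NodeState.sentFactor,
    if_neg (notMem_sent_of_mem_buffer_randomReady x _ (mem_buffer_randomReady.2 hadj))]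
  refine hitFactor_two_le_ofReal_exp (by lia) (by lia) ?_
  rw [div_mul_eq_mul_div, le_div_iff₀ (by linarith)]
  nlinarith

theorem failProb_cliqueHolders_random_le (hτ : 20 ≤ p.tau) (hk : 4 * p.tau ≤ k)
    (v : Fin (n / k) × Fin k) :
    failProb (popRun (cliquePath n k) p.tau (randomReady p (cliquePath n k) tie))
        (fun σ => p.tau + 8 ≤ 2 * (cliqueHolders (fun w => (σ w).sent) v v).card)
      ≤ ENNReal.ofReal (Real.exp (2 - p.tau / 10)) := by
  have hk' : (4 * p.tau : ℝ) ≤ k := by exact_mod_cast hk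
  have hτ' : (20 : ℝ) ≤ p.tau := by exact_mod_cast hτ
  have hexp : expect (popRun (cliquePath n k) p.tau (randomReady p (cliquePath n k) tie))
      (fun σ => ∏ x ∈ Finset.univ.filter (fun x => cliqueDist v x = 0),
        if v ∈ (σ x).sent then 1 / 2 else 1)
      ≤ ENNReal.ofReal (Real.exp (k * -(p.tau / (2 * (k + 3))))) := by
    refine (expect_prod_sent_random_le (by lia) (by lia) _ (fun _ => v) _ fun x hx => ?_).trans
      ((prod_le_ofReal_exp _ _ (-(p.tau / (2 * (k + 3))))
        fun x _ => sentFactor_half_randomReady_le hτ hk x v).trans_eq ?_)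
    · have hxv : cliqueDist x v = 0 := cliqueDist_comm v x ▸ (Finset.mem_filter_univ x).1 hx
      by_cases he : v.2 = x.2
      · exact .inl (eq_of_cliqueDist_eq_zero hxv he)
      · exact .inr (adj_of_cliqueDist_eq_zero hxv he)
    · rw [card_filter_cliqueDist_eq_zero]
  refine (failProb_mono fun σ _ hσ => ?_).trans
    ((failProb_lt_card_filter_le ((p.tau + 7) / 2) hexp).trans ?_)
  · rw [← cliqueHolders_eq_filter fun w => (σ w).sent] at hσ
    lia
  · refine ENNReal.ofReal_le_ofReal (Real.exp_le_exp.2 ?_)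
    have hhalf : (((p.tau + 7) / 2 : ℕ) : ℝ) ≤ (p.tau + 7) / 2 := by
      exact_mod_cast Nat.cast_div_le (α := ℝ) (m := p.tau + 7) (n := 2)
    have hmean : 0.48 * p.tau ≤ (k : ℝ) * (p.tau / (2 * (k + 3))) := by
      rw [← mul_div_assoc, le_div_iff₀ (by positivity)]
      nlinarith
    nlinarith [Real.log_two_gt_d9, Real.log_two_lt_d9]

theorem failProb_few_random_le (hτ : 20 ≤ p.tau) (hk : 4 * p.tau ≤ k)
    {u y : Fin (n / k) × Fin k} (huy : cliqueDist u y = 1) :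
    failProb (popRun (cliquePath n k) p.tau (randomReady p (cliquePath n k) tie))
        (fun σ => 2 * (Finset.univ.filter fun x =>
          cliqueDist u x = 0 ∧ (y.1, x.2) ∈ (σ x).sent).card ≤ 5 * p.tau)
      ≤ ENNReal.ofReal (Real.exp (2 - p.tau / 10)) := by
  have hk' : (4 * p.tau : ℝ) ≤ k := by exact_mod_cast hk
  have hτ' : (20 : ℝ) ≤ p.tau := by exact_mod_cast hτ
  have hexp : expect (popRun (cliquePath n k) p.tau (randomReady p (cliquePath n k) tie))
      (fun σ => ∏ x ∈ Finset.univ.filter (fun x => cliqueDist u x = 0),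
        if (y.1, x.2) ∈ (σ x).sent then 2 else 1)
      ≤ ENNReal.ofReal (Real.exp (k * (p.tau / (k - 1)))) := by
    have hadj (x) (hx : x ∈ Finset.univ.filter fun x => cliqueDist u x = 0) :
        (cliquePath n k).Adj x (y.1, x.2) :=
      cliquePath_adj.2 (.inl ⟨(cliqueDist_congr ((Finset.mem_filter_univ x).1 hx)).trans huy, rfl⟩)
    refine (expect_prod_sent_random_le (by lia) (by lia) _ (fun x => (y.1, x.2)) _
      fun x hx => .inr (hadj x hx)).trans
      ((prod_le_ofReal_exp _ _ (p.tau / (k - 1)) fun x hx =>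
        sentFactor_two_randomReady_le hτ hk (hadj x hx)).trans_eq ?_)
    rw [card_filter_cliqueDist_eq_zero]
  refine (failProb_mono fun σ _ hσ => ?_).trans
    ((failProb_card_filter_lt_le (5 * p.tau / 2 + 1) hexp).trans ?_)
  · rw [Finset.filter_filter] at hσ
    lia
  · refine ENNReal.ofReal_le_ofReal (Real.exp_le_exp.2 ?_)
    have hhalf : (5 * p.tau / 2 : ℝ) ≤ (5 * p.tau / 2 + 1 : ℕ) := by
      rw [div_le_iff₀ two_pos]
      exact_mod_cast (by lia : 5 * p.tau ≤ (5 * p.tau / 2 + 1) * 2)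
    have hmean : (k : ℝ) * (p.tau / (k - 1)) ≤ 1.1 * p.tau := by
      rw [← mul_div_assoc, div_le_iff₀ (by linarith)]
      nlinarith
    nlinarith [Real.log_two_gt_d9]

end RandomFailure

theorem failProb_rankingStart_zero_le {n k : ℕ} {p : Params}
    (tie : TieRule (Fin (n / k) × Fin k)) (hτ : 20 ≤ p.tau) (hk : 4 * p.tau ≤ k) :
    failProb (execution p (cliquePath n k) tie (p.rankingStart 0)) (RankingStart p 0)
      ≤ (Fintype.card (Fin (n / k) × Fin k) + (Fintype.card (Fin (n / k) × Fin k) : ℝ≥0∞) ^ 2)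
        * ENNReal.ofReal (Real.exp (2 - p.tau / 10)) := by
  have hrun : execution p (cliquePath n k) tie (p.rankingStart 0)
      = popRun (cliquePath n k) p.tau (randomReady p (cliquePath n k) tie) := by
    rw [Params.rankingStart, zero_mul, add_zero, execution_add, execution_one, PMF.pure_bind]
    exact run_eq_popRun (.inl rfl) (by lia) (fun j hj => p.stage_random hj) _
  rw [hrun, add_mul]
  have hmany := failProb_forall_le fun v => failProb_cliqueHolders_random_le (tie := tie) hτ hk v
  have hfew : failProb (popRun (cliquePath n k) p.tau (randomReady p (cliquePath n k) tie))
      (fun σ => ∀ u y, cliqueDist u y = 1 → 2 * (Finset.univ.filter fun x =>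
        cliqueDist u x = 0 ∧ (y.1, x.2) ∈ (σ x).sent).card ≤ 5 * p.tau)
      ≤ (Fintype.card (Fin (n / k) × Fin k) : ℝ≥0∞) ^ 2
        * ENNReal.ofReal (Real.exp (2 - p.tau / 10)) := by
    refine failProb_forall₂_le fun u y => ?_
    by_cases huy : cliqueDist u y = 1
    · exact (failProb_mono fun _ _ h _ => h).trans (failProb_few_random_le hτ hk huy)
    · exact (failProb_eq_zero fun _ _ huy' => absurd huy' huy).trans_le zero_le
  refine (failProb_mono fun σ hσ hgood => EvenlySent.rankingStart
    (popRel_of_popRun notMem_sent_of_mem_buffer_randomReady hσ) ⟨fun u => ?_, hgood.1, hgood.2⟩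
    (by lia)).trans ((failProb_and_le _ _ _).trans (add_le_add hmany hfew))
  refine (card_sent_le_of_mem_support_popRun hσ u).trans_eq ?_
  rw [show (randomReady p (cliquePath n k) tie u).sent = {u} from rfl, Finset.card_singleton,
    add_comm]

section Complete

variable {n k : ℕ} {p : Params} {tie : TieRule (Fin (n / k) × Fin k)} {ε₀ ε₁ ε₂ : ℝ≥0∞}

theorem ShuffleStart.complete {r : ℕ} {σ : Fin (n / k) × Fin k → NodeState _}
    (h : ShuffleStart p r σ) (hr : n / k ≤ r + 1) : Complete σ := by
  intro u v
  refine (h.known u v ?_).1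
  have := u.1.isLt
  have := v.1.isLt
  unfold cliqueDist
  lia

variable (h₀ : failProb (execution p (cliquePath n k) tie (p.rankingStart 0)) (RankingStart p 0)
    ≤ ε₀)
  (h₁ : ∀ r σ, RankingStart p r σ →
    failProb (run p (cliquePath n k) tie (p.rankingStart r) p.tauRank σ) (ShuffleStart p r) ≤ ε₁)
  (h₂ : ∀ r σ, ShuffleStart p r σ →
    failProb (run p (cliquePath n k) tie (p.rankingStart r + p.tauRank) (8 * p.tau) σ)
      (RankingStart p (r + 1)) ≤ ε₂)
include h₀ h₁ h₂

theorem failProb_rankingStart_le (r : ℕ) :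
    failProb (execution p (cliquePath n k) tie (p.rankingStart r)) (RankingStart p r)
      ≤ ε₀ + r * (ε₁ + ε₂) := by
  induction r with
  | zero => rwa [Nat.cast_zero, zero_mul, add_zero]
  | succ r ih =>
    rw [Params.rankingStart_succ, execution_add, execution_add]
    calc _ ≤ ε₀ + r * (ε₁ + ε₂) + ε₁ + ε₂ :=
          (failProb_bind_le fun σ _ hσ => h₂ r σ hσ).trans (add_le_add_left
            ((failProb_bind_le fun σ _ hσ => h₁ r σ hσ).trans (add_le_add_left ih _)) _)
      _ = ε₀ + (r + 1 : ℕ) * (ε₁ + ε₂) := by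
        push_cast
        ring

theorem failProb_complete_le {r : ℕ} (hr : n / k ≤ r + 1) :
    failProb (execution p (cliquePath n k) tie (p.rankingStart r + p.tauRank)) Complete
      ≤ ε₀ + (r + 1) * (ε₁ + ε₂) := by
  rw [execution_add]
  calc failProb _ Complete
      ≤ failProb _ (ShuffleStart p r) := failProb_mono fun σ _ hσ => hσ.complete hr
    _ ≤ ε₀ + r * (ε₁ + ε₂) + ε₁ := (failProb_bind_le fun σ _ hσ => h₁ r σ hσ).trans
        (add_le_add_left (failProb_rankingStart_le h₀ h₁ h₂ r) _)
    _ ≤ ε₀ + r * (ε₁ + ε₂) + (ε₁ + ε₂) := by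
        gcongr
        exact le_self_add
    _ = ε₀ + (r + 1) * (ε₁ + ε₂) := by ring

end Complete

theorem failProb_complete_le_mul {n k r : ℕ} {p : Params}
    (tie : TieRule (Fin (n / k) × Fin k)) {q : ℝ≥0} {δ : ℝ≥0∞} (hr : n / k = r + 1)
    (hτ : 20 ≤ p.tau) (hτ' : 0 < p.tauRank) (hk : 4 * p.tau ≤ k) (hc : p.cHat ≤ 1 / 2)
    (hc' : 4 < p.cHat * p.threshold)
    (hq : q * ((8 * p.tau : ℕ) * ∑ j ∈ Finset.range (Fintype.card (Fin (n / k) × Fin k)),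
      1 / ((j : ℝ≥0) + 1)) ≤ 1)
    (hδ : ENNReal.ofReal (Real.exp (2 - p.tau / 10)) ≤ δ)
    (hδ' : (1 - (q : ℝ≥0∞)) ^ p.tauRank ≤ δ) :
    failProb (execution p (cliquePath n k) tie (p.rankingStart r + p.tauRank)) Complete
      ≤ 5 * (Fintype.card (Fin (n / k) × Fin k) : ℝ≥0∞) ^ 3 * δ := by
  set M : ℝ≥0∞ := ((Fintype.card (Fin (n / k) × Fin k) : ℕ) : ℝ≥0∞) with hM
  have hrM : ((r + 1 : ℕ) : ℝ≥0∞) ≤ M := by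
    rw [hM, Fintype.card_prod, Fintype.card_fin, Fintype.card_fin, hr]
    exact_mod_cast Nat.le_mul_of_pos_right _ (by lia)
  have hM1 : 1 ≤ M := le_trans (by exact_mod_cast Nat.le_add_left 1 r) hrM
  calc failProb _ Complete
      ≤ (M + M ^ 2) * δ + (r + 1) * (M ^ 2 * δ + 2 * M ^ 2 * δ) :=
        failProb_complete_le
          ((failProb_rankingStart_zero_le tie hτ hk).trans (by gcongr))
          (fun r σ hσ =>
            (hσ.failProb_shuffleStart_le tie (by lia) hτ' hq).trans (by gcongr))
          (fun r σ hσ =>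
            (hσ.failProb_rankingStart_le tie (by lia) hc hc' hk).trans (by gcongr)) hr.le
    _ ≤ (M ^ 3 + M ^ 3) * δ + M * (M ^ 2 * δ + 2 * M ^ 2 * δ) := by
        gcongr ?_ * δ + ?_ * _
        · exact add_le_add (le_self_pow hM1 three_ne_zero) (pow_le_pow_right₀ hM1 (by lia))
        · exact_mod_cast hrM
    _ = 5 * M ^ 3 * δ := by ring

theorem one_sub_pow_le_ofReal_exp (q : ℝ≥0) (m : ℕ) :
    (1 - (q : ℝ≥0∞)) ^ m ≤ ENNReal.ofReal (Real.exp (-(m * q))) := by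
  have h : 1 - (q : ℝ≥0∞) ≤ ENNReal.ofReal (Real.exp (-q)) := by
    rw [← ENNReal.ofReal_coe_nnreal, ← ENNReal.ofReal_one, ← ENNReal.ofReal_sub 1 q.coe_nonneg]
    exact ENNReal.ofReal_le_ofReal (Real.one_sub_le_exp_neg q)
  refine (pow_le_pow_left' h m).trans_eq ?_
  rw [← ENNReal.ofReal_pow (Real.exp_pos _).le, ← Real.exp_nat_mul, mul_neg]

theorem sum_one_div_le_one_add_log (n : ℕ) :
    ((∑ j ∈ Finset.range n, 1 / ((j : ℝ≥0) + 1) : ℝ≥0) : ℝ) ≤ 1 + Real.log n := by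
  refine le_trans (le_of_eq ?_) (harmonic_le_one_add_log n)
  rw [harmonic]
  push_cast
  exact Finset.sum_congr rfl fun _ _ => one_div _

theorem log_le_mul_logb_two (n : ℕ) : Real.log n ≤ 7 / 10 * Real.logb 2 n := by
  rw [Real.logb, mul_div_assoc', le_div_iff₀ (Real.log_pos one_lt_two)]
  nlinarith [Real.log_natCast_nonneg n, Real.log_two_lt_d9]

theorem tendsto_logb_natCast_atTop : Tendsto (fun n : ℕ => Real.logb 2 n) atTop atTop :=
  (Real.tendsto_logb_atTop one_lt_two).comp tendsto_natCast_atTop_atTop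

theorem eventually_mul_logb_le {k : ℕ → ℕ}
    (hk : Tendsto (fun n : ℕ => (k n : ℝ) / Real.logb 2 n ^ 3) atTop atTop) (a : ℝ) :
    ∀ᶠ n : ℕ in atTop, a * Real.logb 2 n ≤ k n := by
  filter_upwards [hk.eventually_ge_atTop |a|, tendsto_logb_natCast_atTop.eventually_ge_atTop 1]
    with n hkn hl
  calc a * Real.logb 2 n ≤ |a| * Real.logb 2 n ^ 3 := by
        gcongr
        · exact le_abs_self a
        · exact le_self_pow₀ hl three_ne_zero
    _ ≤ k n := (le_div_iff₀ (by positivity)).1 hkn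

section Params

variable {c α d cHat : ℝ} {n k r : ℕ}

theorem le_tau : α * Real.logb 2 n ≤ (params α d cHat n).tau := Nat.le_ceil _

theorem tau_le (h : 1 ≤ α * Real.logb 2 n) :
    ((params α d cHat n).tau : ℝ) ≤ 2 * (α * Real.logb 2 n) :=
  (Nat.ceil_lt_add_one (by linarith)).le.trans (by linarith)

theorem le_tauRank :
    8 * d * (params α d cHat n).tau * Real.logb 2 n ^ 2 ≤ (params α d cHat n).tauRank :=
  Nat.le_ceil _

theorem tauRank_le (hd : 0 ≤ d) (h : 1 ≤ α * Real.logb 2 n) :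
    ((params α d cHat n).tauRank : ℝ) ≤ 16 * d * α * Real.logb 2 n ^ 3 + 1 := by
  refine (Nat.ceil_lt_add_one (by positivity)).le.trans (add_le_add_left ?_ 1)
  calc 8 * d * (params α d cHat n).tau * Real.logb 2 n ^ 2
      ≤ 8 * d * (2 * (α * Real.logb 2 n)) * Real.logb 2 n ^ 2 := by
        gcongr
        exact tau_le h
    _ = 16 * d * α * Real.logb 2 n ^ 3 := by ring

theorem rankingStart_add_tauRank_le_floor (hα : 1 ≤ α) (hd : 0 ≤ d) (hn : 1 ≤ Real.logb 2 n)
    (hk : 0 < k) (hkn : k ∣ n) (hr : n / k = r + 1) :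
    (params α d cHat n).rankingStart r + (params α d cHat n).tauRank
      ≤ ⌊(16 * d * α + 18 * α + 2) * (n * Real.logb 2 n ^ 3 / k)⌋₊ := by
  have hαn : 1 ≤ α * Real.logb 2 n := one_le_mul_of_one_le_of_one_le hα hn
  have hτ := tau_le (d := d) (cHat := cHat) hαn
  have hτ' := tauRank_le (cHat := cHat) hd hαn
  set p := params α d cHat n
  set l := Real.logb 2 (n : ℝ)
  have hl : l ≤ l ^ 3 := le_self_pow₀ hn three_ne_zero
  have hnk : (n : ℝ) * l ^ 3 / k = (r + 1) * l ^ 3 := by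
    have h : (n : ℝ) / k = r + 1 := by
      rw [← Nat.cast_div hkn (Nat.cast_ne_zero.2 hk.ne'), hr, Nat.cast_add_one]
    rw [mul_div_right_comm, h]
  have hτl : (p.tau : ℝ) ≤ 2 * α * l ^ 3 := by nlinarith
  rw [hnk]
  refine Nat.le_floor ?_
  calc ((p.rankingStart r + p.tauRank : ℕ) : ℝ)
      = 1 + p.tau + r * (p.tauRank + 8 * p.tau) + p.tauRank := by
        rw [Params.rankingStart]
        push_cast
        ring
    _ ≤ l ^ 3 + 2 * α * l ^ 3 + r * (16 * d * α * l ^ 3 + l ^ 3 + 8 * (2 * α * l ^ 3))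
        + (16 * d * α * l ^ 3 + l ^ 3) := by
        gcongr <;> linarith
    _ ≤ (16 * d * α + 18 * α + 2) * ((r + 1) * l ^ 3) := by
        have : 0 ≤ α * l ^ 3 := by positivity
        have : 0 ≤ (r : ℝ) * ((2 * α + 1) * l ^ 3) := by positivity
        nlinarith

theorem exp_two_sub_tau_div_ten_le (hc : 0 ≤ c) (hα : 7 * (c + 4) ≤ α) :
    Real.exp (2 - (params α d cHat n).tau / 10) ≤ 8 * Real.exp (-((c + 4) * Real.log n)) := by
  have hexp : Real.exp 2 ≤ 8 := by
    rw [← one_add_one_eq_two, Real.exp_add]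
    nlinarith [Real.exp_one_lt_d9, Real.exp_pos 1]
  have hτ : (c + 4) * Real.log n ≤ (params α d cHat n).tau / 10 := by
    have hlog := log_le_mul_logb_two n
    have hlogb : 0 ≤ Real.logb 2 (n : ℝ) := by linarith [Real.log_natCast_nonneg n]
    have hle := le_tau (α := α) (d := d) (cHat := cHat) (n := n)
    nlinarith
  rw [sub_eq_add_neg, Real.exp_add]
  gcongr

theorem one_sub_pow_tauRank_le (hc : 0 ≤ c) (hd : 7 * (c + 4) / 10 ≤ d) (hn : 0 < Real.logb 2 n)
    (hτ : 0 < (params α d cHat n).tau) {q : ℝ≥0}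
    (hq : (q : ℝ) = 1 / (8 * (params α d cHat n).tau * Real.logb 2 n)) :
    (1 - (q : ℝ≥0∞)) ^ (params α d cHat n).tauRank
      ≤ ENNReal.ofReal (Real.exp (-((c + 4) * Real.log n))) := by
  refine (one_sub_pow_le_ofReal_exp q _).trans (ENNReal.ofReal_le_ofReal (Real.exp_le_exp.2 ?_))
  rw [neg_le_neg_iff, hq, mul_one_div]
  have : (0 : ℝ) < (params α d cHat n).tau := Nat.cast_pos.2 hτ
  have hle := le_tauRank (α := α) (d := d) (cHat := cHat) (n := n)
  calc (c + 4) * Real.log n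
      ≤ (c + 4) * (7 / 10 * Real.logb 2 n) := by
        gcongr
        exact log_le_mul_logb_two n
    _ ≤ d * Real.logb 2 n := by nlinarith
    _ ≤ (params α d cHat n).tauRank / (8 * (params α d cHat n).tau * Real.logb 2 n) := by
        rw [le_div_iff₀ (by positivity)]
        linarith

theorem five_mul_pow_mul_ofReal_exp_le (hn : 40 ≤ n) :
    5 * (n : ℝ≥0∞) ^ 3 * ENNReal.ofReal (8 * Real.exp (-((c + 4) * Real.log n)))
      ≤ ENNReal.ofReal (1 / (n : ℝ) ^ c) := by
  have hn' : (40 : ℝ) ≤ n := by exact_mod_cast hn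
  have hn₀ : (0 : ℝ) < n := by linarith
  have hexp : Real.exp (-((c + 4) * Real.log n)) = 1 / ((n : ℝ) ^ c * (n : ℝ) ^ 4) := by
    rw [Real.exp_neg, ← one_div, mul_comm, ← Real.rpow_def_of_pos hn₀, Real.rpow_add hn₀]
    norm_cast
  rw [hexp, ← ENNReal.ofReal_natCast n, ← ENNReal.ofReal_pow hn₀.le, ← ENNReal.ofReal_ofNat 5,
    ← ENNReal.ofReal_mul (by norm_num), ← ENNReal.ofReal_mul (by positivity)]
  refine ENNReal.ofReal_le_ofReal ?_
  have : (0 : ℝ) < (n : ℝ) ^ c := Real.rpow_pos_of_pos hn₀ c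
  calc 5 * (n : ℝ) ^ 3 * (8 * (1 / ((n : ℝ) ^ c * (n : ℝ) ^ 4)))
      = 1 / (n : ℝ) ^ c * (40 / n) := by
        field_simp
        norm_num
    _ ≤ 1 / (n : ℝ) ^ c :=
        mul_le_of_le_one_right (by positivity) ((div_le_one hn₀).2 hn')

theorem failProb_complete_params_le (hc : 0 ≤ c) (hα : 7 * (c + 4) ≤ α)
    (hd : 7 * (c + 4) / 10 ≤ d) (hcHat : 0 ≤ cHat) (hcHat' : cHat ≤ 1 / 2) (hn : 40 ≤ n)
    (hn' : 4 ≤ Real.logb 2 n) (hnc : 8 < cHat * (α * Real.logb 2 n))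
    (hk : 8 * α * Real.logb 2 n ≤ k) (hkn : k ∣ n) (hr : n / k = r + 1)
    (tie : TieRule (Fin (n / k) × Fin k)) :
    failProb (execution (params α d cHat n) (cliquePath n k) tie
      ((params α d cHat n).rankingStart r + (params α d cHat n).tauRank)) Complete
        ≤ ENNReal.ofReal (1 / (n : ℝ) ^ c) := by
  have : 28 ≤ α := by linarith
  have hτle := le_tau (α := α) (d := d) (cHat := cHat) (n := n)
  have hτge := tau_le (α := α) (d := d) (cHat := cHat) (n := n) (by nlinarith)
  have hτ : 20 ≤ (params α d cHat n).tau := by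
    have : (20 : ℝ) ≤ (params α d cHat n).tau := by nlinarith
    exact_mod_cast this
  have : (0 : ℝ) < (params α d cHat n).tau := Nat.cast_pos.2 (by lia)
  have : 0 < Real.logb 2 (n : ℝ) := by linarith
  have : 0 < d := by linarith
  have hτ' : 0 < (params α d cHat n).tauRank :=
    Nat.cast_pos.1 (lt_of_lt_of_le (by positivity) (le_tauRank (α := α) (d := d) (cHat := cHat)))
  have hcard : Fintype.card (Fin (n / k) × Fin k) = n := by
    rw [Fintype.card_prod, Fintype.card_fin, Fintype.card_fin, Nat.div_mul_cancel hkn]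
  have hq := Real.coe_toNNReal (1 / (8 * (params α d cHat n).tau * Real.logb 2 n)) (by positivity)
  refine (failProb_complete_le_mul tie hr hτ hτ' ?_ hcHat' ?_ ?_
    (ENNReal.ofReal_le_ofReal (exp_two_sub_tau_div_ten_le hc hα))
    ((one_sub_pow_tauRank_le hc hd (by linarith) (by lia) hq).trans
      (ENNReal.ofReal_le_ofReal ?_))).trans ?_
  · have : 4 * ((params α d cHat n).tau : ℝ) ≤ k := by linarith
    exact_mod_cast this
  · change 4 < cHat * ((params α d cHat n).tau / 2)
    nlinarith
  · rw [hcard, ← NNReal.coe_le_coe, NNReal.coe_mul, NNReal.coe_mul, hq, NNReal.coe_natCast,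
      NNReal.coe_one, div_mul_eq_mul_div, one_mul, div_le_one (by positivity)]
    push_cast
    gcongr
    have := sum_one_div_le_one_add_log n
    have := log_le_mul_logb_two n
    push_cast at *
    linarith
  · exact le_mul_of_one_le_left (Real.exp_pos _).le (by norm_num)
  · rw [hcard]
    exact five_mul_pow_mul_ofReal_exp_le hn

end Params

theorem one_sub_le_probComplete {V : Type*} [Fintype V] [DecidableEq V] {p : Params}
    {G : SimpleGraph V} {tie : TieRule V} {s t : ℕ} {ε : ℝ≥0∞} (hst : s ≤ t)
    (h : failProb (execution p G tie s) Complete ≤ ε) : 1 - ε ≤ probComplete p G tie t :=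
  (tsub_le_tsub_left ((failProb_complete_antitone p G tie hst).trans h) 1).trans
    (one_sub_failProb_le _ _)

end InfoSpreading

end

theorem mainTheorem3_general {c α d : ℝ} (hc : 0 ≤ c) (hα : 7 * (c + 4) ≤ α)
    (hd : 7 * (c + 4) / 10 ≤ d) :
    ∃ C : ℝ, 0 < C ∧
      ∀ cHat : ℝ, 0 < cHat → cHat ≤ 1 / 2 →
      ∀ᶠ n : ℕ in atTop, ∀ k : ℕ, 8 * α * Real.logb 2 n ≤ k → k ∣ n →
      ∀ tie : InfoSpreading.TieRule (Fin (n / k) × Fin k),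
        ENNReal.ofReal (1 - 1 / (n : ℝ) ^ c) ≤
          InfoSpreading.probComplete (InfoSpreading.params α d cHat n)
            (InfoSpreading.cliquePath n k) tie ⌊C * (n * Real.logb 2 n ^ 3 / k)⌋₊ := by
  have hα' : 28 ≤ α := by linarith
  have hd' : 0 ≤ d := by linarith
  refine ⟨16 * d * α + 18 * α + 2, by positivity, fun cHat hcHat hcHat' => ?_⟩
  have hlogb := InfoSpreading.tendsto_logb_natCast_atTop
  filter_upwards [eventually_ge_atTop 40, hlogb.eventually_ge_atTop 4,
    hlogb.eventually_gt_atTop (8 / (cHat * α))] with n hn hl hlc k hk hkn tie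
  have hk₀ : 0 < k := Nat.cast_pos.1 (lt_of_lt_of_le (by positivity) hk)
  obtain ⟨r, hr⟩ := Nat.exists_eq_add_one.2 (Nat.div_pos (Nat.le_of_dvd (by lia) hkn) hk₀)
  rw [div_lt_iff₀ (by positivity), mul_comm, mul_assoc] at hlc
  have hfail := InfoSpreading.failProb_complete_params_le hc hα hd hcHat.le hcHat' hn hl hlc hk hkn
    hr tie
  have htime := InfoSpreading.rankingStart_add_tauRank_le_floor (α := α) (cHat := cHat)
    (by linarith) hd' (by linarith) hk₀ hkn hr
  rw [ENNReal.ofReal_sub _ (by positivity), ENNReal.ofReal_one]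
  exact InfoSpreading.one_sub_le_probComplete htime hfail

theorem mainTheorem3 (c : ℝ) (hc : 1 ≤ c) (α d : ℝ) (hα : 48 * c + 96 < α) (hd : c + 3 < d) :
    ∃ C : ℝ, 0 < C ∧
      ∀ cHat : ℝ, 0 < cHat → cHat ≤ 1 / 2 →
      ∀ k : ℕ → ℕ, Filter.Tendsto (fun n : ℕ => (k n : ℝ) / Real.logb 2 n ^ 3)
          Filter.atTop Filter.atTop →
      ∀ᶠ n : ℕ in Filter.atTop, k n ∣ n →
      ∀ tie : InfoSpreading.TieRule (Fin (n / k n) × Fin (k n)),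
        ENNReal.ofReal (1 - 1 / (n : ℝ) ^ c) ≤
          InfoSpreading.probComplete (InfoSpreading.params α d cHat n)
            (InfoSpreading.cliquePath n (k n)) tie
            ⌊C * (n * Real.logb 2 n ^ 3 / k n)⌋₊ := by
  obtain ⟨C, hC, h⟩ := mainTheorem3_general (c := c) (α := α) (d := d) (by linarith) (by linarith)
    (by linarith)
  refine ⟨C, hC, fun cHat hcHat hcHat' k hk => ?_⟩
  filter_upwards [h cHat hcHat hcHat', InfoSpreading.eventually_mul_logb_le hk (8 * α)]
    with n hn hkn using hn (k n) hkn
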